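/- Let $a>0$, $c>0$ and $0<t<t_c:=a(a+2\sqrt c)$. Write $dA$ for area measure on $\mathbb C$, let $Q(z)=|z|^2+2c\log\frac1{|z-a|}$ (so $Q(a)=+\infty$), and for $\alpha\in(0,1)$ put $$\rho=\frac{t+a^2\alpha^2}{2a\alpha},\qquad \kappa=\frac{(1-\alpha^2)(t-a^2\alpha^2)}{2a\alpha},\qquad f(v)=\rho v-\frac{\kappa}{v-\alpha}-\frac{\kappa}{\alpha},$$ $$P(X)=X^3-\frac{a^2+4c+2t}{2a^2}X^2+\frac{t^2}{2a^4}.$$ (1) There is exactly one $\alpha$ with $0<\alpha<1$, $P(\alpha^2)=0$ and $\kappa>0$. (2) For this $\alpha$, let $K$ be the union of the closed curve $f(\{|v|=1\})$ and all bounded components of its complement. Then $f$ is injective with $f'\ne0$ on $\{|v|=1\}$, $\partial K=f(\{|v|=1\})$, the interior of $K$ is nonempty and connected, and $K$ is the closure of its interior. Moreover $K$ has the following property with the parameters $(\rho,\kappa,\alpha)$: $\rho>0$, $\kappa>0$, $0<\alpha<1$; $K$ is compact and simply connected, with area $\pi t$; $f$ maps $\{|v|>1\}$ conformally onto $\mathbb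 C\setminus K$; and, with $F:\mathbb C\setminus K\to\{|v|>1\}$ the inverse of $f$, the function $S(z)=f(1/F(z))$ is the Schwarz function of $K$, that is, $S$ has the boundary value $\overline z$ at every $z\in\partial K$, $S(z)-\frac c{z-a}$ is analytic in $\mathbb C\setminus K$ (after removal of a singularity at $a$), and $S(z)=\frac{c+t}{z}+O(z^{-2})$ as $z\to\infty$. Also $\kappa/\rho\le1-\alpha^2$. If a set $K'$ and real numbers $\rho',\kappa',\alpha'$ have the same property (with $f$ formed from $\rho',\kappa',\alpha'$), then $K'=K$ and $(\rho',\kappa',\alpha')=(\rho,\kappa,\alpha)$. (3) For every $z$ the integral $\int_K\log|z-w|\,dA(w)$ converges absolutely, and there is $\ell_{2D}\in\mathbb R$ such that the effective potential $$\mathcal U_{2D}(z)=Q(z)-\frac2\pi\int_K\log|z-w|\,dA(w)+\ell_{2D}\in(-\infty,+\infty]$$ satisfies (A) $\mathcal U_{2D}=0$ on $K$ and (B) $\mathcal U_{2D}>0$ on $\mathbb C\setminus K$; that is, the set of global minimum points of $\mathcal U_{2D}$ is exactly $K$. -/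

import Mathlib

open Set Filter Topology MeasureTheory

noncomputable section

namespace NormalMatrixModel

/-! ### The potential and the equilibrium conditions -/

/-- The external potential `Q(z) = |z|² + 2 c log (1 / |z - a|)`, with its value `+∞` at the
logarithmic singularity `z = a`. -/
def externalPotential (a c : ℝ) (z : ℂ) : EReal :=
  if z = (a : ℂ) then ⊤
  else ((‖z‖ ^ 2 + 2 * c * Real.log (1 / ‖z - (a : ℂ)‖) : ℝ) : EReal)

/-- The effective potential
`𝓤_2D(z) = Q(z) - (2 / π) ∫_K log |z - w| dA(w) + ℓ` of a set `K` with constant `ℓ`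
(`dA` is the area measure, that is `volume` on `ℂ`). -/
def effectivePotential (a c : ℝ) (K : Set ℂ) (l : ℝ) (z : ℂ) : EReal :=
  externalPotential a c z
    - ((2 / Real.pi * ∫ w in K, Real.log ‖z - w‖ : ℝ) : EReal) + (l : EReal)

/-- Condition (A), for the constant `ℓ`: the effective potential vanishes on `K`. -/
def ConditionA (a c : ℝ) (K : Set ℂ) (l : ℝ) : Prop :=
  ∀ z ∈ K, effectivePotential a c K l z = 0

/-- Condition (B), for the constant `ℓ`: the effective potential is positive off `K`. -/
def ConditionB (a c : ℝ) (K : Set ℂ) (l : ℝ) : Prop :=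
  ∀ z ∈ Kᶜ, 0 < effectivePotential a c K l z

/-! ### The rational map and its parameters -/

/-- The rational map `f(v) = ρ v - κ / (v - α) - κ / α`. -/
def ratMap (ρ κ α : ℝ) (v : ℂ) : ℂ :=
  (ρ : ℂ) * v - (κ : ℂ) / (v - (α : ℂ)) - (κ : ℂ) / (α : ℂ)

/-- The exterior `{|v| > 1}` of the closed unit disk. -/
def exteriorDisk : Set ℂ := {v : ℂ | 1 < ‖v‖}

/-- The unit circle `{|v| = 1}`. -/
def unitCircle : Set ℂ := {v : ℂ | ‖v‖ = 1}

/-- `P(X) = X³ - ((a² + 4c + 2t) / (2a²)) X² + t² / (2a⁴)`. -/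
def cubicP (a c t X : ℝ) : ℝ :=
  X ^ 3 - (a ^ 2 + 4 * c + 2 * t) / (2 * a ^ 2) * X ^ 2 + t ^ 2 / (2 * a ^ 4)

/-- `ρ = (t + a²α²) / (2aα)`. -/
def rhoParam (a t α : ℝ) : ℝ := (t + a ^ 2 * α ^ 2) / (2 * a * α)

/-- `κ = (1 - α²)(t - a²α²) / (2aα)`. -/
def kappaParam (a t α : ℝ) : ℝ := (1 - α ^ 2) * (t - a ^ 2 * α ^ 2) / (2 * a * α)

/-- `α` is an admissible parameter: `0 < α < 1`, `P(α²) = 0` and `κ > 0`. -/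
def IsAdmissibleAlpha (a c t α : ℝ) : Prop :=
  0 < α ∧ α < 1 ∧ cubicP a c t (α ^ 2) = 0 ∧ 0 < kappaParam a t α

/-- The compact region enclosed by the closed curve `f(|v| = 1)`: the curve together with all
points that lie in a bounded component of its complement. -/
def enclosedRegion (ρ κ α : ℝ) : Set ℂ :=
  {z : ℂ | z ∈ ratMap ρ κ α '' unitCircle ∨
    Bornology.IsBounded (connectedComponentIn (ratMap ρ κ α '' unitCircle)ᶜ z)}

/-! ### Schwarz functions and the conformal description of the region -/

/-- `S` (of which only the values on `Kᶜ` matter) is the Schwarz function of the compact set `K`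
of area `π t`: it has boundary value `conj z` on `∂K`; `S(z) - c / (z - a)` is analytic in `Kᶜ`
(extended over `z = a`, where `S` itself has the value `∞`); and
`S(z) = (c + t) / z + O(z⁻²)` at infinity. -/
structure IsSchwarzFunction (a c t : ℝ) (K : Set ℂ) (S : ℂ → ℂ) : Prop where
  isCompact : IsCompact K
  area : volume K = ENNReal.ofReal (Real.pi * t)
  boundary : ∀ z ∈ frontier K, Tendsto S (𝓝[Kᶜ] z) (𝓝 (starRingEnd ℂ z))
  analytic : ∃ h : ℂ → ℂ, AnalyticOnNhd ℂ h Kᶜ ∧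
    ∀ z ∈ Kᶜ, z ≠ (a : ℂ) → S z - (c : ℂ) / (z - (a : ℂ)) = h z
  atInfinity : (fun z : ℂ => S z - ((c : ℂ) + (t : ℂ)) / z)
    =O[cocompact ℂ] (fun z : ℂ => (z ^ 2)⁻¹)

/-- The inverse `F` of `f` on the exterior of the closed unit disk (used only where `f` maps
`{|v| > 1}` bijectively onto the complement of `K`). -/
def ratMapInv (ρ κ α : ℝ) : ℂ → ℂ := Function.invFunOn (ratMap ρ κ α) exteriorDisk

/-- `K` is a simply connected compact set whose complement is the conformal image of `{|v| > 1}`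
under `f`, with `ρ, κ > 0` and `0 < α < 1`, such that `S(z) = f(1 / F(z))`, with `F` the inverse
of `f`, is the Schwarz function of `K`. -/
structure IsConformalRegion (a c t : ℝ) (K : Set ℂ) (ρ κ α : ℝ) : Prop where
  rho_pos : 0 < ρ
  kappa_pos : 0 < κ
  alpha_pos : 0 < α
  alpha_lt_one : α < 1
  isCompact : IsCompact K
  isSimplyConnected : IsSimplyConnected K
  holomorphic : AnalyticOnNhd ℂ (ratMap ρ κ α) exteriorDisk
  bijective : BijOn (ratMap ρ κ α) exteriorDisk Kᶜ
  schwarz : IsSchwarzFunction a c t K (fun z => ratMap ρ κ α (1 / ratMapInv ρ κ α z))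

end NormalMatrixModel

end

open NormalMatrixModel

/-!
The proof rests on an explicit description of the region `K`, the complement of `f({|v| > 1})`.

*Univalence and topology.* For `κ < ρ (1 - α²)` the second root `v` of `f(v) = f(w)` lies in the
unit disk for all `|w| ≥ 1`, so that `f` is injective on `{|v| ≥ 1}` with a Lipschitz inverse
(`IsUnivalentParam.exists_mul_norm_sub_le`). There is a real `x > 1` with `f(x) = f(1/x)`; a Möbius
map that preserves the circle and sends `x` to `∞` turns `1 / (f - f(x))` into an affine function of
a Joukowski map `u + r / u`, `|r| < 1`. Hence `K` is the inversion of a filled ellipse, and it is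
homeomorphic to the closed disk (`IsUnivalentParam.exists_disk_parametrization`). This gives all the
topological claims.

*Parameters.* The pole of `S` at `f(1/α)`, its residue, and its leading coefficient at infinity give
three equations for `(ρ, κ, α)` (`IsConformalRegion.isMatched`). They amount to the formulas for
`ρ` and `κ` together with the cubic equation for `α²`, which has a single admissible root
(`existsUnique_isAdmissibleAlpha`).

*Potential.* Let `gradField` be `conj z - c / (z - a)` on `K` and `S(z) - c / (z - a)` outside. The
two expressions agree on the boundary curve, so the field is globally Lipschitz, and it is
`∂U/∂z` for an explicit function `U` (`potential`) with `U = 2 t log |z| + const + o(1)` at infinity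
and Laplacian `4` on `K`, `0` off `K`. Testing this against the logarithm cut off near its pole and at a
large radius, in polar coordinates, identifies `U` with `2 / π` times the logarithmic potential of
`K`, up to a constant, and the area of `K` with `π t` (`area_and_integral_log`). So the effective
potential is explicit, and it is constant on `K`.

*Positivity.* Off `K` the critical points of the effective potential are the solutions of
`S(z) = conj z`. They are real, and at them `S' < -1`, which makes the second derivative in the
vertical direction negative (`IsSecondZero.not_isLocalMin_reducedPotential`). The effective
potential is `+∞` at `a` and tends to `+∞` at infinity, so it cannot drop to its value on `K`
outside `K` without having a local minimum there (`IsSecondZero.lt_reducedPotential`).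
-/

namespace NormalMatrixModel

open Asymptotics

/-! ### The parameters -/

/-- The parameter range in which `f` is injective on `{|v| ≥ 1}`. -/
structure IsUnivalentParam (ρ κ α : ℝ) : Prop where
  rho_pos : 0 < ρ
  kappa_pos : 0 < κ
  alpha_pos : 0 < α
  alpha_lt_one : α < 1
  kappa_lt : κ < ρ * (1 - α ^ 2)

/-- The three equations that link `(ρ, κ, α)` to `(a, c, t)`: they express `f(1/α) = a`,
`κ f'(1/α) / α² = c` and `ρ f'(0) = c + t`. -/
structure IsMatched (a c t ρ κ α : ℝ) : Prop where
  image_pole : ρ / α - κ / (1 / α - α) - κ / α = a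
  residue_pole : κ * (ρ + κ / (1 / α - α) ^ 2) = c * α ^ 2
  residue_infinity : ρ * (ρ + κ / α ^ 2) = c + t

/-- The condition `κ > 0` says that `α² < t / a²`. The cubic `P` is positive at `0` and negative at
`min 1 (t / a²)`; the value at `1` is where `t < t_c` enters. -/
theorem existsUnique_isAdmissibleAlpha {a c t : ℝ} (ha : 0 < a) (hc : 0 < c) (ht : 0 < t)
    (htc : t < a * (a + 2 * Real.sqrt c)) : ∃! α : ℝ, IsAdmissibleAlpha a c t α := by
  have ha2 : 0 < a ^ 2 := by positivity
  -- `κ > 0` says that `α² < t / a²`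
  have kap : ∀ α : ℝ, 0 < α → α < 1 → (0 < kappaParam a t α ↔ α ^ 2 < t / a ^ 2) := by
    intro α h0 h1
    have h2 : 0 < 1 - α ^ 2 := by nlinarith
    unfold kappaParam
    rw [lt_div_iff₀ ha2, div_pos_iff_of_pos_right (by positivity), mul_pos_iff_of_pos_left h2]
    constructor <;> intro h <;> nlinarith
  have Pt : cubicP a c t (t / a ^ 2) < 0 := by
    have : cubicP a c t (t / a ^ 2) = -(2 * c * t ^ 2 / a ^ 6) := by
      unfold cubicP; field_simp; ring
    rw [this]; have : 0 < 2 * c * t ^ 2 / a ^ 6 := by positivity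
    linarith
  have P0 : 0 < cubicP a c t 0 := by
    unfold cubicP; have : 0 < t ^ 2 / (2 * a ^ 4) := by positivity
    simpa using this
  have P1 : a ^ 2 ≤ t → cubicP a c t 1 < 0 := by
    intro h
    have e : cubicP a c t 1 = ((a ^ 2 - t) ^ 2 - 4 * a ^ 2 * c) / (2 * a ^ 4) := by
      unfold cubicP; field_simp; ring
    rw [e]
    apply div_neg_of_neg_of_pos _ (by positivity)
    have hs : Real.sqrt c ^ 2 = c := Real.sq_sqrt hc.le
    have hs0 := Real.sqrt_nonneg c
    nlinarith [mul_nonneg ha.le hs0]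
  have cont : Continuous (cubicP a c t) := by unfold cubicP; fun_prop
  obtain ⟨m, hm0, hm1, hmt, hPm⟩ : ∃ m : ℝ, 0 < m ∧ m ≤ 1 ∧ m ≤ t / a ^ 2 ∧
      cubicP a c t m < 0 := by
    rcases le_total (t / a ^ 2) 1 with h | h
    · exact ⟨t / a ^ 2, by positivity, h, le_rfl, Pt⟩
    · exact ⟨1, one_pos, le_rfl, h, P1 (by rw [one_le_div ha2] at h; exact h)⟩
  obtain ⟨X, hX, hPX⟩ : ∃ X ∈ Ioo 0 m, cubicP a c t X = 0 := by
    have := intermediate_value_Ioo' hm0.le cont.continuousOn (f := cubicP a c t)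
    obtain ⟨X, hX, h⟩ := this (show (0 : ℝ) ∈ Ioo _ _ from ⟨hPm, P0⟩)
    exact ⟨X, hX, h⟩
  refine ⟨Real.sqrt X, ?_, ?_⟩
  · have h0 : 0 < Real.sqrt X := Real.sqrt_pos.2 hX.1
    have hs : Real.sqrt X ^ 2 = X := Real.sq_sqrt hX.1.le
    have h1 : Real.sqrt X < 1 := by
      rw [Real.sqrt_lt' one_pos]; have := hX.2; linarith
    refine ⟨h0, h1, by rw [hs, hPX], (kap _ h0 h1).2 ?_⟩
    rw [hs]; exact hX.2.trans_le hmt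
  · rintro β ⟨hb0, hb1, hPb, hkb⟩
    rw [kap β hb0 hb1] at hkb
    have hb2 : 0 < β ^ 2 := by positivity
    -- if `P(Y) = P(Z) = 0 > P(T)` with `Y < Z < T`, the second divided difference of
    -- `P = X³ - p X² + d` at these points gives `Y + Z + T < p`, while the first one at `Y, Z`
    -- gives `p (Y + Z) = Y² + Y Z + Z²`
    have key : ∀ Y Z : ℝ, 0 < Y → Y < Z → Z < t / a ^ 2 → cubicP a c t Y = 0 →
        cubicP a c t Z = 0 → False := by
      intro Y Z hY hYZ hZt h1 h2
      set T := t / a ^ 2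
      set p := (a ^ 2 + 4 * c + 2 * t) / (2 * a ^ 2)
      have hd : cubicP a c t 0 > 0 := P0
      have e : ∀ X, cubicP a c t X = X ^ 3 - p * X ^ 2 + cubicP a c t 0 := by
        intro X; simp [cubicP, p]
      rw [e] at h1 h2 Pt
      generalize cubicP a c t 0 = d at *
      have q1 : Z ^ 2 + Z * Y + Y ^ 2 = p * (Y + Z) := by
        have : (Z - Y) * (Z ^ 2 + Z * Y + Y ^ 2 - p * (Y + Z)) = 0 := by linear_combination h2 - h1
        rcases mul_eq_zero.1 this with h | h <;> linarith
      have q2 : (T - Z) * (T ^ 2 + T * Z + Z ^ 2 - p * (T + Z)) < 0 := by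
        have : (T - Z) * (T ^ 2 + T * Z + Z ^ 2 - p * (T + Z)) =
          T ^ 3 - p * T ^ 2 + d - (Z ^ 3 - p * Z ^ 2 + d) := by ring
        rw [this, h2]; linarith
      have q3 : T ^ 2 + T * Z + Z ^ 2 - p * (T + Z) < 0 := by
        by_contra h; push Not at h
        have := mul_nonneg (sub_nonneg.2 hZt.le) h; linarith
      have q4 : (T - Y) * (T + Z + Y - p) < 0 := by nlinarith
      have q5 : T + Z + Y - p < 0 := by
        by_contra h; push Not at h
        have := mul_nonneg (sub_nonneg.2 (hYZ.trans hZt).le) h; linarith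
      nlinarith [mul_pos hY (hY.trans hYZ),
          mul_pos (add_pos hY (hY.trans hYZ)) (hY.trans (hYZ.trans hZt))]
    have : β ^ 2 = X := by
      rcases lt_trichotomy (β ^ 2) X with h | h | h
      · exact (key _ _ hb2 h (hX.2.trans_le hmt) hPb hPX).elim
      · exact h
      · exact (key _ _ hX.1 h hkb hPX hPb).elim
    rw [← this, Real.sqrt_sq hb0.le]

theorem IsAdmissibleAlpha.isUnivalentParam {a c t α : ℝ} (ha : 0 < a) (ht : 0 < t)
    (h : IsAdmissibleAlpha a c t α) :
    IsUnivalentParam (rhoParam a t α) (kappaParam a t α) α := by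
  obtain ⟨h0, h1, -, hk⟩ := h
  have h2 : 0 < 1 - α ^ 2 := by nlinarith
  refine ⟨by unfold rhoParam; positivity, hk, h0, h1, ?_⟩
  have : rhoParam a t α * (1 - α ^ 2) - kappaParam a t α = (1 - α ^ 2) * (a * α) := by
    unfold rhoParam kappaParam; field_simp; ring
  have : 0 < (1 - α ^ 2) * (a * α) := by positivity
  linarith

theorem IsAdmissibleAlpha.isMatched {a c t α : ℝ} (ha : 0 < a)
    (h : IsAdmissibleAlpha a c t α) :
    IsMatched a c t (rhoParam a t α) (kappaParam a t α) α := by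
  obtain ⟨h0, h1, hP, -⟩ := h
  have h2 : 0 < 1 - α ^ 2 := by nlinarith
  have h3 : (1 : ℝ) / α - α ≠ 0 := by
    have : (1 : ℝ) / α - α = (1 - α ^ 2) / α := by field_simp
    rw [this]; positivity
  have h4 : (1 : ℝ) / α - α = (1 - α ^ 2) / α := by field_simp
  have hP' : 2 * a ^ 4 * α ^ 6 - a ^ 2 * (a ^ 2 + 4 * c + 2 * t) * α ^ 4 + t ^ 2 = 0 := by
    unfold cubicP at hP; field_simp at hP; linarith
  refine ⟨?_, ?_, ?_⟩
  · rw [h4]; unfold rhoParam kappaParam; field_simp; ring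
  · rw [h4]; unfold rhoParam kappaParam; field_simp; linear_combination hP'
  · unfold rhoParam kappaParam; field_simp; linear_combination hP'

/-- The matching equations determine `ρ` and `κ` through `α`, and give the cubic equation for
`α²`. -/
theorem IsMatched.eq_params {a c t ρ κ α : ℝ} (ha : 0 < a) (hα : 0 < α) (hα1 : α < 1)
    (hκ : 0 < κ) (h : IsMatched a c t ρ κ α) :
    IsAdmissibleAlpha a c t α ∧ ρ = rhoParam a t α ∧ κ = kappaParam a t α := by
  obtain ⟨e1, e2, e3⟩ := h
  have h2 : 0 < 1 - α ^ 2 := by nlinarith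
  have h4 : (1 : ℝ) / α - α = (1 - α ^ 2) / α := by field_simp
  rw [h4] at e1 e2
  obtain ⟨k, rfl⟩ : ∃ k, κ = k * (1 - α ^ 2) := ⟨κ / (1 - α ^ 2), by field_simp⟩
  have f1 : a = (ρ - k) / α := by rw [← e1]; field_simp; ring
  have f2 : c = k * (ρ * (1 - α ^ 2) + k * α ^ 2) / α ^ 2 := by
    rw [eq_div_iff (by positivity), ← e2]; field_simp
  have f3 : t = ρ ^ 2 - k ^ 2 := by
    have : t = ρ * (ρ + k * (1 - α ^ 2) / α ^ 2) - c := by linarith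
    rw [this, f2]; field_simp; ring
  have hρk : 0 < ρ - k := by
    have : ρ - k = a * α := by rw [f1]; field_simp
    rw [this]; positivity
  have g1 : ρ = rhoParam a t α := by
    unfold rhoParam; rw [f1, f3]; field_simp; ring
  have g2 : k * (1 - α ^ 2) = kappaParam a t α := by
    unfold kappaParam; rw [f1, f3]; field_simp; ring
  refine ⟨⟨hα, hα1, ?_, g2 ▸ hκ⟩, g1, g2⟩
  unfold cubicP; rw [f1, f2, f3]; field_simp; ring

/-! ### Injectivity of the rational map on the closed exterior of the disk -/

/-- The closed exterior `{|v| ≥ 1}` of the unit disk. -/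
def closedExterior : Set ℂ := {v : ℂ | 1 ≤ ‖v‖}

@[simp] theorem mem_closedExterior {v : ℂ} : v ∈ closedExterior ↔ 1 ≤ ‖v‖ := Iff.rfl

@[simp] theorem mem_exteriorDisk {v : ℂ} : v ∈ exteriorDisk ↔ 1 < ‖v‖ := Iff.rfl

@[simp] theorem mem_unitCircle {v : ℂ} : v ∈ unitCircle ↔ ‖v‖ = 1 := Iff.rfl

/-- The second zero of `f - f(w)`: the involution `w ↦ α - (κ/ρ) / (w - α)` satisfies
`f ∘ conjugateRoot = f`. It is written with `s = κ / (ρ (1 - α²))`, in the form which shows that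
it maps `{|w| ≥ 1}` into the disk of radius `s` about `α (1 - s)`. -/
noncomputable def conjugateRoot (ρ κ α : ℝ) (w : ℂ) : ℂ :=
  ((α * (1 - κ / (ρ * (1 - α ^ 2))) : ℝ) : ℂ) +
    ((κ / (ρ * (1 - α ^ 2)) : ℝ) : ℂ) * ((α * w - 1) / (w - α))

/-- The bound `s + α (1 - s)`, with `s = κ / (ρ (1 - α²))`, for `|conjugateRoot w|`, `|w| ≥ 1`. -/
noncomputable def conjugateRadius (ρ κ α : ℝ) : ℝ :=
  κ / (ρ * (1 - α ^ 2)) + α * (1 - κ / (ρ * (1 - α ^ 2)))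

theorem sub_ne_zero_of_closedExterior {α : ℝ} (h0 : 0 < α) (h1 : α < 1) {v : ℂ}
    (hv : v ∈ closedExterior) : v - α ≠ 0 := by
  intro h
  have : v = α := sub_eq_zero.1 h
  rw [this, mem_closedExterior, Complex.norm_real, Real.norm_of_nonneg h0.le] at hv
  linarith

theorem ne_zero_of_closedExterior {v : ℂ} (hv : v ∈ closedExterior) : v ≠ 0 := by
  rintro rfl
  rw [mem_closedExterior, norm_zero] at hv; linarith

theorem exteriorDisk_subset_closedExterior : exteriorDisk ⊆ closedExterior :=
  fun _ h => le_of_lt (mem_exteriorDisk.1 h)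

theorem unitCircle_subset_closedExterior : unitCircle ⊆ closedExterior :=
  fun _ h => ge_of_eq (mem_unitCircle.1 h)

theorem norm_mul_sub_one_le {α : ℝ} (h0 : 0 < α) (h1 : α < 1) {w : ℂ} (hw : 1 ≤ ‖w‖) :
    ‖(α : ℂ) * w - 1‖ ≤ ‖w - α‖ := by
  have h2 : 1 ≤ w.re * w.re + w.im * w.im := by
    rw [← Complex.normSq_apply, Complex.normSq_eq_norm_sq]; nlinarith
  refine le_of_sq_le_sq ?_ (norm_nonneg _)
  rw [Complex.sq_norm, Complex.sq_norm, Complex.normSq_apply, Complex.normSq_apply]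
  simp
  have : 0 < 1 - α ^ 2 := by nlinarith
  nlinarith

namespace IsUnivalentParam

variable {ρ κ α : ℝ} (hp : IsUnivalentParam ρ κ α)
include hp

theorem one_sub_sq_pos : 0 < 1 - α ^ 2 := by nlinarith [hp.alpha_pos, hp.alpha_lt_one]

theorem ratio_pos : 0 < κ / (ρ * (1 - α ^ 2)) :=
  div_pos hp.kappa_pos (mul_pos hp.rho_pos hp.one_sub_sq_pos)

theorem ratio_lt_one : κ / (ρ * (1 - α ^ 2)) < 1 := by
  rw [div_lt_one (mul_pos hp.rho_pos hp.one_sub_sq_pos)]; exact hp.kappa_lt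

theorem conjugateRadius_lt_one : conjugateRadius ρ κ α < 1 := by
  have := hp.ratio_lt_one; have := hp.alpha_lt_one
  unfold conjugateRadius; nlinarith

theorem norm_conjugateRoot_le {w : ℂ} (hw : w ∈ closedExterior) :
    ‖conjugateRoot ρ κ α w‖ ≤ conjugateRadius ρ κ α := by
  have hs := hp.ratio_pos
  have hs1 := hp.ratio_lt_one
  have hw' := sub_ne_zero_of_closedExterior hp.alpha_pos hp.alpha_lt_one hw
  have : ‖((α : ℂ) * w - 1) / (w - α)‖ ≤ 1 := by
    rw [norm_div]
    exact div_le_one_of_le₀ (norm_mul_sub_one_le hp.alpha_pos hp.alpha_lt_one hw) (norm_nonneg _)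
  unfold conjugateRoot conjugateRadius
  refine (norm_add_le _ _).trans ?_
  rw [norm_mul, Complex.norm_real, Complex.norm_real, Real.norm_of_nonneg hs.le,
    Real.norm_of_nonneg (mul_nonneg hp.alpha_pos.le (sub_nonneg.2 hs1.le))]
  nlinarith

/-- As a function of `v`, the difference `f(v) - f(w)` has the zeros `w` and `conjugateRoot w`. -/
theorem ratMap_sub_ratMap {v w : ℂ} (hv : v - α ≠ 0) (hw : w - α ≠ 0) :
    ratMap ρ κ α v - ratMap ρ κ α w = ρ * (v - w) * (v - conjugateRoot ρ κ α w) / (v - α) := by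
  have h1 : (ρ : ℂ) ≠ 0 := by exact_mod_cast hp.rho_pos.ne'
  have h2 : (1 - α ^ 2 : ℂ) ≠ 0 := by exact_mod_cast hp.one_sub_sq_pos.ne'
  have h3 : (α : ℂ) ≠ 0 := by exact_mod_cast hp.alpha_pos.ne'
  unfold ratMap conjugateRoot
  push_cast
  field_simp
  ring

theorem sub_conjugateRoot {w : ℂ} (hw : w - α ≠ 0) (v : ℂ) (hv : v - α ≠ 0) :
    (ρ : ℂ) * (v - conjugateRoot ρ κ α w) / (v - α) = ρ + κ / ((v - α) * (w - α)) := by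
  have h1 : (ρ : ℂ) ≠ 0 := by exact_mod_cast hp.rho_pos.ne'
  have h2 : (1 - α ^ 2 : ℂ) ≠ 0 := by exact_mod_cast hp.one_sub_sq_pos.ne'
  unfold conjugateRoot
  push_cast
  field_simp
  ring

/-- A positive lower bound for the difference quotients of `f` on `{|v| ≥ 1}`. -/
theorem exists_le_norm_quotient : ∃ m : ℝ, 0 < m ∧ ∀ v ∈ closedExterior, ∀ w ∈ closedExterior,
    m ≤ ‖(ρ : ℂ) + κ / ((v - α) * (w - α))‖ := by
  have hr := hp.conjugateRadius_lt_one
  have h0 := hp.alpha_pos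
  have hr0 : 0 < conjugateRadius ρ κ α := by
    unfold conjugateRadius
    have := hp.ratio_lt_one; have := hp.ratio_pos
    have := mul_pos h0 (sub_pos.2 hp.ratio_lt_one); linarith
  refine ⟨ρ * (1 - conjugateRadius ρ κ α) / (1 + α),
    div_pos (mul_pos hp.rho_pos (sub_pos.2 hr)) (by linarith), fun v hv w hw => ?_⟩
  have hv' := sub_ne_zero_of_closedExterior h0 hp.alpha_lt_one hv
  have hw' := sub_ne_zero_of_closedExterior h0 hp.alpha_lt_one hw
  rw [← hp.sub_conjugateRoot hw' v hv', norm_div, norm_mul, Complex.norm_real,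
    Real.norm_of_nonneg hp.rho_pos.le, div_le_div_iff₀ (by linarith) (norm_pos_iff.2 hv')]
  have a1 : ‖v‖ - conjugateRadius ρ κ α ≤ ‖v - conjugateRoot ρ κ α w‖ :=
    le_trans (sub_le_sub_left (hp.norm_conjugateRoot_le hw) _) (norm_sub_norm_le _ _)
  have a2 : ‖v - α‖ ≤ ‖v‖ + α := by
    refine (norm_sub_le _ _).trans_eq ?_
    rw [Complex.norm_real, Real.norm_of_nonneg h0.le]
  have hv1 : 1 ≤ ‖v‖ := hv
  have a3 : (1 - conjugateRadius ρ κ α) * ‖v - α‖ ≤ ‖v - conjugateRoot ρ κ α w‖ * (1 + α) := by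
    refine (mul_le_mul_of_nonneg_left a2 (sub_nonneg.2 hr.le)).trans
      (le_trans ?_ (mul_le_mul_of_nonneg_right a1 (by linarith)))
    nlinarith
  calc _ = ρ * ((1 - conjugateRadius ρ κ α) * ‖v - α‖) := by ring
    _ ≤ ρ * (‖v - conjugateRoot ρ κ α w‖ * (1 + α)) := mul_le_mul_of_nonneg_left a3 hp.rho_pos.le
    _ = _ := by ring

theorem ratMap_sub_eq_mul {v w : ℂ} (hv : v ∈ closedExterior) (hw : w ∈ closedExterior) :
    ratMap ρ κ α v - ratMap ρ κ α w = (v - w) * (ρ + κ / ((v - α) * (w - α))) := by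
  have hv' := sub_ne_zero_of_closedExterior hp.alpha_pos hp.alpha_lt_one hv
  have hw' := sub_ne_zero_of_closedExterior hp.alpha_pos hp.alpha_lt_one hw
  rw [hp.ratMap_sub_ratMap hv' hw', ← hp.sub_conjugateRoot hw' v hv']; ring

/-- The lower bound behind the injectivity of `f` on `{|v| ≥ 1}`; it also makes the inverse of `f`
Lipschitz up to the boundary curve. -/
theorem exists_mul_norm_sub_le : ∃ m : ℝ, 0 < m ∧ ∀ v ∈ closedExterior, ∀ w ∈ closedExterior,
    m * ‖v - w‖ ≤ ‖ratMap ρ κ α v - ratMap ρ κ α w‖ := by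
  obtain ⟨m, hm, h⟩ := hp.exists_le_norm_quotient
  refine ⟨m, hm, fun v hv w hw => ?_⟩
  rw [hp.ratMap_sub_eq_mul hv hw, norm_mul, mul_comm]
  exact mul_le_mul_of_nonneg_left (h v hv w hw) (norm_nonneg _)

theorem injOn_closedExterior : InjOn (ratMap ρ κ α) closedExterior := by
  obtain ⟨m, hm, h⟩ := hp.exists_mul_norm_sub_le
  intro v hv w hw e
  have := h v hv w hw
  rw [e, sub_self, norm_zero] at this
  have h2 : ‖v - w‖ ≤ 0 := by
    by_contra hh; push Not at hh; have := mul_pos hm hh; linarith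
  exact sub_eq_zero.1 (norm_le_zero_iff.1 h2)

end IsUnivalentParam

/-- The derivative `ρ + κ / (v - α)²` of `f`. -/
theorem hasDerivAt_ratMap (ρ κ α : ℝ) {v : ℂ} (hv : v - α ≠ 0) :
    HasDerivAt (ratMap ρ κ α) (ρ + κ / (v - α) ^ 2) v := by
  unfold ratMap
  have h1 : HasDerivAt (fun v : ℂ => (ρ : ℂ) * v) (ρ * 1) v := (hasDerivAt_id v).const_mul _
  have h2 : HasDerivAt (fun v : ℂ => (κ : ℂ) / (v - α)) ((0 * (v - α) - κ * 1) / (v - α) ^ 2) v :=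
    (hasDerivAt_const v (κ : ℂ)).div ((hasDerivAt_id v).sub_const _) hv
  refine ((h1.sub h2).sub_const _).congr_deriv ?_
  ring

namespace IsUnivalentParam

variable {ρ κ α : ℝ} (hp : IsUnivalentParam ρ κ α)
include hp

theorem deriv_ne_zero {v : ℂ} (hv : v ∈ closedExterior) : (ρ : ℂ) + κ / (v - α) ^ 2 ≠ 0 := by
  obtain ⟨m, hm, h⟩ := hp.exists_le_norm_quotient
  have := h v hv v hv
  rw [← pow_two] at this
  exact norm_pos_iff.1 (hm.trans_le this)

theorem continuousOn_ratMap : ContinuousOn (ratMap ρ κ α) closedExterior := fun _ hv =>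
  (hasDerivAt_ratMap ρ κ α
    (sub_ne_zero_of_closedExterior hp.alpha_pos hp.alpha_lt_one hv)).continuousAt.continuousWithinAt

end IsUnivalentParam

/-! ### The complement of the image is the inversion of a filled ellipse -/

/-- Filled ellipses and the Joukowski map: for real `|r| < 1`, every complex number is either of the
form `ζ + r conj ζ` with `|ζ| ≤ 1`, or of the form `u + r / u` with `|u| > 1`. -/
theorem exists_ellipse_or_joukowski {r : ℝ} (hr : |r| < 1) (n : ℂ) :
    (∃ ζ : ℂ, ‖ζ‖ ≤ 1 ∧ n = ζ + r * starRingEnd ℂ ζ) ∨ ∃ u : ℂ, 1 < ‖u‖ ∧ n = u + r / u := by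
  obtain ⟨d, hd⟩ := IsAlgClosed.exists_pow_nat_eq (n ^ 2 - 4 * r) (n := 2) two_pos
  set u := (n + d) / 2 with hu
  set w := (n - d) / 2 with hw
  have hsum : u + w = n := by rw [hu, hw]; ring
  have hprod : u * w = r := by
    have : (n + d) / 2 * ((n - d) / 2) = (n ^ 2 - d ^ 2) / 4 := by ring
    rw [hu, hw, this, hd]; ring
  by_cases h1 : 1 < ‖u‖
  · right
    have : u ≠ 0 := by rintro h; rw [h, norm_zero] at h1; linarith
    exact ⟨u, h1, by rw [← hprod, ← hsum]; field_simp⟩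
  by_cases h2 : 1 < ‖w‖
  · right
    have : w ≠ 0 := by rintro h; rw [h, norm_zero] at h2; linarith
    exact ⟨w, h2, by rw [← hprod, ← hsum]; field_simp; ring⟩
  left
  push Not at h1 h2
  have hr2 : 0 < 1 - r ^ 2 := by have := abs_lt.1 hr; nlinarith
  have hr2' : (1 - r ^ 2 : ℂ) ≠ 0 := by exact_mod_cast hr2.ne'
  refine ⟨(n - r * starRingEnd ℂ n) / (1 - r ^ 2), ?_, ?_⟩
  · -- since `r = u w`, the numerator is `u (1 - |w|²) + w (1 - |u|²)`
    have e : n - r * starRingEnd ℂ n =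
        u * ((1 - ‖w‖ ^ 2 : ℝ) : ℂ) + w * ((1 - ‖u‖ ^ 2 : ℝ) : ℂ) := by
      have hprod' : starRingEnd ℂ u * starRingEnd ℂ w = r := by
        rw [← map_mul, hprod, Complex.conj_ofReal]
      have c1 := Complex.mul_conj' u
      have c2 := Complex.mul_conj' w
      push_cast
      rw [← c1, ← c2, ← hsum, map_add]
      linear_combination (starRingEnd ℂ u + starRingEnd ℂ w) * hprod
    have hm : ‖u‖ * ‖w‖ = |r| := by rw [← norm_mul, hprod, Complex.norm_real, Real.norm_eq_abs]
    have e2 : ‖(1 - r ^ 2 : ℂ)‖ = 1 - (‖u‖ * ‖w‖) ^ 2 := by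
      rw [hm, sq_abs, ← Complex.ofReal_pow, ← Complex.ofReal_one, ← Complex.ofReal_sub,
        Complex.norm_real, Real.norm_of_nonneg hr2.le]
    have hpos : 0 < 1 - (‖u‖ * ‖w‖) ^ 2 := by rw [hm, sq_abs]; exact hr2
    rw [e, norm_div, e2, div_le_one hpos]
    refine (norm_add_le _ _).trans ?_
    have u0 := norm_nonneg u
    have w0 := norm_nonneg w
    rw [norm_mul, norm_mul, Complex.norm_real, Complex.norm_real,
      Real.norm_of_nonneg (by nlinarith), Real.norm_of_nonneg (by nlinarith)]
    -- `(m + n)(1 - mn) ≤ (1 + mn)(1 - mn)` because `m + n ≤ 1 + mn`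
    nlinarith [mul_nonneg (sub_nonneg.2 h1) (sub_nonneg.2 h2),
      mul_nonneg (mul_nonneg (sub_nonneg.2 h1) (sub_nonneg.2 h2))
        (sub_nonneg.2 (mul_le_one₀ h1 w0 h2))]
  · rw [map_div₀, map_sub, map_mul, Complex.conj_conj, map_sub, map_one, map_pow,
      Complex.conj_ofReal]
    field_simp
    ring

/-- The two alternatives of `exists_ellipse_or_joukowski` exclude each other. -/
theorem ellipse_ne_joukowski {r : ℝ} (hr : |r| < 1) {ζ u : ℂ} (hζ : ‖ζ‖ ≤ 1) (hu : 1 < ‖u‖) :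
    ζ + r * starRingEnd ℂ ζ ≠ u + r / u := by
  intro h
  have hu0 : u ≠ 0 := by rintro rfl; rw [norm_zero] at hu; linarith
  have h1 : u * (ζ - u) = r * (1 - starRingEnd ℂ ζ * u) := by
    field_simp at h; linear_combination h
  have h2 : ‖1 - starRingEnd ℂ ζ * u‖ ≤ ‖ζ - u‖ := by
    refine le_of_sq_le_sq ?_ (norm_nonneg _)
    have a1 : ζ.re * ζ.re + ζ.im * ζ.im ≤ 1 := by
      rw [← Complex.normSq_apply, Complex.normSq_eq_norm_sq]; nlinarith [norm_nonneg ζ]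
    have a2 : 1 ≤ u.re * u.re + u.im * u.im := by
      rw [← Complex.normSq_apply, Complex.normSq_eq_norm_sq]; nlinarith
    rw [Complex.sq_norm, Complex.sq_norm, Complex.normSq_apply, Complex.normSq_apply]
    simp
    nlinarith [mul_nonneg (sub_nonneg.2 a1) (sub_nonneg.2 a2)]
  have h3 : 0 < ‖ζ - u‖ := by
    rw [norm_pos_iff, sub_ne_zero]; rintro rfl; linarith
  have h4 := congrArg norm h1
  rw [norm_mul, norm_mul, Complex.norm_real, Real.norm_eq_abs] at h4
  have : |r| * ‖1 - starRingEnd ℂ ζ * u‖ ≤ |r| * ‖ζ - u‖ :=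
    mul_le_mul_of_nonneg_left h2 (abs_nonneg _)
  nlinarith

namespace IsUnivalentParam

variable {ρ κ α : ℝ} (hp : IsUnivalentParam ρ κ α)
include hp

/-- The real point `x > 1/α` with `f(x) = f(1/x)`, the equation being solved for `κ`. The inequality
`x (α x - 1) < x - α` is the condition `κ < ρ (1 - α²)` in terms of `x`. -/
theorem exists_real_double_point : ∃ x : ℝ, 1 < x ∧ 1 < α * x ∧ x * (α * x - 1) < x - α ∧
    κ = ρ * (x - α) * (α * x - 1) / x := by
  have h0 := hp.alpha_pos
  have h1 := hp.alpha_lt_one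
  have hρ := hp.rho_pos
  have hκ := hp.kappa_pos
  obtain ⟨q, rfl⟩ : ∃ q, κ = ρ * q := ⟨κ / ρ, by field_simp⟩
  have hq : 0 < q := pos_of_mul_pos_right hκ hρ.le
  have hq1 : q < 1 - α ^ 2 := lt_of_mul_lt_mul_left hp.kappa_lt hρ.le
  set p : ℝ → ℝ := fun x => α * x ^ 2 - (1 + α ^ 2 + q) * x + α with hpdef
  have c : Continuous p := by fun_prop
  have pa : p (1 / α) < 0 := by
    have : p (1 / α) = -(q / α) := by simp only [hpdef]; field_simp; ring
    rw [this]; have := div_pos hq h0; linarith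
  have pM : 0 < p ((1 + α ^ 2 + q) / α) := by
    have : p ((1 + α ^ 2 + q) / α) = α := by simp only [hpdef]; field_simp; ring
    rw [this]; exact h0
  have hle : 1 / α ≤ (1 + α ^ 2 + q) / α := by
    rw [div_le_div_iff_of_pos_right h0]; nlinarith
  obtain ⟨x, hx, hpx⟩ := intermediate_value_Ioo hle c.continuousOn
    (show (0 : ℝ) ∈ Ioo _ _ from ⟨pa, pM⟩)
  have hax : 1 < α * x := by have := hx.1; rw [div_lt_iff₀ h0] at this; linarith
  have hx1 : 1 < x := by nlinarith
  have hpx' : α * x ^ 2 - (1 + α ^ 2 + q) * x + α = 0 := hpx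
  refine ⟨x, hx1, hax, by nlinarith, ?_⟩
  rw [eq_div_iff (by linarith)]
  linear_combination (-ρ) * hpx'

end IsUnivalentParam

/-- The affine image `ζ ↦ n₀ + ζ + r conj ζ`, scaled by `A` and inverted about `b`. On the closed
unit disk it parametrizes the inversion of a filled ellipse. -/
noncomputable def invertedEllipse (b A n₀ r : ℝ) (ζ : ℂ) : ℂ :=
  b + (A * (n₀ + (ζ + r * starRingEnd ℂ ζ)))⁻¹

theorem ellipse_leftInverse {r : ℝ} (hr : |r| < 1) (ζ : ℂ) :
    ((ζ + r * starRingEnd ℂ ζ) - r * starRingEnd ℂ (ζ + r * starRingEnd ℂ ζ)) / (1 - r ^ 2 : ℂ)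
      = ζ := by
  have hr2 : 0 < 1 - r ^ 2 := by have := abs_lt.1 hr; nlinarith
  have hr2' : (1 - r ^ 2 : ℂ) ≠ 0 := by exact_mod_cast hr2.ne'
  rw [map_add, map_mul, Complex.conj_conj, Complex.conj_ofReal]
  field_simp
  ring

theorem ellipse_rightInverse {r : ℝ} (hr : |r| < 1) (n : ℂ) :
    (n - r * starRingEnd ℂ n) / (1 - r ^ 2 : ℂ) +
      r * starRingEnd ℂ ((n - r * starRingEnd ℂ n) / (1 - r ^ 2 : ℂ)) = n := by
  have hr2 : 0 < 1 - r ^ 2 := by have := abs_lt.1 hr; nlinarith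
  have hr2' : (1 - r ^ 2 : ℂ) ≠ 0 := by exact_mod_cast hr2.ne'
  rw [map_div₀, map_sub, map_mul, Complex.conj_conj, map_sub, map_one, map_pow,
    Complex.conj_ofReal]
  field_simp
  ring

/-- In the coordinate `u = (x v - 1) / (x - v)`, which maps the unit circle to itself and `x` to
`∞`, the function `1 / (f - f(x))` is an affine function of the Joukowski map `u + r / u`. -/
theorem ratMap_sub_mul_joukowski {ρ α x : ℝ} (hρ : ρ ≠ 0) (hx : 1 < x) (hxa : x - α ≠ 0)
    (v : ℂ) (hvx : (x : ℂ) - v ≠ 0) (hxv : (x : ℂ) * v - 1 ≠ 0) (hva : v - α ≠ 0) :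
    (ratMap ρ (ρ * (x - α) * (α * x - 1) / x) α v -
        ratMap ρ (ρ * (x - α) * (α * x - 1) / x) α x) *
      (((-(x * (x - α)) / (ρ * (x ^ 2 - 1) ^ 2) : ℝ) : ℂ) *
        (((x + -(x * (α * x - 1)) / (x - α) / x : ℝ) : ℂ) + ((x * v - 1) / (x - v) +
          ((-(x * (α * x - 1)) / (x - α) : ℝ) : ℂ) / ((x * v - 1) / (x - v))))) = 1 := by
  have hx0 : (x : ℂ) ≠ 0 := by exact_mod_cast (by linarith : x ≠ 0)
  have hρ' : (ρ : ℂ) ≠ 0 := by exact_mod_cast hρ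
  have hx2 : (x ^ 2 - 1 : ℂ) ≠ 0 := by exact_mod_cast (by nlinarith : x ^ 2 - 1 ≠ 0)
  have hxa' : (x - α : ℂ) ≠ 0 := by exact_mod_cast hxa
  have e1 : ratMap ρ (ρ * (x - α) * (α * x - 1) / x) α v -
        ratMap ρ (ρ * (x - α) * (α * x - 1) / x) α x =
            -(ρ * (x - v) * (x * v - 1) / (x * (v - α))) := by
    unfold ratMap
    push_cast
    field_simp
    ring
  have e2 : (((x + -(x * (α * x - 1)) / (x - α) / x : ℝ) : ℂ) + ((x * v - 1) / (x - v) +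
          ((-(x * (α * x - 1)) / (x - α) : ℝ) : ℂ) / ((x * v - 1) / (x - v)))) =
      (x ^ 2 - 1) ^ 2 * (v - α) / ((x - v) * (x * v - 1) * (x - α)) := by
    push_cast
    field_simp
    ring
  rw [e1, e2]
  push_cast
  field_simp

/-- The Möbius map `v ↦ (x v - 1) / (x - v)` preserves `{|v| > 1}`. -/
theorem norm_sub_lt_norm_mobius {x : ℝ} (hx : 1 < x) {v : ℂ} (hv : 1 < ‖v‖) :
    ‖(x : ℂ) - v‖ < ‖(x : ℂ) * v - 1‖ := by
  refine lt_of_pow_lt_pow_left₀ 2 (norm_nonneg _) ?_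
  have a2 : 1 < v.re * v.re + v.im * v.im := by
    rw [← Complex.normSq_apply, Complex.normSq_eq_norm_sq]; nlinarith
  rw [Complex.sq_norm, Complex.sq_norm, Complex.normSq_apply, Complex.normSq_apply]
  simp
  nlinarith [mul_pos (sub_pos.2 a2) (by nlinarith : 0 < x ^ 2 - 1)]

/-- The inverse Möbius map `u ↦ (x u + 1) / (u + x)` preserves `{|u| > 1}`. -/
theorem norm_add_lt_norm_mobius {x : ℝ} (hx : 1 < x) {u : ℂ} (hu : 1 < ‖u‖) :
    ‖u + (x : ℂ)‖ < ‖(x : ℂ) * u + 1‖ := by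
  have := norm_sub_lt_norm_mobius hx (v := -u) (by rwa [norm_neg])
  rw [sub_neg_eq_add, add_comm] at this
  rwa [mul_neg, ← neg_add', norm_neg] at this

theorem norm_mobius_eq_of_norm_one {x : ℝ} {v : ℂ} (hv : ‖v‖ = 1) :
    ‖(x : ℂ) - v‖ = ‖(x : ℂ) * v - 1‖ := by
  have h : v * starRingEnd ℂ v = 1 := by rw [Complex.mul_conj', hv]; norm_num
  have e : (x : ℂ) * v - 1 = v * starRingEnd ℂ (x - v) := by
    rw [map_sub, Complex.conj_ofReal, mul_sub, h]; ring
  rw [e, norm_mul, hv, one_mul, Complex.norm_conj]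

/-- The complement of `f({|v| > 1})` is a homeomorphic image of the closed unit disk, with the unit
circle going to `f({|v| = 1})`. -/
theorem IsUnivalentParam.exists_disk_parametrization {ρ κ α : ℝ} (hp : IsUnivalentParam ρ κ α) :
    ∃ Φ : ℂ → ℂ, ContinuousOn Φ (Metric.closedBall 0 1) ∧ InjOn Φ (Metric.closedBall 0 1) ∧
      IsOpen (Φ '' Metric.ball 0 1) ∧
      Φ '' Metric.closedBall 0 1 = (ratMap ρ κ α '' exteriorDisk)ᶜ ∧
      Φ '' Metric.sphere 0 1 = ratMap ρ κ α '' unitCircle := by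
  obtain ⟨x, hx, hax, hlt, hκ⟩ := hp.exists_real_double_point
  have hρ := hp.rho_pos
  have h0 := hp.alpha_pos
  have h1 := hp.alpha_lt_one
  have hxa : 0 < x - α := by linarith
  have hx2 : 0 < x ^ 2 - 1 := by nlinarith
  set b : ℝ := ρ * x - κ / (x - α) - κ / α with hb
  have hbf : ratMap ρ κ α x = b := by simp [ratMap, hb]
  set r : ℝ := -(x * (α * x - 1)) / (x - α) with hr
  set A : ℝ := -(x * (x - α)) / (ρ * (x ^ 2 - 1) ^ 2) with hA
  set n₀ : ℝ := x + r / x with hn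
  have hr1 : |r| < 1 := by
    rw [hr, abs_div, abs_neg, abs_of_pos hxa, abs_of_pos (by nlinarith), div_lt_one hxa]
    exact hlt
  have hA0 : (A : ℂ) ≠ 0 := by
    have : A ≠ 0 := div_ne_zero (by nlinarith) (by positivity)
    exact_mod_cast this
  have hx0 : (x : ℂ) ≠ 0 := by exact_mod_cast (by linarith : x ≠ 0)
  have hnorm_x : ‖(x : ℂ)‖ = x := by rw [Complex.norm_real, Real.norm_of_nonneg (by linarith)]
  -- `f - b` in the coordinate `u`
  have hf : ∀ v ∈ closedExterior, (x : ℂ) - v ≠ 0 →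
      (ratMap ρ κ α v - b) * (A * (n₀ + ((x * v - 1) / (x - v) + r / ((x * v - 1) / (x - v)))))
        = 1 := by
    intro v hv hvx
    have hxv : (x : ℂ) * v - 1 ≠ 0 := by
      intro h
      have : ‖(x : ℂ) * v‖ = 1 := by rw [sub_eq_zero.1 h, norm_one]
      rw [norm_mul, hnorm_x] at this
      have : 1 ≤ ‖v‖ := hv
      nlinarith
    have := ratMap_sub_mul_joukowski hρ.ne' hx hxa.ne' v hvx hxv
      (sub_ne_zero_of_closedExterior h0 h1 hv)
    rwa [← hκ, hbf] at this
  -- the filled ellipse avoids `0`: the point `-n₀` is the Joukowski image of `-x`, the value of the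
  -- coordinate `u` at `v = ∞`
  have hden : ∀ ζ : ℂ, ‖ζ‖ ≤ 1 → (n₀ : ℂ) + (ζ + r * starRingEnd ℂ ζ) ≠ 0 := by
    intro ζ hζ h
    refine ellipse_ne_joukowski hr1 hζ (u := -x) (by rw [norm_neg, hnorm_x]; exact hx) ?_
    rw [hn] at h; push_cast at h
    rw [div_neg]; linear_combination h
  have hsub : ∀ ζ : ℂ, invertedEllipse b A n₀ r ζ - b =
      (A * (n₀ + (ζ + r * starRingEnd ℂ ζ)))⁻¹ := by
    intro ζ; unfold invertedEllipse; ring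
  have hinj : ∀ ζ ζ' : ℂ, (ζ + r * starRingEnd ℂ ζ) = (ζ' + r * starRingEnd ℂ ζ') → ζ = ζ' := by
    intro ζ ζ' h
    rw [← ellipse_leftInverse hr1 ζ, h, ellipse_leftInverse hr1 ζ']
  refine ⟨invertedEllipse b A n₀ r, ?_, ?_, ?_, ?_, ?_⟩
  · intro ζ hζ
    have := hden ζ (mem_closedBall_zero_iff.1 hζ)
    apply ContinuousAt.continuousWithinAt
    unfold invertedEllipse
    refine continuousAt_const.add (ContinuousAt.inv₀ ?_ (mul_ne_zero hA0 this))
    have := Complex.continuous_conj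
    fun_prop
  · intro ζ _ ζ' _ h
    have h2 : invertedEllipse b A n₀ r ζ - b = invertedEllipse b A n₀ r ζ' - b := by rw [h]
    rw [hsub, hsub, inv_inj] at h2
    exact hinj _ _ (add_left_cancel (mul_left_cancel₀ hA0 h2))
  · -- the image of the open disk is cut out by a continuous inequality
    have : invertedEllipse b A n₀ r '' Metric.ball 0 1 = {z : ℂ | z ≠ b} ∩
        (fun z : ℂ => ((((z - b) * A)⁻¹ - n₀) - r * starRingEnd ℂ (((z - b) * A)⁻¹ - n₀)) /
          (1 - r ^ 2 : ℂ)) ⁻¹' Metric.ball 0 1 := by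
      ext z
      constructor
      · rintro ⟨ζ, hζ, rfl⟩
        have hd := hden ζ (mem_ball_zero_iff.1 hζ).le
        refine ⟨?_, ?_⟩
        · intro h
          have := hsub ζ
          rw [show invertedEllipse b A n₀ r ζ = b from h, sub_self] at this
          exact inv_ne_zero (mul_ne_zero hA0 hd) this.symm
        · have e : ((invertedEllipse b A n₀ r ζ - b) * A)⁻¹ - n₀ = ζ + r * starRingEnd ℂ ζ := by
            rw [hsub]; field_simp; ring
          rw [mem_preimage, e, ellipse_leftInverse hr1]; exact hζ
      · rintro ⟨hz, hζ⟩
        have hz' : z - b ≠ 0 := sub_ne_zero.2 hz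
        refine ⟨_, hζ, ?_⟩
        unfold invertedEllipse
        simp only
        rw [ellipse_rightInverse hr1]
        field_simp
        ring
    rw [this]
    refine ContinuousOn.isOpen_inter_preimage ?_ isOpen_ne Metric.isOpen_ball
    intro z hz
    have hz' : (z - b) * A ≠ 0 := mul_ne_zero (sub_ne_zero.2 hz) hA0
    apply ContinuousAt.continuousWithinAt
    have c := Complex.continuous_conj
    have c1 : ContinuousAt (fun z : ℂ => ((z - b) * A)⁻¹ - n₀) z :=
      (ContinuousAt.inv₀ (f := fun z : ℂ => (z - b) * A) (by fun_prop) hz').sub continuousAt_const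
    exact ((c1.sub (continuousAt_const.mul (c.continuousAt.comp c1)))).div_const _
  · ext z
    constructor
    · rintro ⟨ζ, hζ, rfl⟩ ⟨v, hv, hvz⟩
      rw [mem_closedBall_zero_iff] at hζ
      have hd := hden ζ hζ
      have hz := hsub ζ
      rw [← hvz] at hz
      by_cases hvx : (x : ℂ) - v = 0
      · rw [← sub_eq_zero.1 hvx, hbf, sub_self] at hz
        exact inv_ne_zero (mul_ne_zero hA0 hd) hz.symm
      · have := hf v (exteriorDisk_subset_closedExterior hv) hvx
        rw [hz, inv_mul_eq_one₀ (mul_ne_zero hA0 hd)] at this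
        refine ellipse_ne_joukowski hr1 hζ ?_ (add_left_cancel (mul_left_cancel₀ hA0 this))
        rw [norm_div, one_lt_div (norm_pos_iff.2 hvx)]
        exact norm_sub_lt_norm_mobius hx hv
    · intro hz
      have hzb : z - b ≠ 0 := by
        intro h
        exact hz ⟨x, by rw [mem_exteriorDisk, hnorm_x]; exact hx, by rw [hbf, sub_eq_zero.1 h]⟩
      rcases exists_ellipse_or_joukowski hr1 (((z - b) * A)⁻¹ - n₀) with ⟨ζ, hζ, e⟩ | ⟨u, hu, e⟩
      · refine ⟨ζ, mem_closedBall_zero_iff.2 hζ, ?_⟩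
        unfold invertedEllipse
        rw [← e]
        field_simp
        ring
      · exfalso
        have hu0 : u ≠ 0 := by rintro rfl; rw [norm_zero] at hu; linarith
        have hux : u + x ≠ 0 := by
          intro h
          have hu' : u = -x := eq_neg_of_add_eq_zero_left h
          have : ((z - b) * A)⁻¹ = 0 := by
            rw [sub_eq_iff_eq_add.1 e, hu', hn]; push_cast; field_simp; ring
          exact inv_ne_zero (mul_ne_zero hzb hA0) this
        set v : ℂ := (x * u + 1) / (u + x) with hv
        have hvn : 1 < ‖v‖ := by
          rw [hv, norm_div, one_lt_div (norm_pos_iff.2 hux)]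
          exact norm_add_lt_norm_mobius hx hu
        have e1 : (x : ℂ) - v = (x ^ 2 - 1) / (u + x) := by rw [hv]; field_simp; ring
        have hx2' : (x ^ 2 - 1 : ℂ) ≠ 0 := by exact_mod_cast hx2.ne'
        have hxv : (x : ℂ) - v ≠ 0 := by rw [e1]; exact div_ne_zero hx2' hux
        have e2 : ((x : ℂ) * v - 1) / (x - v) = u := by
          rw [e1, hv]; field_simp; ring
        have h3 := hf v hvn.le hxv
        rw [e2, ← e] at h3
        refine hz ⟨v, hvn, ?_⟩
        have h4 : (ratMap ρ κ α v - b) * (z - b)⁻¹ = 1 := by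
          rw [← h3]; field_simp; ring
        have h5 := (mul_inv_eq_one₀ hzb).1 h4
        exact sub_left_injective h5
  · have hmob : ∀ v : ℂ, ‖v‖ = 1 → (x : ℂ) - v ≠ 0 := by
      intro v hv h
      rw [← sub_eq_zero.1 h, hnorm_x] at hv; linarith
    have hconj : ∀ ζ : ℂ, ‖ζ‖ = 1 → starRingEnd ℂ ζ = 1 / ζ := by
      intro ζ h
      have h0 : ζ ≠ 0 := by rintro rfl; rw [norm_zero] at h; linarith
      rw [eq_div_iff h0, mul_comm, Complex.mul_conj', h]; norm_num
    have key : ∀ v : ℂ, ‖v‖ = 1 → ‖(x * v - 1) / ((x : ℂ) - v)‖ = 1 ∧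
        invertedEllipse b A n₀ r ((x * v - 1) / (x - v)) = ratMap ρ κ α v := by
      intro v hv
      have hu : ‖(x * v - 1) / ((x : ℂ) - v)‖ = 1 := by
        rw [norm_div, ← norm_mobius_eq_of_norm_one hv, div_self (norm_ne_zero_iff.2 (hmob v hv))]
      refine ⟨hu, ?_⟩
      have h3 := hf v hv.ge (hmob v hv)
      have h4 := hsub ((x * v - 1) / (x - v))
      rw [hconj _ hu, mul_one_div] at h4
      rw [← eq_inv_of_mul_eq_one_left h3] at h4
      exact sub_left_injective h4
    ext z
    constructor
    · rintro ⟨ζ, hζ, rfl⟩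
      rw [mem_sphere_zero_iff_norm] at hζ
      -- the inverse of `v ↦ (x v - 1) / (x - v)` is `ζ ↦ (x ζ + 1) / (ζ + x)`
      have hζx : ζ + x ≠ 0 := by
        intro h
        rw [eq_neg_of_add_eq_zero_left h, norm_neg, hnorm_x] at hζ; linarith
      have hv : ‖(x * ζ + 1) / (ζ + x)‖ = 1 := by
        have := norm_mobius_eq_of_norm_one (x := x) (v := -ζ) (by rwa [norm_neg])
        rw [sub_neg_eq_add, add_comm, mul_neg, ← neg_add', norm_neg] at this
        rw [norm_div, this, div_self (this ▸ norm_ne_zero_iff.2 hζx)]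
      have hx2' : (x ^ 2 - 1 : ℂ) ≠ 0 := by exact_mod_cast hx2.ne'
      have e1 : (x : ℂ) - (x * ζ + 1) / (ζ + x) = (x ^ 2 - 1) / (ζ + x) := by field_simp; ring
      have e2 : ((x : ℂ) * ((x * ζ + 1) / (ζ + x)) - 1) / (x - (x * ζ + 1) / (ζ + x)) = ζ := by
        rw [e1]; field_simp; ring
      refine ⟨_, hv, ?_⟩
      rw [← (key _ hv).2, e2]
    · rintro ⟨v, hv, rfl⟩
      exact ⟨_, mem_sphere_zero_iff_norm.2 (key v hv).1, (key v hv).2⟩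

/-! ### Topology of the region -/

/-- The complement of `f({|v| > 1})`. -/
def omittedSet (ρ κ α : ℝ) : Set ℂ := (ratMap ρ κ α '' exteriorDisk)ᶜ

theorem exteriorDisk_eq_compl : exteriorDisk = (Metric.closedBall (0 : ℂ) 1)ᶜ := by
  ext v; simp

theorem isPreconnected_exteriorDisk : IsPreconnected exteriorDisk := by
  have : exteriorDisk = (fun p : ℝ × ℂ => (p.1 : ℂ) * p.2) ''
      (Ioi (1 : ℝ) ×ˢ Metric.sphere (0 : ℂ) 1) := by
    ext v
    constructor
    · intro hv
      have hv : 1 < ‖v‖ := hv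
      have h0 : (‖v‖ : ℂ) ≠ 0 := by exact_mod_cast (by linarith : ‖v‖ ≠ 0)
      refine ⟨(‖v‖, v / ‖v‖), ⟨hv, ?_⟩, ?_⟩
      · rw [mem_sphere_zero_iff_norm, norm_div, Complex.norm_real, norm_norm, div_self]; linarith
      · simp only; field_simp
    · rintro ⟨⟨R, u⟩, ⟨hR, hu⟩, rfl⟩
      have hR : 1 < R := hR
      rw [mem_sphere_zero_iff_norm] at hu
      simp only at hu
      rw [mem_exteriorDisk, norm_mul, hu, Complex.norm_real, Real.norm_of_nonneg (by linarith)]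
      linarith
  rw [this]
  refine IsPreconnected.image ?_ _ (by fun_prop)
  refine isPreconnected_Ioi.prod (isPreconnected_sphere ?_ 0 1)
  rw [Complex.rank_real_complex]; norm_num

theorem closedExterior_eq_union : closedExterior = exteriorDisk ∪ unitCircle := by
  ext v
  simp only [mem_closedExterior, mem_union, mem_exteriorDisk, mem_unitCircle]
  rw [le_iff_lt_or_eq, eq_comm (a := (1 : ℝ))]

theorem closure_exteriorDisk : closure exteriorDisk = closedExterior := by
  rw [exteriorDisk_eq_compl, closure_compl, interior_closedBall _ one_ne_zero]
  ext v; simp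

namespace IsUnivalentParam

variable {ρ κ α : ℝ} (hp : IsUnivalentParam ρ κ α)
include hp

theorem isCompact_omittedSet : IsCompact (omittedSet ρ κ α) := by
  obtain ⟨Φ, hc, -, -, h, -⟩ := hp.exists_disk_parametrization
  rw [omittedSet, ← h]
  exact (isCompact_closedBall 0 1).image_of_continuousOn hc

theorem isSimplyConnected_omittedSet : IsSimplyConnected (omittedSet ρ κ α) := by
  obtain ⟨Φ, hc, hi, -, h, -⟩ := hp.exists_disk_parametrization
  rw [omittedSet, ← h]
  have : CompactSpace (Metric.closedBall (0 : ℂ) 1) :=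
    isCompact_iff_compactSpace.1 (isCompact_closedBall 0 1)
  have : ContractibleSpace (Metric.closedBall (0 : ℂ) 1) :=
    (convex_closedBall (0 : ℂ) 1).contractibleSpace ⟨0, by simp⟩
  let e : Metric.closedBall (0 : ℂ) 1 ≃ (Φ '' Metric.closedBall 0 1 : Set ℂ) :=
    Equiv.Set.imageOfInjOn Φ _ hi
  have he : Continuous e := by
    refine Continuous.subtype_mk (continuousOn_iff_continuous_domRestrict.1 hc) _
  have := ((he.homeoOfEquivCompactToT2).symm).contractibleSpace
  unfold IsSimplyConnected
  infer_instance

theorem image_unitCircle_subset_closure :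
    ratMap ρ κ α '' unitCircle ⊆ closure (ratMap ρ κ α '' exteriorDisk) := by
  refine Subset.trans ?_ (ContinuousOn.image_closure (s := exteriorDisk) ?_)
  · rw [closure_exteriorDisk]; exact image_mono unitCircle_subset_closedExterior
  · rw [closure_exteriorDisk]; exact hp.continuousOn_ratMap

theorem disjoint_images :
    Disjoint (ratMap ρ κ α '' exteriorDisk) (ratMap ρ κ α '' unitCircle) := by
  rw [Set.disjoint_left]
  rintro _ ⟨v, hv, rfl⟩ ⟨w, hw, e⟩
  have := hp.injOn_closedExterior (unitCircle_subset_closedExterior hw)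
    (exteriorDisk_subset_closedExterior hv) e
  rw [this] at hw
  have h1 : ‖v‖ = 1 := hw
  have h2 : 1 < ‖v‖ := hv
  linarith

theorem image_unitCircle_subset_omittedSet :
    ratMap ρ κ α '' unitCircle ⊆ omittedSet ρ κ α := fun _ h h' =>
  Set.disjoint_left.1 hp.disjoint_images h' h

theorem interior_omittedSet_eq_diff :
    interior (omittedSet ρ κ α) = omittedSet ρ κ α \ ratMap ρ κ α '' unitCircle := by
  obtain ⟨Φ, -, hi, ho, h, h'⟩ := hp.exists_disk_parametrization
  have e : omittedSet ρ κ α \ ratMap ρ κ α '' unitCircle = Φ '' Metric.ball 0 1 := by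
    rw [omittedSet, ← h, ← h', ← hi.image_sdiff_subset Metric.sphere_subset_closedBall,
      Metric.closedBall_sdiff_sphere]
  apply Subset.antisymm
  · intro z hz
    refine ⟨interior_subset hz, fun hz' => ?_⟩
    have := hp.image_unitCircle_subset_closure hz'
    rw [closure_eq_compl_interior_compl] at this
    exact this hz
  · rw [e]
    refine interior_maximal ?_ ho
    rw [← e]; exact sdiff_subset

theorem isConnected_interior_omittedSet : IsConnected (interior (omittedSet ρ κ α)) := by
  rw [hp.interior_omittedSet_eq_diff]
  obtain ⟨Φ, hc, hi, ho, h, h'⟩ := hp.exists_disk_parametrization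
  rw [omittedSet, ← h, ← h', ← hi.image_sdiff_subset Metric.sphere_subset_closedBall,
    Metric.closedBall_sdiff_sphere]
  exact ((convex_ball (0 : ℂ) 1).isConnected ⟨0, by simp⟩).image _
    (hc.mono Metric.ball_subset_closedBall)

theorem closure_interior_omittedSet : closure (interior (omittedSet ρ κ α)) = omittedSet ρ κ α := by
  apply Subset.antisymm
  · exact closure_minimal interior_subset hp.isCompact_omittedSet.isClosed
  · rw [hp.interior_omittedSet_eq_diff]
    obtain ⟨Φ, hc, hi, ho, h, h'⟩ := hp.exists_disk_parametrization
    rw [omittedSet, ← h, ← h', ← hi.image_sdiff_subset Metric.sphere_subset_closedBall,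
      Metric.closedBall_sdiff_sphere]
    have hcl : closure (Metric.ball (0 : ℂ) 1) = Metric.closedBall 0 1 :=
      closure_ball _ one_ne_zero
    rw [← hcl] at hc ⊢
    exact hc.image_closure

theorem frontier_omittedSet : frontier (omittedSet ρ κ α) = ratMap ρ κ α '' unitCircle := by
  rw [hp.isCompact_omittedSet.isClosed.frontier_eq, hp.interior_omittedSet_eq_diff,
    sdiff_sdiff_right_self, inter_eq_right]
  exact hp.image_unitCircle_subset_omittedSet

theorem isOpen_image_exteriorDisk : IsOpen (ratMap ρ κ α '' exteriorDisk) := by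
  have := hp.isCompact_omittedSet.isClosed.isOpen_compl
  rwa [omittedSet, compl_compl] at this

theorem image_closedExterior_eq_compl_interior :
    ratMap ρ κ α '' closedExterior = (interior (omittedSet ρ κ α))ᶜ := by
  rw [hp.interior_omittedSet_eq_diff, closedExterior_eq_union, image_union, sdiff_eq, compl_inter,
    compl_compl, omittedSet, compl_compl]

theorem isClosed_image_closedExterior : IsClosed (ratMap ρ κ α '' closedExterior) := by
  rw [hp.image_closedExterior_eq_compl_interior]
  exact isOpen_interior.isClosed_compl

theorem omittedSet_union_image : omittedSet ρ κ α ∪ ratMap ρ κ α '' closedExterior = univ := by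
  rw [hp.image_closedExterior_eq_compl_interior, eq_univ_iff_forall]
  intro z
  by_cases h : z ∈ interior (omittedSet ρ κ α)
  · exact Or.inl (interior_subset h)
  · exact Or.inr h

/-- The complement of the curve consists of the connected unbounded set `f({|v| > 1})` and of the
bounded interior of `omittedSet`. -/
theorem enclosedRegion_eq_omittedSet : enclosedRegion ρ κ α = omittedSet ρ κ α := by
  ext z
  constructor
  · rintro (hz | hz)
    · exact hp.image_unitCircle_subset_omittedSet hz
    · intro hz'
      -- otherwise the component of `z` contains the unbounded set `f({|v| > 1})`
      have hsub : ratMap ρ κ α '' exteriorDisk ⊆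
          connectedComponentIn (ratMap ρ κ α '' unitCircle)ᶜ z := by
        refine IsPreconnected.subset_connectedComponentIn ?_ hz' ?_
        · exact isPreconnected_exteriorDisk.image _
            (hp.continuousOn_ratMap.mono exteriorDisk_subset_closedExterior)
        · exact hp.disjoint_images.subset_compl_right
      have hb := (hz.subset hsub).union hp.isCompact_omittedSet.isBounded
      rw [omittedSet, union_compl_self] at hb
      exact NormedSpace.unbounded_univ ℝ ℂ hb
  · intro hz
    by_cases hc : z ∈ ratMap ρ κ α '' unitCircle
    · exact Or.inl hc
    · right
      have hzi : z ∈ interior (omittedSet ρ κ α) := by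
        rw [hp.interior_omittedSet_eq_diff]; exact ⟨hz, hc⟩
      refine hp.isCompact_omittedSet.isBounded.subset (Subset.trans ?_ interior_subset)
      refine IsPreconnected.subset_left_of_subset_union isOpen_interior
        hp.isOpen_image_exteriorDisk ?_ ?_ ⟨z, mem_connectedComponentIn hc, hzi⟩
        isPreconnected_connectedComponentIn
      · exact Set.disjoint_left.2 fun w hw hw' => interior_subset hw hw'
      · refine (connectedComponentIn_subset _ _).trans fun w hw => ?_
        rw [hp.interior_omittedSet_eq_diff]
        by_cases h : w ∈ ratMap ρ κ α '' exteriorDisk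
        · exact Or.inr h
        · exact Or.inl ⟨h, hw⟩

end IsUnivalentParam

/-! ### The inverse of the rational map -/

/-- The inverse of `f` on `f({|v| ≥ 1})`. -/
noncomputable def closedInv (ρ κ α : ℝ) : ℂ → ℂ := Function.invFunOn (ratMap ρ κ α) closedExterior

namespace IsUnivalentParam

variable {ρ κ α : ℝ} (hp : IsUnivalentParam ρ κ α)
include hp

theorem closedInv_ratMap {v : ℂ} (hv : v ∈ closedExterior) :
    closedInv ρ κ α (ratMap ρ κ α v) = v :=
  hp.injOn_closedExterior.leftInvOn_invFunOn hv

theorem ratMapInv_ratMap {v : ℂ} (hv : v ∈ exteriorDisk) :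
    ratMapInv ρ κ α (ratMap ρ κ α v) = v :=
  (hp.injOn_closedExterior.mono exteriorDisk_subset_closedExterior).leftInvOn_invFunOn hv

theorem exists_lipschitzOnWith_closedInv :
    ∃ C, LipschitzOnWith C (closedInv ρ κ α) (ratMap ρ κ α '' closedExterior) := by
  obtain ⟨m, hm, h⟩ := hp.exists_mul_norm_sub_le
  refine ⟨Real.toNNReal m⁻¹, LipschitzOnWith.of_dist_le_mul ?_⟩
  rintro _ ⟨v, hv, rfl⟩ _ ⟨w, hw, rfl⟩
  rw [hp.closedInv_ratMap hv, hp.closedInv_ratMap hw, dist_eq_norm, dist_eq_norm,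
      Real.coe_toNNReal _ (inv_pos.2 hm).le,
    inv_mul_eq_div, le_div_iff₀ hm, mul_comm]
  exact h v hv w hw

/-- The derivative of the inverse of `f`, one-sided at the points of the boundary curve. -/
theorem hasDerivWithinAt_closedInv {v : ℂ} (hv : v ∈ closedExterior) :
    HasDerivWithinAt (closedInv ρ κ α) ((ρ : ℂ) + κ / (v - α) ^ 2)⁻¹
      (ratMap ρ κ α '' closedExterior) (ratMap ρ κ α v) := by
  obtain ⟨C, hC⟩ := hp.exists_lipschitzOnWith_closedInv
  have hd := hasDerivAt_ratMap ρ κ α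
    (sub_ne_zero_of_closedExterior hp.alpha_pos hp.alpha_lt_one hv)
  have hne := hp.deriv_ne_zero hv
  have hmem : ratMap ρ κ α v ∈ ratMap ρ κ α '' closedExterior := mem_image_of_mem _ hv
  have := HasFDerivWithinAt.of_local_left_inverse (g := closedInv ρ κ α) (f := ratMap ρ κ α)
    (f' := ContinuousLinearEquiv.unitsEquivAut ℂ (Units.mk0 _ hne)) (a := ratMap ρ κ α v)
    (s := ratMap ρ κ α '' closedExterior) (t := univ)
    (by rw [nhdsWithin_univ]; exact (hC.continuousOn _ hmem))
    (by rw [hp.closedInv_ratMap hv]; exact hd.hasFDerivAt.hasFDerivWithinAt)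
    hmem ?_
  · exact this
  · filter_upwards [self_mem_nhdsWithin] with z hz
    obtain ⟨w, hw, rfl⟩ := hz
    rw [hp.closedInv_ratMap hw]

end IsUnivalentParam

/-! ### Behaviour at infinity and at the pole -/

/-- The quotient `f(w) / w`, extended over `w = 0`. -/
noncomputable def quotAtZero (ρ κ α : ℝ) (w : ℂ) : ℂ := ρ + κ / (α * (α - w))

/-- The product `w f(1/w)`, extended over `w = 0`. -/
noncomputable def mulAtInfinity (ρ κ α : ℝ) (w : ℂ) : ℂ :=
  ρ - κ * w ^ 2 / (1 - α * w) - κ / α * w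

theorem ratMap_eq_mul_quotAtZero {ρ κ α : ℝ} (h0 : α ≠ 0) {w : ℂ} (hw : w - α ≠ 0) :
    ratMap ρ κ α w = w * quotAtZero ρ κ α w := by
  have h0' : (α : ℂ) ≠ 0 := by exact_mod_cast h0
  have hw' : (α : ℂ) - w ≠ 0 := by rw [← neg_sub]; exact neg_ne_zero.2 hw
  unfold ratMap quotAtZero
  rw [← neg_sub (α : ℂ) w]
  field_simp
  ring

/-- No condition at `w = 1/α` is needed, where both sides have the same junk value. -/
theorem ratMap_inv_eq {ρ κ α : ℝ} {w : ℂ} (h : w ≠ 0) :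
    ratMap ρ κ α w⁻¹ = w⁻¹ * mulAtInfinity ρ κ α w := by
  have e : w⁻¹ - (α : ℂ) = (1 - α * w) / w := by field_simp
  unfold ratMap mulAtInfinity
  rw [e]
  field_simp

theorem differentiableAt_quotAtZero (ρ κ α : ℝ) (h0 : α ≠ 0) :
    DifferentiableAt ℂ (quotAtZero ρ κ α) 0 := by
  have h0' : (α : ℂ) ≠ 0 := by exact_mod_cast h0
  unfold quotAtZero
  refine (differentiableAt_const _).add ((differentiableAt_const _).div (by fun_prop) ?_)
  simp [h0']

theorem differentiableAt_mulAtInfinity (ρ κ α : ℝ) :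
    DifferentiableAt ℂ (mulAtInfinity ρ κ α) 0 := by
  unfold mulAtInfinity
  refine ((differentiableAt_const _).sub (DifferentiableAt.div (by fun_prop) (by fun_prop) ?_)).sub
    (by fun_prop)
  simp

theorem mulAtInfinity_zero (ρ κ α : ℝ) : mulAtInfinity ρ κ α 0 = ρ := by simp [mulAtInfinity]

theorem quotAtZero_zero (ρ κ α : ℝ) : quotAtZero ρ κ α 0 = ((ρ + κ / α ^ 2 : ℝ) : ℂ) := by
  simp [quotAtZero, pow_two]

theorem eventually_sub_ne_zero {α : ℝ} (h0 : α ≠ 0) : ∀ᶠ w in 𝓝 (0 : ℂ), w - (α : ℂ) ≠ 0 := by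
  have : ContinuousAt (fun w : ℂ => w - (α : ℂ)) 0 := by fun_prop
  exact this.eventually_ne (by simp [h0])

theorem tendsto_ratMap_cocompact {ρ κ α : ℝ} (hρ : ρ ≠ 0) :
    Tendsto (ratMap ρ κ α) (cocompact ℂ) (cocompact ℂ) := by
  rw [← Metric.cobounded_eq_cocompact]
  have hi : Tendsto (fun v : ℂ => v⁻¹) (Bornology.cobounded ℂ) (𝓝 0) := tendsto_inv₀_cobounded
  have h1 : Tendsto (fun v : ℂ => ‖v‖ * ‖mulAtInfinity ρ κ α v⁻¹‖)
      (Bornology.cobounded ℂ) atTop := by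
    refine Tendsto.atTop_mul_pos (norm_pos_iff.2 ?_) tendsto_norm_cobounded_atTop
      (((differentiableAt_mulAtInfinity ρ κ α).continuousAt.tendsto.comp hi).norm)
    rw [mulAtInfinity_zero]; exact_mod_cast hρ
  rw [← tendsto_norm_atTop_iff_cobounded]
  refine h1.congr' ?_
  filter_upwards [Bornology.eventually_ne_cobounded (0 : ℂ)] with v hv0
  have := ratMap_inv_eq (ρ := ρ) (κ := κ) (α := α) (inv_ne_zero hv0)
  rw [inv_inv] at this
  rw [this, norm_mul]

theorem analyticOnNhd_ratMap {ρ κ α : ℝ} (h0 : 0 < α) (h1 : α < 1) :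
    AnalyticOnNhd ℂ (ratMap ρ κ α) exteriorDisk := by
  have ho : IsOpen exteriorDisk := by
    rw [exteriorDisk_eq_compl]; exact Metric.isClosed_closedBall.isOpen_compl
  refine DifferentiableOn.analyticOnNhd (fun v hv => ?_) ho
  exact (hasDerivAt_ratMap ρ κ α (sub_ne_zero_of_closedExterior h0 h1
    (exteriorDisk_subset_closedExterior hv))).differentiableAt.differentiableWithinAt

/-! ### The parameters of a conformal region are determined -/

/-- The equations of `IsMatched` are read off from the residue of `S` at its only finite pole
`f(1/α)` and from the leading coefficient of `S` at infinity. -/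
theorem IsConformalRegion.isMatched {a c t : ℝ} {K : Set ℂ} {ρ κ α : ℝ}
    (h : IsConformalRegion a c t K ρ κ α) : IsMatched a c t ρ κ α := by
  have h0 := h.alpha_pos
  have h1 := h.alpha_lt_one
  have h0' : (α : ℂ) ≠ 0 := by exact_mod_cast h0.ne'
  have hinj := h.bijective.injOn
  have hS : ∀ v ∈ exteriorDisk, ratMap ρ κ α (1 / ratMapInv ρ κ α (ratMap ρ κ α v)) =
      ratMap ρ κ α (1 / v) := fun v hv => by
    have : ratMapInv ρ κ α (ratMap ρ κ α v) = v := hinj.leftInvOn_invFunOn hv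
    rw [this]
  obtain ⟨g, hg, hSg⟩ := h.schwarz.analytic
  set p : ℂ := 1 / (α : ℂ) with hp
  have hp0 : p ≠ 0 := one_div_ne_zero h0'
  have hpext : p ∈ exteriorDisk := by
    rw [mem_exteriorDisk, hp, norm_div, norm_one, Complex.norm_real, Real.norm_of_nonneg h0.le]
    exact (one_lt_div h0).2 h1
  have ho : IsOpen exteriorDisk := by
    rw [exteriorDisk_eq_compl]; exact Metric.isClosed_closedBall.isOpen_compl
  have hpα : p - α ≠ 0 := sub_ne_zero_of_closedExterior h0 h1
      (exteriorDisk_subset_closedExterior hpext)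
  have hd := hasDerivAt_ratMap ρ κ α hpα
  have hne : ∀ᶠ v in 𝓝[≠] p, v ∈ exteriorDisk ∧ v ≠ p ∧ v ≠ 0 := by
    filter_upwards [nhdsWithin_le_nhds (ho.mem_nhds hpext), self_mem_nhdsWithin,
      nhdsWithin_le_nhds (isOpen_ne.mem_nhds hp0)] with v h1 h2 h3
    exact ⟨h1, h2, h3⟩
  have hid : Tendsto (fun v : ℂ => v) (𝓝[≠] p) (𝓝 p) := nhdsWithin_le_nhds
  have hsub : Tendsto (fun v : ℂ => v - p) (𝓝[≠] p) (𝓝 0) := by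
    have := hid.sub_const p
    rwa [sub_self] at this
  -- the residue of `v ↦ f(1/v)` at `1/α`
  have hres : Tendsto (fun v : ℂ => (v - p) * ratMap ρ κ α (1 / v)) (𝓝[≠] p)
      (𝓝 (κ / α ^ 2)) := by
    have e : Tendsto (fun v : ℂ => (v - p) * (ρ / v - κ / α) + κ * v / α) (𝓝[≠] p)
        (𝓝 (0 * (ρ / p - κ / α) + κ * p / α)) :=
      (hsub.mul ((tendsto_const_nhds.div hid hp0).sub_const _)).add
        ((hid.const_mul _).div_const _)
    have e2 : (0 * (ρ / p - κ / α) + κ * p / α : ℂ) = κ / α ^ 2 := by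
      rw [hp]; field_simp; ring
    rw [e2] at e
    refine e.congr' ?_
    filter_upwards [hne] with v hv
    have hv0 := hv.2.2
    have hvp := sub_ne_zero.2 hv.2.1
    have e3 : 1 / v - (α : ℂ) = -(α * (v - p) / v) := by rw [hp]; field_simp; ring
    unfold ratMap
    rw [e3]
    field_simp
    ring
  have hgc : Tendsto (fun v : ℂ => g (ratMap ρ κ α v)) (𝓝[≠] p) (𝓝 (g (ratMap ρ κ α p))) :=
    ((hg _ (h.bijective.mapsTo hpext)).continuousAt.tendsto.comp hd.continuousAt.tendsto).mono_left
      nhdsWithin_le_nhds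
  have hfc : Tendsto (ratMap ρ κ α) (𝓝[≠] p) (𝓝 (ratMap ρ κ α p)) :=
    hd.continuousAt.tendsto.mono_left nhdsWithin_le_nhds
  have hκ : (κ / α ^ 2 : ℂ) ≠ 0 := by exact_mod_cast (div_pos h.kappa_pos (pow_pos h0 2)).ne'
  have hpa : ratMap ρ κ α p = a := by
    by_contra hpa
    have lim : Tendsto (fun v : ℂ => (v - p) * ratMap ρ κ α (1 / v)) (𝓝[≠] p) (𝓝 0) := by
      have := hsub.mul (hgc.add ((tendsto_const_nhds (x := (c : ℂ))).div
        (hfc.sub_const (a : ℂ)) (sub_ne_zero.2 hpa)))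
      rw [zero_mul] at this
      refine this.congr' ?_
      filter_upwards [hne, hfc.eventually_ne hpa] with v hv hva
      have := hSg _ (h.bijective.mapsTo hv.1) hva
      simp only [hS v hv.1] at this
      rw [← this, Pi.div_apply, sub_add_cancel]
    exact hκ (tendsto_nhds_unique hres lim)
  have hc : (c : ℂ) = (ρ + κ / (p - α) ^ 2) * (κ / α ^ 2) := by
    have hslope := hasDerivAt_iff_tendsto_slope.1 hd
    have lim := hslope.mul (hres.sub (hsub.mul hgc))
    rw [zero_mul, sub_zero] at lim
    refine tendsto_nhds_unique (tendsto_const_nhds.congr' ?_) lim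
    filter_upwards [hne] with v hv
    have hva : ratMap ρ κ α v ≠ a := by
      rw [← hpa]; exact fun e => hv.2.1 (hinj hv.1 hpext e)
    have := hSg _ (h.bijective.mapsTo hv.1) hva
    simp only [hS v hv.1] at this
    have hvp := sub_ne_zero.2 hv.2.1
    have hva' := sub_ne_zero.2 hva
    rw [← this, slope_def_field, hpa]
    field_simp
    ring
  have hinf : ((c + t : ℝ) : ℂ) = ρ * ((ρ + κ / α ^ 2 : ℝ) : ℂ) := by
    have hi : Tendsto (fun v : ℂ => v⁻¹) (cocompact ℂ) (𝓝 0) := by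
      rw [← Metric.cobounded_eq_cocompact]; exact tendsto_inv₀_cobounded
    have hf := tendsto_ratMap_cocompact (κ := κ) (α := α) h.rho_pos.ne'
    have hne' : ∀ᶠ v in cocompact ℂ, v ∈ exteriorDisk ∧ v ≠ 0 := by
      have : ∀ᶠ v in cocompact ℂ, v ∈ exteriorDisk := by
        rw [exteriorDisk_eq_compl]; exact (isCompact_closedBall 0 1).compl_mem_cocompact
      filter_upwards [this] with v hv
      refine ⟨hv, ?_⟩
      rintro rfl
      simp at hv
      linarith
    have hev2 := eventually_sub_ne_zero h0.ne'
    -- the product `f(v) f(1/v)` has the limit `ρ f'(0)` at infinity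
    have l1 : Tendsto (fun v : ℂ => mulAtInfinity ρ κ α v⁻¹ * quotAtZero ρ κ α v⁻¹) (cocompact ℂ)
        (𝓝 (ρ * ((ρ + κ / α ^ 2 : ℝ) : ℂ))) := by
      have a1 := (differentiableAt_mulAtInfinity ρ κ α).continuousAt.tendsto.comp hi
      have a2 := (differentiableAt_quotAtZero ρ κ α h0.ne').continuousAt.tendsto.comp hi
      rw [mulAtInfinity_zero] at a1
      rw [quotAtZero_zero] at a2
      exact a1.mul a2
    have l2 : Tendsto (fun v : ℂ => ratMap ρ κ α v * (ratMap ρ κ α (1 / v) -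
        ((c : ℂ) + t) / ratMap ρ κ α v)) (cocompact ℂ) (𝓝 0) := by
      have o1 := (h.schwarz.atInfinity.comp_tendsto hf)
      have o2 : (fun v : ℂ => ratMap ρ κ α v * (ratMap ρ κ α (1 / v) -
        ((c : ℂ) + t) / ratMap ρ κ α v)) =O[cocompact ℂ]
          (fun v => ratMap ρ κ α v * (ratMap ρ κ α v ^ 2)⁻¹) := by
        refine (isBigO_refl _ _).mul (IsBigO.congr' o1 ?_ (EventuallyEq.rfl))
        filter_upwards [hne'] with v hv
        simp only [Function.comp, hS v hv.1]
      refine o2.trans_tendsto ?_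
      have : Tendsto (fun z : ℂ => z⁻¹) (cocompact ℂ) (𝓝 0) := hi
      refine (this.comp hf).congr fun v => ?_
      simp only [Function.comp]
      rw [pow_two, mul_inv, ← mul_assoc]
      by_cases hz : ratMap ρ κ α v = 0
      · simp [hz]
      · rw [mul_inv_cancel₀ hz, one_mul]
    have l3 := l1.sub l2
    rw [sub_zero] at l3
    refine tendsto_nhds_unique (tendsto_const_nhds.congr' ?_) l3
    have hfne : ∀ᶠ v in cocompact ℂ, ratMap ρ κ α v ≠ 0 := by
      have : ∀ᶠ z in cocompact ℂ, z ≠ 0 := by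
        rw [← Metric.cobounded_eq_cocompact]
        exact Bornology.eventually_ne_cobounded 0
      exact hf.eventually this
    filter_upwards [hne', hi.eventually hev2, hfne] with v hv e2 e3
    have a1 := ratMap_inv_eq (ρ := ρ) (κ := κ) (α := α) (inv_ne_zero hv.2)
    have a2 := ratMap_eq_mul_quotAtZero (ρ := ρ) (κ := κ) h0.ne' e2
    rw [inv_inv] at a1
    rw [one_div, mul_sub, mul_div_cancel₀ _ e3, a2]
    have hv0 := hv.2
    rw [a1]
    push_cast
    field_simp
    ring
  refine ⟨?_, ?_, ?_⟩
  · unfold ratMap at hpa; rw [hp] at hpa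
    have : ((ρ / α - κ / (1 / α - α) - κ / α : ℝ) : ℂ) = (a : ℂ) := by
      rw [← hpa]; push_cast; ring
    exact_mod_cast this
  · have : ((κ * (ρ + κ / (1 / α - α) ^ 2) : ℝ) : ℂ) = ((c * α ^ 2 : ℝ) : ℂ) := by
      push_cast
      rw [hc, hp]
      field_simp
    exact_mod_cast this
  · exact_mod_cast hinf.symm

/-! ### Logarithmic potentials from a Lipschitz gradient field -/

/-- The real differential form `2 Re (g dz)`, that is the differential of a real function `U` with
`∂U/∂z = g`. -/
noncomputable def reForm (g : ℂ) : ℂ →L[ℝ] ℝ :=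
  (2 : ℝ) • (Complex.reCLM ∘L ((ContinuousLinearMap.mul ℝ ℂ) g))

@[simp] theorem reForm_apply (g h : ℂ) : reForm g h = 2 * (g * h).re := rfl

/-- A radial test function: the logarithmic kernel about `z₀`, cut off at the radii `ε` and `R`. -/
noncomputable def cutLog (z₀ : ℂ) (ε R : ℝ) (w : ℂ) : ℝ :=
  Real.log R - Real.log (max ε (min ‖w - z₀‖ R))

theorem lipschitzWith_cutLog (z₀ : ℂ) {ε R : ℝ} (hε : 0 < ε) :
    LipschitzWith (Real.toNNReal ε⁻¹) (cutLog z₀ ε R) := by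
  have hlog : ∀ x y : ℝ, ε ≤ x → ε ≤ y → Real.log x - Real.log y ≤ ε⁻¹ * |x - y| := by
    intro x y hx hy
    have hx0 : 0 < x := hε.trans_le hx
    have hy0 : 0 < y := hε.trans_le hy
    rw [← Real.log_div hx0.ne' hy0.ne']
    refine (Real.log_le_sub_one_of_pos (div_pos hx0 hy0)).trans ?_
    have e : x / y - 1 = (x - y) / y := by field_simp
    rw [e, inv_mul_eq_div]
    refine (div_le_div_of_nonneg_right (le_abs_self _) hy0.le).trans ?_
    exact div_le_div_of_nonneg_left (abs_nonneg _) hε hy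
  refine LipschitzWith.of_dist_le_mul fun x y => ?_
  have habs : |Real.log (max ε (min ‖x - z₀‖ R)) - Real.log (max ε (min ‖y - z₀‖ R))| ≤
      ε⁻¹ * |max ε (min ‖x - z₀‖ R) - max ε (min ‖y - z₀‖ R)| := by
    rw [abs_le']
    refine ⟨hlog _ _ (le_max_left _ _) (le_max_left _ _), ?_⟩
    rw [neg_sub, abs_sub_comm]
    exact hlog _ _ (le_max_left _ _) (le_max_left _ _)
  have h2 : |max ε (min ‖x - z₀‖ R) - max ε (min ‖y - z₀‖ R)| ≤ dist x y := by
    refine (abs_max_sub_max_le_max _ _ _ _).trans ?_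
    rw [sub_self, abs_zero, max_eq_right (abs_nonneg _)]
    refine (abs_min_sub_min_le_max _ _ _ _).trans ?_
    rw [sub_self, abs_zero, max_eq_left (abs_nonneg _)]
    refine (abs_norm_sub_norm_le _ _).trans ?_
    rw [sub_sub_sub_cancel_right, dist_eq_norm]
  rw [Real.dist_eq, Real.coe_toNNReal _ (inv_nonneg.2 hε.le)]
  unfold cutLog
  rw [sub_sub_sub_cancel_left, abs_sub_comm]
  exact habs.trans (mul_le_mul_of_nonneg_left h2 (inv_nonneg.2 hε.le))

theorem cutLog_eq_zero (z₀ : ℂ) {ε R : ℝ} (hR : ε < R) {w : ℂ} (hw : R ≤ ‖w - z₀‖) :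
    cutLog z₀ ε R w = 0 := by
  unfold cutLog
  rw [min_eq_right hw, max_eq_right hR.le, sub_self]

theorem hasCompactSupport_cutLog (z₀ : ℂ) {ε R : ℝ} (hR : ε < R) :
    HasCompactSupport (cutLog z₀ ε R) := by
  refine HasCompactSupport.intro (isCompact_closedBall z₀ R) fun w hw => ?_
  rw [Metric.mem_closedBall, not_le, dist_eq_norm] at hw
  exact cutLog_eq_zero z₀ hR hw.le

/-- The function `log |w - β|` has differential `2 Re (dw / (2 (w - β)))`. -/
theorem hasFDerivAt_log_norm (β : ℂ) {w : ℂ} (hw : w - β ≠ 0) :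
    HasFDerivAt (fun w : ℂ => Real.log ‖w - β‖) (reForm (1 / (2 * (w - β)))) w := by
  have h1 : HasFDerivAt (fun w : ℂ => ‖w - β‖ ^ 2) (2 • (innerSL ℝ) (w - β)) w := by
    have := (hasStrictFDerivAt_norm_sq (w - β)).hasFDerivAt.comp w ((hasFDerivAt_id w).sub_const β)
    exact this
  have h2 := (h1.log (by positivity)).const_mul (1 / 2)
  have e : (fun w : ℂ => Real.log ‖w - β‖) = fun w => 1 / 2 * Real.log (‖w - β‖ ^ 2) := by
    funext w; rw [Real.log_pow]; push_cast; ring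
  rw [e]
  refine h2.congr_fderiv ?_
  ext h
  have hn : Complex.normSq (w - β) ≠ 0 := by simpa using hw
  have e3 : 1 / (2 * (w - β)) * h =
      ((1 / (2 * Complex.normSq (w - β)) : ℝ) : ℂ) * (starRingEnd ℂ (w - β) * h) := by
    have hn' : (Complex.normSq (w - β) : ℂ) ≠ 0 := by exact_mod_cast hn
    rw [Complex.ofReal_div, Complex.ofReal_one, Complex.ofReal_mul, Complex.ofReal_ofNat]
    rw [← Complex.mul_conj] at hn' ⊢
    have hc := right_ne_zero_of_mul hn'
    field_simp
  rw [reForm_apply, e3, Complex.re_ofReal_mul]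
  rw [Complex.normSq_eq_norm_sq] at hn ⊢
  simp [Complex.inner]
  field_simp
  ring

theorem hasLineDerivAt_cutLog_of_mem (z₀ : ℂ) {ε R : ℝ} (hε : 0 < ε) {w : ℂ}
    (h1 : ε < ‖w - z₀‖) (h2 : ‖w - z₀‖ < R) (v : ℂ) :
    HasLineDerivAt ℝ (cutLog z₀ ε R) (-((1 / (w - z₀) * v).re)) w v := by
  have hw : w - z₀ ≠ 0 := norm_pos_iff.1 (hε.trans h1)
  have hd := (hasFDerivAt_log_norm z₀ hw).const_sub (Real.log R)
  have hev : cutLog z₀ ε R =ᶠ[𝓝 w] fun w => Real.log R - Real.log ‖w - z₀‖ := by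
    have hc : ContinuousAt (fun w : ℂ => ‖w - z₀‖) w := by fun_prop
    filter_upwards [hc.tendsto.eventually_const_lt h1,
        hc.tendsto.eventually_lt_const h2] with x hx1 hx2
    unfold cutLog
    rw [min_eq_left hx2.le, max_eq_right hx1.le]
  have := (hd.congr_of_eventuallyEq hev).hasLineDerivAt v
  have e : (1 : ℂ) / (2 * (w - z₀)) * v = ((1 / 2 : ℝ) : ℂ) * (1 / (w - z₀) * v) := by
    push_cast; field_simp
  have e2 : (-reForm (1 / (2 * (w - z₀)))) v = -((1 / (w - z₀) * v).re) := by
    rw [neg_apply, reForm_apply, e, Complex.re_ofReal_mul]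
    ring
  rwa [e2] at this

theorem lineDeriv_cutLog_eq_zero (z₀ : ℂ) {ε R : ℝ} (hR : ε < R) {w : ℂ}
    (h : ‖w - z₀‖ < ε ∨ R < ‖w - z₀‖) (v : ℂ) : lineDeriv ℝ (cutLog z₀ ε R) w v = 0 := by
  have hc : ContinuousAt (fun w : ℂ => ‖w - z₀‖) w := by fun_prop
  have hev : ∃ C : ℝ, cutLog z₀ ε R =ᶠ[𝓝 w] fun _ => C := by
    rcases h with h | h
    · refine ⟨Real.log R - Real.log ε, ?_⟩
      filter_upwards [hc.tendsto.eventually_lt_const h] with x hx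
      unfold cutLog
      rw [min_eq_left (hx.trans hR).le, max_eq_left hx.le]
    · refine ⟨0, ?_⟩
      filter_upwards [hc.tendsto.eventually_const_lt h] with x hx
      exact cutLog_eq_zero z₀ hR hx.le
  obtain ⟨C, hC⟩ := hev
  rw [(((hasFDerivAt_const C w).congr_of_eventuallyEq hC).hasLineDerivAt v).lineDeriv]
  rfl

/-- Integration by parts against a compactly supported Lipschitz function. -/
theorem integral_divergence_mul {G : ℂ → ℂ} {C D : NNReal} (hG : LipschitzWith C G) {φ : ℂ → ℝ}
    (hφ : LipschitzWith D φ) (hφc : HasCompactSupport φ) :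
    ∫ w, (lineDeriv ℝ (fun z => (G z).re) w 1 - lineDeriv ℝ (fun z => (G z).im) w Complex.I) * φ w
      = -∫ w, (lineDeriv ℝ φ w 1 * (G w).re - lineDeriv ℝ φ w Complex.I * (G w).im) := by
  have hre : LipschitzWith C fun z => (G z).re :=
    LipschitzWith.of_dist_le_mul fun x y => by
      refine le_trans ?_ (hG.dist_le_mul x y)
      rw [Real.dist_eq, dist_eq_norm, ← Complex.sub_re]; exact Complex.abs_re_le_norm _
  have him : LipschitzWith C fun z => (G z).im :=
    LipschitzWith.of_dist_le_mul fun x y => by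
      refine le_trans ?_ (hG.dist_le_mul x y)
      rw [Real.dist_eq, dist_eq_norm, ← Complex.sub_im]; exact Complex.abs_im_le_norm _
  have int1 : ∀ {g : ℂ → ℝ} (_ : LipschitzWith C g) (v : ℂ),
      Integrable fun w => lineDeriv ℝ g w v * φ w := fun hg v =>
    (hg.locallyIntegrable_lineDeriv v).integrable_smul_right_of_hasCompactSupport
      hφ.continuous hφc
  have int2 : ∀ {g : ℂ → ℝ} (_ : Continuous g) (v : ℂ),
      Integrable fun w => lineDeriv ℝ φ w v * g w := by
    intro g hg v
    have h1 : IntegrableOn (fun w => lineDeriv ℝ φ w v * g w) (tsupport φ) :=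
      (((hφ.locallyIntegrable_lineDeriv v).integrableOn_isCompact hφc).mul_continuousOn
        hg.continuousOn hφc)
    refine (integrableOn_iff_integrable_of_support_subset ?_).1 h1
    intro w hw
    by_contra h
    apply hw
    have hev : φ =ᶠ[𝓝 w] fun _ => (0 : ℝ) := notMem_tsupport_iff_eventuallyEq.1 h
    have := (((hasFDerivAt_const (𝕜 := ℝ)
        (0 : ℝ) w).congr_of_eventuallyEq hev).hasLineDerivAt v).lineDeriv
    simp only
    rw [this]; simp
  have p1 := hre.integral_lineDeriv_mul_eq (μ := volume) hφ hφc 1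
  have p2 := him.integral_lineDeriv_mul_eq (μ := volume) hφ hφc Complex.I
  simp only [sub_mul]
  rw [integral_sub (int1 hre 1) (int1 him _), integral_sub (int2 hre.continuous 1)
    (int2 him.continuous _), p1, p2]
  simp only [lineDeriv_neg, neg_mul, integral_neg]
  ring

/-- The integral of the pairing of a vector field with the gradient of the cut-off logarithm, in
polar coordinates. -/
theorem integral_lineDeriv_cutLog {G : ℂ → ℂ} (hG : Continuous G) {U : ℂ → ℝ}
    (hU : ∀ z, HasFDerivAt U (reForm (G z)) z) (z₀ : ℂ) {ε R : ℝ} (hε : 0 < ε) (hR : ε < R) :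
    -∫ w, (lineDeriv ℝ (cutLog z₀ ε R) w 1 * (G w).re -
        lineDeriv ℝ (cutLog z₀ ε R) w Complex.I * (G w).im) =
      1 / 2 * ∫ θ in (-Real.pi)..Real.pi,
        (U (z₀ + R * (Real.cos θ + Real.sin θ * Complex.I)) -
          U (z₀ + ε * (Real.cos θ + Real.sin θ * Complex.I))) := by
  set u : ℝ → ℂ := fun θ => Real.cos θ + Real.sin θ * Complex.I with hu
  have huc : Continuous u := by fun_prop
  have hun : ∀ θ, ‖u θ‖ = 1 := by
    intro θ
    have : u θ = Complex.exp (θ * Complex.I) := by rw [hu]; simp [Complex.exp_mul_I]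
    rw [this, Complex.norm_exp_ofReal_mul_I]
  have huu : ∀ θ, u θ ≠ 0 := fun θ h => by have := hun θ; rw [h, norm_zero] at this; linarith
  set f : ℂ → ℝ := fun w => lineDeriv ℝ (cutLog z₀ ε R) w 1 * (G w).re -
        lineDeriv ℝ (cutLog z₀ ε R) w Complex.I * (G w).im with hf
  set k : ℝ × ℝ → ℝ := fun p => -(G (z₀ + p.1 * u p.2) * u p.2).re with hk
  have hkc : Continuous k := by fun_prop
  -- values of the integrand in polar coordinates
  have hval1 : ∀ r θ : ℝ, ε < r → r < R → r * f (r * u θ + z₀) = k (r, θ) := by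
    intro r θ h1 h2
    have hr : 0 < r := hε.trans h1
    have hn : ‖(r * u θ + z₀) - z₀‖ = r := by
      rw [add_sub_cancel_right, norm_mul, hun, Complex.norm_real, mul_one,
          Real.norm_of_nonneg hr.le]
    have d := hasLineDerivAt_cutLog_of_mem z₀ hε (w := r * u θ + z₀) (by rwa [hn]) (by rwa [hn])
    simp only [hf, hk]
    rw [(d 1).lineDeriv, (d Complex.I).lineDeriv, add_sub_cancel_right, add_comm (z₀ : ℂ)]
    have e : (1 : ℂ) / (r * u θ) = ((1 / r : ℝ) : ℂ) * starRingEnd ℂ (u θ) := by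
      have h1 : u θ * starRingEnd ℂ (u θ) = 1 := by rw [Complex.mul_conj', hun]; norm_num
      have hr' : (r : ℂ) ≠ 0 := by exact_mod_cast hr.ne'
      have := huu θ
      push_cast
      field_simp
      linear_combination -h1
    rw [e, mul_assoc, mul_assoc, Complex.re_ofReal_mul, Complex.re_ofReal_mul]
    simp only [Complex.mul_re, Complex.conj_re, Complex.conj_im, Complex.one_re, Complex.one_im,
      Complex.I_re, Complex.I_im]
    field_simp
    ring
  have hval2 : ∀ r θ : ℝ, 0 < r → (r < ε ∨ R < r) → r * f (r * u θ + z₀) = 0 := by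
    intro r θ hr h
    have hn : ‖(r * u θ + z₀) - z₀‖ = r := by
      rw [add_sub_cancel_right, norm_mul, hun, Complex.norm_real, mul_one,
          Real.norm_of_nonneg hr.le]
    simp only [hf]
    rw [lineDeriv_cutLog_eq_zero z₀ hR (by rwa [hn]), lineDeriv_cutLog_eq_zero z₀ hR (by rwa [hn])]
    ring
  have hnull : ∀ s : ℝ, ∀ᵐ p : ℝ × ℝ, p.1 ≠ s := by
    intro s
    have : (volume : Measure (ℝ × ℝ)) ({s} ×ˢ univ) = 0 := by
      rw [Measure.volume_eq_prod, Measure.prod_prod]; simp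
    refine (measure_eq_zero_iff_ae_notMem.1 this).mono fun p hp h => hp ⟨h, mem_univ _⟩
  have hint : IntegrableOn k (Ioo ε R ×ˢ Ioo (-Real.pi) Real.pi) (volume.prod volume) := by
    refine IntegrableOn.mono_set (t := Icc ε R ×ˢ Icc (-Real.pi) Real.pi) ?_
      (prod_mono Ioo_subset_Icc_self Ioo_subset_Icc_self)
    exact hkc.continuousOn.integrableOn_compact (isCompact_Icc.prod isCompact_Icc)
  calc -∫ w, f w = -∫ w, f (w + z₀) := by rw [integral_add_right_eq_self]
    _ = -∫ p in polarCoord.target, p.1 * f (p.1 * u p.2 + z₀) := by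
        rw [← Complex.integral_comp_polarCoord_symm]
        simp only [Complex.polarCoord_symm_apply, smul_eq_mul, hu]
    _ = -∫ p in Ioo ε R ×ˢ Ioo (-Real.pi) Real.pi, p.1 * f (p.1 * u p.2 + z₀) := by
        congr 1
        refine setIntegral_eq_of_subset_of_ae_sdiff_eq_zero
          polarCoord.open_target.measurableSet.nullMeasurableSet ?_ ?_
        · rw [polarCoord_target]
          exact prod_mono (fun r hr => hε.trans hr.1) Subset.rfl
        · filter_upwards [hnull ε, hnull R] with p hp1 hp2 hp
          rw [polarCoord_target] at hp
          refine hval2 _ _ hp.1.1 ?_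
          by_contra hcon
          push Not at hcon
          exact hp.2 ⟨⟨lt_of_le_of_ne hcon.1 (Ne.symm hp1), lt_of_le_of_ne hcon.2 hp2⟩, hp.1.2⟩
    _ = -∫ p in Ioo ε R ×ˢ Ioo (-Real.pi) Real.pi, k p := by
        congr 1
        refine setIntegral_congr_fun (measurableSet_Ioo.prod measurableSet_Ioo) fun p hp => ?_
        exact hval1 _ _ hp.1.1 hp.1.2
    _ = -∫ θ in Ioo (-Real.pi) Real.pi, ∫ r in Ioo ε R, k (r, θ) := by
        rw [IntegrableOn, ← Measure.prod_restrict] at hint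
        rw [Measure.volume_eq_prod, ← Measure.prod_restrict, integral_prod_symm _ hint]
    _ = ∫ θ in Ioo (-Real.pi) Real.pi, 1 / 2 * (U (z₀ + R * u θ) - U (z₀ + ε * u θ)) := by
        rw [← integral_neg]
        congr 1
        funext θ
        have hder : ∀ r ∈ uIcc ε R, HasDerivAt (fun r : ℝ => U (z₀ + r * u θ))
            (-2 * k (r, θ)) r := by
          intro r _
          have h1 : HasDerivAt (fun r : ℝ => z₀ + r * u θ) (u θ) r := by
            have := ((Complex.ofRealCLM.hasDerivAt (x := r)).mul_const (u θ)).const_add z₀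
            simpa using this
          have h2 := (hU (z₀ + r * u θ)).comp_hasDerivAt r h1
          refine h2.congr_deriv ?_
          rw [reForm_apply, hk]; ring
        have hci : IntervalIntegrable (fun r => -2 * k (r, θ)) volume ε R :=
          Continuous.intervalIntegrable (by fun_prop) _ _
        rw [← intervalIntegral.integral_eq_sub_of_hasDerivAt hder hci,
          intervalIntegral.integral_const_mul, intervalIntegral.integral_of_le hR.le,
          integral_Ioc_eq_integral_Ioo]
        ring
    _ = _ := by
        rw [integral_const_mul, intervalIntegral.integral_of_le (by linarith [Real.pi_pos]),
          integral_Ioc_eq_integral_Ioo]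

theorem integrableOn_log_norm_closedBall (M : ℝ) :
    IntegrableOn (fun w : ℂ => Real.log ‖w‖) (Metric.closedBall 0 M) := by
  have hm : Measurable fun w : ℂ => Real.log ‖w‖ := Real.measurable_log.comp measurable_norm
  refine ⟨hm.aestronglyMeasurable, ?_⟩
  rw [hasFiniteIntegral_iff_enorm]
  obtain ⟨B, hB⟩ := (isCompact_Icc (a := (0 : ℝ)) (b := M)).exists_bound_of_continuousOn
    Real.continuous_mul_log.continuousOn
  rw [← lintegral_indicator Metric.isClosed_closedBall.measurableSet,
    ← Complex.lintegral_comp_polarCoord_symm]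
  calc _ ≤ ∫⁻ p in polarCoord.target,
        (Icc (0 : ℝ) M ×ˢ (univ : Set ℝ)).indicator (fun _ => ENNReal.ofReal B) p := by
        refine setLIntegral_mono' polarCoord.open_target.measurableSet fun p hp => ?_
        have hp0 : 0 < p.1 := by rw [polarCoord_target] at hp; exact hp.1
        have hn : ‖Complex.polarCoord.symm p‖ = p.1 := by
          rw [Complex.norm_polarCoord_symm, abs_of_pos hp0]
        by_cases h : p.1 ≤ M
        · rw [indicator_of_mem (by rw [mem_closedBall_zero_iff, hn]; exact h),
            indicator_of_mem (show p ∈ Icc (0 : ℝ) M ×ˢ (univ : Set ℝ) from ⟨⟨hp0.le, h⟩,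
                mem_univ _⟩),
            hn, smul_eq_mul, ← ofReal_norm, ← ENNReal.ofReal_mul hp0.le]
          refine ENNReal.ofReal_le_ofReal ?_
          have := hB p.1 ⟨hp0.le, h⟩
          rwa [norm_mul, Real.norm_of_nonneg hp0.le] at this
        · rw [indicator_of_notMem (by rw [mem_closedBall_zero_iff, hn]; exact h)]
          simp
    _ < ⊤ := by
        rw [lintegral_indicator (measurableSet_Icc.prod MeasurableSet.univ), lintegral_const]
        refine ENNReal.mul_lt_top ENNReal.ofReal_lt_top ?_
        rw [Measure.restrict_restrict (measurableSet_Icc.prod MeasurableSet.univ),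
          Measure.restrict_apply_univ, polarCoord_target, prod_inter_prod, univ_inter,
          Measure.volume_eq_prod, Measure.prod_prod]
        refine ENNReal.mul_lt_top ?_ ?_
        · exact (measure_mono inter_subset_left).trans_lt
            (by rw [Real.volume_Icc]; exact ENNReal.ofReal_lt_top)
        · rw [Real.volume_Ioo]; exact ENNReal.ofReal_lt_top

theorem integrableOn_log_norm_sub {K : Set ℂ} (hK : IsCompact K) (z₀ : ℂ) :
    IntegrableOn (fun w : ℂ => Real.log ‖w - z₀‖) K := by
  obtain ⟨M, hM⟩ := hK.isBounded.subset_closedBall z₀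
  refine IntegrableOn.mono_set ?_ hM
  have h := integrableOn_log_norm_closedBall M
  have hmp := (measurePreserving_sub_right (volume : Measure ℂ) z₀)
  have := (hmp.integrableOn_comp_preimage (MeasurableEquiv.subRight z₀).measurableEmbedding).2 h
  have e : Metric.closedBall z₀ M = (fun x => x - z₀) ⁻¹' Metric.closedBall 0 M := by
    ext w; simp [dist_eq_norm]
  rw [e]
  exact this

section FundamentalSolution

variable {K : Set ℂ} {G : ℂ → ℂ} {U : ℂ → ℝ} {C : NNReal}

/-- Green's formula for `U` and the logarithm on the annulus `ε < |w - z₀| < R`, in the weak form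
that only asks for the divergence of the gradient almost everywhere. -/
theorem four_mul_integral_cutLog (hK : IsCompact K) (hG : LipschitzWith C G)
    (hU : ∀ z, HasFDerivAt U (reForm (G z)) z)
    (hdiv : ∀ᵐ w, lineDeriv ℝ (fun z => (G z).re) w 1 - lineDeriv ℝ (fun z => (G z).im) w Complex.I
      = K.indicator (fun _ => 2) w) (z₀ : ℂ) {ε R : ℝ} (hε : 0 < ε) (hR : ε < R) :
    4 * ∫ w in K, cutLog z₀ ε R w =
      (∫ θ in (-Real.pi)..Real.pi, U (z₀ + R * (Real.cos θ + Real.sin θ * Complex.I))) -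
        ∫ θ in (-Real.pi)..Real.pi, U (z₀ + ε * (Real.cos θ + Real.sin θ * Complex.I)) := by
  have hUc : Continuous U := continuous_iff_continuousAt.2 fun z => (hU z).continuousAt
  have h1 := integral_divergence_mul hG (lipschitzWith_cutLog z₀ (R := R) hε)
    (hasCompactSupport_cutLog z₀ hR)
  rw [integral_lineDeriv_cutLog hG.continuous hU z₀ hε hR] at h1
  have h2 : ∫ w, (lineDeriv ℝ (fun z => (G z).re) w 1 -
      lineDeriv ℝ (fun z => (G z).im) w Complex.I) * cutLog z₀ ε R w =
      2 * ∫ w in K, cutLog z₀ ε R w := by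
    rw [← integral_indicator hK.measurableSet, ← integral_const_mul]
    refine integral_congr_ae (hdiv.mono fun w hw => ?_)
    simp only [hw]
    by_cases h : w ∈ K
    · rw [indicator_of_mem h, indicator_of_mem h]
    · rw [indicator_of_notMem h, indicator_of_notMem h]; simp
  rw [h2, intervalIntegral.integral_sub (Continuous.intervalIntegrable (by fun_prop) _ _)
    (Continuous.intervalIntegrable (by fun_prop) _ _)] at h1
  linarith

/-- The limit `ε → 0` of `four_mul_integral_cutLog`: a Jensen formula on the disk of radius `R`. -/
theorem integral_log_add_circle (hK : IsCompact K) (hG : LipschitzWith C G)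
    (hU : ∀ z, HasFDerivAt U (reForm (G z)) z)
    (hdiv : ∀ᵐ w, lineDeriv ℝ (fun z => (G z).re) w 1 - lineDeriv ℝ (fun z => (G z).im) w Complex.I
      = K.indicator (fun _ => 2) w) (z₀ : ℂ) {R : ℝ} (hR : 0 < R) (hKR : K ⊆ Metric.ball z₀ R) :
    4 * (Real.log R * volume.real K - ∫ w in K, Real.log ‖w - z₀‖) =
      (∫ θ in (-Real.pi)..Real.pi, U (z₀ + R * (Real.cos θ + Real.sin θ * Complex.I))) -
        2 * Real.pi * U z₀ := by
  have hUc : Continuous U := continuous_iff_continuousAt.2 fun z => (hU z).continuousAt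
  have hlogint := integrableOn_log_norm_sub hK z₀
  have hlim : Tendsto (fun ε : ℝ => ∫ w in K, cutLog z₀ ε R w) (𝓝[>] 0)
      (𝓝 (∫ w in K, (Real.log R - Real.log ‖w - z₀‖))) := by
    refine tendsto_integral_filter_of_dominated_convergence
      (fun w => |Real.log R| + |Real.log ‖w - z₀‖|) ?_ ?_ ?_ ?_
    · filter_upwards [self_mem_nhdsWithin] with ε hε
      exact (lipschitzWith_cutLog z₀ hε).continuous.aestronglyMeasurable
    · filter_upwards [Ioo_mem_nhdsGT (lt_min one_pos hR)] with ε hε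
      have hε1 := hε.2.trans_le (min_le_left _ _)
      rw [ae_restrict_iff' hK.measurableSet]
      have hne : ∀ᵐ w : ℂ, w ≠ z₀ := by simp [ae_iff]
      filter_upwards [hne] with w hw hwK
      have hr : 0 < ‖w - z₀‖ := norm_pos_iff.2 (sub_ne_zero.2 hw)
      have hwR : ‖w - z₀‖ < R := by have := hKR hwK; rwa [Metric.mem_ball, dist_eq_norm] at this
      unfold cutLog
      rw [min_eq_left hwR.le]
      refine (norm_sub_le _ _).trans ?_
      rw [Real.norm_eq_abs, Real.norm_eq_abs]
      refine add_le_add le_rfl ?_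
      rcases le_total ε ‖w - z₀‖ with h | h
      · rw [max_eq_right h]
      · rw [max_eq_left h, abs_of_nonpos (Real.log_nonpos hε.1.le hε1.le),
          abs_of_nonpos (Real.log_nonpos hr.le (h.trans hε1.le)), neg_le_neg_iff]
        exact Real.log_le_log hr h
    · exact (integrableOn_const hK.measure_ne_top).add hlogint.abs
    · rw [ae_restrict_iff' hK.measurableSet]
      have hne : ∀ᵐ w : ℂ, w ≠ z₀ := by simp [ae_iff]
      filter_upwards [hne] with w hw hwK
      have hr : 0 < ‖w - z₀‖ := norm_pos_iff.2 (sub_ne_zero.2 hw)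
      have hwR : ‖w - z₀‖ < R := by have := hKR hwK; rwa [Metric.mem_ball, dist_eq_norm] at this
      refine tendsto_const_nhds.congr' ?_
      filter_upwards [Ioo_mem_nhdsGT hr] with ε hε
      unfold cutLog
      rw [min_eq_left hwR.le, max_eq_right hε.2.le]
  have hcirc : Tendsto (fun ε : ℝ => ∫ θ in (-Real.pi)..Real.pi,
      U (z₀ + ε * (Real.cos θ + Real.sin θ * Complex.I))) (𝓝[>] 0) (𝓝 (2 * Real.pi * U z₀)) := by
    have hc : Continuous fun ε : ℝ => ∫ θ in (-Real.pi)..Real.pi,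
        U (z₀ + ε * (Real.cos θ + Real.sin θ * Complex.I)) :=
      intervalIntegral.continuous_parametric_intervalIntegral_of_continuous' (by fun_prop) _ _
    have := (hc.tendsto 0).mono_left (nhdsWithin_le_nhds (s := Ioi (0 : ℝ)))
    have e : ∫ θ in (-Real.pi)..Real.pi,
        U (z₀ + (0 : ℝ) * (Real.cos θ + Real.sin θ * Complex.I)) = 2 * Real.pi * U z₀ := by
      simp only [Complex.ofReal_zero, zero_mul, add_zero, intervalIntegral.integral_const,
        smul_eq_mul]
      ring
    rwa [e] at this
  have h1 := tendsto_nhds_unique ((hlim.const_mul 4).congr' (f₂ := fun ε : ℝ =>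
      (∫ θ in (-Real.pi)..Real.pi, U (z₀ + R * (Real.cos θ + Real.sin θ * Complex.I))) -
        ∫ θ in (-Real.pi)..Real.pi, U (z₀ + ε * (Real.cos θ + Real.sin θ * Complex.I))) ?_)
    (hcirc.const_sub _)
  · have hci : IntegrableOn (fun _ : ℂ => Real.log R) K := integrableOn_const hK.measure_ne_top
    rw [← h1, integral_sub hci hlogint, setIntegral_const,
      smul_eq_mul]
    ring
  · filter_upwards [Ioo_mem_nhdsGT hR] with ε hε
    exact four_mul_integral_cutLog hK hG hU hdiv z₀ hε.1 hε.2

/-- A function `U` with Lipschitz gradient whose Laplacian is `4` on `K` and `0` elsewhere, and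
which behaves like `T log |z| + L` at infinity, is `L` plus `2 / π` times the logarithmic
potential of `K`; moreover `K` has area `π T / 2`. -/
theorem area_and_integral_log (hK : IsCompact K) (hG : LipschitzWith C G)
    (hU : ∀ z, HasFDerivAt U (reForm (G z)) z)
    (hdiv : ∀ᵐ w, lineDeriv ℝ (fun z => (G z).re) w 1 - lineDeriv ℝ (fun z => (G z).im) w Complex.I
      = K.indicator (fun _ => 2) w) {T L : ℝ}
    (hinf : Tendsto (fun z => U z - T * Real.log ‖z‖) (cocompact ℂ) (𝓝 L)) (z₀ : ℂ) :
    volume.real K = Real.pi * T / 2 ∧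
      ∫ w in K, Real.log ‖w - z₀‖ = Real.pi / 2 * (U z₀ - L) := by
  have hUc : Continuous U := continuous_iff_continuousAt.2 fun z => (hU z).continuousAt
  set u : ℝ → ℂ := fun θ => Real.cos θ + Real.sin θ * Complex.I with hu
  have hun : ∀ θ, ‖u θ‖ = 1 := by
    intro θ
    have : u θ = Complex.exp (θ * Complex.I) := by rw [hu]; simp [Complex.exp_mul_I]
    rw [this, Complex.norm_exp_ofReal_mul_I]
  -- the asymptotics are the same with `log |z - z₀|`
  have hinf' : Tendsto (fun z => U z - T * Real.log ‖z - z₀‖) (cocompact ℂ) (𝓝 L) := by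
    have h1 : Tendsto (fun z : ℂ => Real.log ‖1 - z₀ * z⁻¹‖) (cocompact ℂ) (𝓝 0) := by
      have hi : Tendsto (fun v : ℂ => v⁻¹) (cocompact ℂ) (𝓝 0) := by
        rw [← Metric.cobounded_eq_cocompact]; exact tendsto_inv₀_cobounded
      have h2 : Tendsto (fun z : ℂ => ‖1 - z₀ * z⁻¹‖) (cocompact ℂ) (𝓝 1) := by
        have := ((hi.const_mul z₀).const_sub 1).norm
        simpa using this
      have := (Real.continuousAt_log one_ne_zero).tendsto.comp h2
      rwa [Real.log_one] at this
    have h3 := hinf.sub (h1.const_mul T)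
    rw [mul_zero, sub_zero] at h3
    refine h3.congr' ?_
    have hev : ∀ᶠ z in cocompact ℂ, z ∉ ({0, z₀} : Set ℂ) :=
      (Set.toFinite _).isCompact.compl_mem_cocompact
    filter_upwards [hev] with z hz
    have hz0 : z ≠ 0 := fun h => hz (by simp [h])
    have hz1 : z - z₀ ≠ 0 := sub_ne_zero.2 fun h => hz (by simp [h])
    have e : z - z₀ = z * (1 - z₀ * z⁻¹) := by field_simp
    have hz2 : 1 - z₀ * z⁻¹ ≠ 0 := right_ne_zero_of_mul (e ▸ hz1)
    rw [e, norm_mul, Real.log_mul (norm_ne_zero_iff.2 hz0) (norm_ne_zero_iff.2 hz2)]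
    ring
  have hA : Tendsto (fun R : ℝ => (∫ θ in (-Real.pi)..Real.pi, U (z₀ + R * u θ)) -
      2 * Real.pi * (T * Real.log R)) atTop (𝓝 (2 * Real.pi * L)) := by
    rw [Metric.tendsto_atTop]
    intro η hη
    have hη' : 0 < η / (4 * Real.pi) := div_pos hη (by positivity)
    have hev := hinf' (Metric.ball_mem_nhds L hη')
    rw [mem_map, ← Metric.cobounded_eq_cocompact,
      (Metric.hasBasis_cobounded_compl_closedBall z₀).mem_iff] at hev
    obtain ⟨M, -, hM⟩ := hev
    refine ⟨max M 0 + 1, fun R hR => ?_⟩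
    have hRM : M < R := by have := le_max_left M 0; linarith
    have hR0 : 0 < R := by have := le_max_right M 0; linarith
    have hn : ∀ θ, ‖z₀ + R * u θ - z₀‖ = R := by
      intro θ
      rw [add_sub_cancel_left, norm_mul, hun, Complex.norm_real, mul_one,
          Real.norm_of_nonneg hR0.le]
    have hcont : Continuous fun θ : ℝ => U (z₀ + R * u θ) := by fun_prop
    have e : (∫ θ in (-Real.pi)..Real.pi, U (z₀ + R * u θ)) - 2 * Real.pi * (T * Real.log R) -
        2 * Real.pi * L = ∫ θ in (-Real.pi)..Real.pi, (U (z₀ + R * u θ) - T * Real.log R - L) := by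
      rw [intervalIntegral.integral_sub (Continuous.intervalIntegrable (by fun_prop) _ _)
        (Continuous.intervalIntegrable (by fun_prop) _ _),
        intervalIntegral.integral_sub (hcont.intervalIntegrable _ _)
        (Continuous.intervalIntegrable (by fun_prop) _ _)]
      simp
      ring
    rw [Real.dist_eq, e, ← Real.norm_eq_abs]
    refine (intervalIntegral.norm_integral_le_of_norm_le_const (C := η /
        (4 * Real.pi)) ?_).trans_lt ?_
    · intro θ _
      have hmem : z₀ + R * u θ ∈ (Metric.closedBall z₀ M)ᶜ := by
        rw [mem_compl_iff, Metric.mem_closedBall, dist_eq_norm, hn, not_le]; exact hRM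
      have := hM hmem
      rw [mem_preimage, Metric.mem_ball, Real.dist_eq, hn] at this
      exact this.le
    · have : |Real.pi - -Real.pi| = 2 * Real.pi := by
        rw [abs_of_nonneg] <;> linarith [Real.pi_pos]
      rw [this]
      have hpi := Real.pi_pos
      have : η / (4 * Real.pi) * (2 * Real.pi) = η / 2 := by field_simp; norm_num
      rw [this]; linarith
  set I := ∫ w in K, Real.log ‖w - z₀‖ with hI
  have hev : ∀ᶠ R : ℝ in atTop, (4 * volume.real K - 2 * Real.pi * T) * Real.log R =
      (∫ θ in (-Real.pi)..Real.pi, U (z₀ + R * u θ)) - 2 * Real.pi * (T * Real.log R) -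
        2 * Real.pi * U z₀ + 4 * I := by
    obtain ⟨M, hM⟩ := hK.isBounded.subset_ball z₀
    filter_upwards [eventually_gt_atTop 0, eventually_ge_atTop M] with R hR0 hRM
    have := integral_log_add_circle hK hG hU hdiv z₀ hR0 (hM.trans (Metric.ball_subset_ball hRM))
    linarith
  have hlim : Tendsto (fun R : ℝ => (4 * volume.real K - 2 * Real.pi * T) * Real.log R) atTop
      (𝓝 (2 * Real.pi * L - 2 * Real.pi * U z₀ + 4 * I)) :=
    ((hA.sub_const _).add_const _).congr' (hev.mono fun R h => h.symm)
  have hcoef : 4 * volume.real K - 2 * Real.pi * T = 0 := by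
    by_contra hne
    have := hlim.const_mul (4 * volume.real K - 2 * Real.pi * T)⁻¹
    simp only [inv_mul_cancel_left₀ hne] at this
    exact not_tendsto_nhds_of_tendsto_atTop Real.tendsto_log_atTop _ this
  refine ⟨by linarith, ?_⟩
  simp only [hcoef, zero_mul] at hlim
  have := tendsto_nhds_unique hlim tendsto_const_nhds
  linarith

end FundamentalSolution

/-! ### The parameters in terms of the second zero -/

/-- The parameters expressed through `ρ`, `α` and `β`, where `β ∈ (0, α)` is the second zero of
`f - a`, the first being `1/α`. -/
structure IsSecondZero (a c t ρ κ α β : ℝ) : Prop where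
  rho_pos : 0 < ρ
  beta_pos : 0 < β
  beta_lt : β < α
  alpha_lt_one : α < 1
  kappa_eq : κ = ρ * (α - β) * (1 - α ^ 2) / α
  a_eq : a = ρ * β / α ^ 2
  c_eq : c = ρ ^ 2 * (α - β) * (1 - α * β) / α ^ 3
  t_eq : t = ρ ^ 2 * (1 - ((α - β) / α) ^ 2)

/-- The second zero of `f - a` is `conjugateRoot (1/α) = α - κ α / (ρ (1 - α²))`. -/
theorem IsMatched.exists_isSecondZero {a c t ρ κ α : ℝ} (hp : IsUnivalentParam ρ κ α)
    (hm : IsMatched a c t ρ κ α) : ∃ β, IsSecondZero a c t ρ κ α β := by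
  obtain ⟨e1, e2, e3⟩ := hm
  have h0 := hp.alpha_pos
  have hρ := hp.rho_pos
  have h2 := hp.one_sub_sq_pos
  have hs := hp.ratio_pos
  have hs1 := hp.ratio_lt_one
  have h4 : (1 : ℝ) / α - α = (1 - α ^ 2) / α := by field_simp
  rw [h4] at e1 e2
  set s := κ / (ρ * (1 - α ^ 2)) with hsdef
  have hκ : κ = ρ * s * (1 - α ^ 2) := by rw [hsdef]; field_simp
  have hc : c = ρ ^ 2 * (α - α * (1 - s)) * (1 - α * (α * (1 - s))) / α ^ 3 := by
    have : c = κ * (ρ + κ / ((1 - α ^ 2) / α) ^ 2) / α ^ 2 := by rw [e2]; field_simp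
    rw [this, hκ]; field_simp; ring
  refine ⟨α * (1 - s), hρ, mul_pos h0 (sub_pos.2 hs1), by nlinarith, hp.alpha_lt_one, ?_, ?_, hc,
      ?_⟩
  · rw [hκ]; field_simp; ring
  · rw [← e1, hκ]; field_simp; ring
  · have : t = ρ * (ρ + κ / α ^ 2) - c := by linarith
    rw [this, hc, hκ]; field_simp; ring

namespace IsSecondZero

variable {a c t ρ κ α β : ℝ} (hz : IsSecondZero a c t ρ κ α β)
include hz

theorem alpha_pos : 0 < α := hz.beta_pos.trans hz.beta_lt

theorem isUnivalentParam : IsUnivalentParam ρ κ α := by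
  have h0 := hz.alpha_pos
  have h1 := hz.alpha_lt_one
  have h2 : 0 < 1 - α ^ 2 := by nlinarith
  have hab := sub_pos.2 hz.beta_lt
  have hρ := hz.rho_pos
  refine ⟨hz.rho_pos, ?_, h0, h1, ?_⟩
  · rw [hz.kappa_eq]; positivity
  · rw [hz.kappa_eq, div_lt_iff₀ h0]
    have : 0 < ρ * (1 - α ^ 2) * β := mul_pos (mul_pos hρ h2) hz.beta_pos
    nlinarith

theorem sub_beta_ne_zero {v : ℂ} (hv : v ∈ closedExterior) : v - β ≠ 0 :=
  sub_ne_zero_of_closedExterior hz.beta_pos (hz.beta_lt.trans hz.alpha_lt_one) hv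

theorem sub_alpha_ne_zero {v : ℂ} (hv : v ∈ closedExterior) : v - α ≠ 0 :=
  sub_ne_zero_of_closedExterior hz.alpha_pos hz.alpha_lt_one hv

theorem ratMap_sub_a {v : ℂ} (hv : v - α ≠ 0) :
    ratMap ρ κ α v - a = ρ * (α * v - 1) * (v - β) / (α * (v - α)) := by
  have h0 : (α : ℂ) ≠ 0 := by exact_mod_cast hz.alpha_pos.ne'
  rw [hz.kappa_eq, hz.a_eq]
  unfold ratMap
  push_cast
  field_simp
  ring

theorem ratMap_inv_alpha : ratMap ρ κ α (1 / α : ℂ) = a := by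
  have h0 : (α : ℂ) ≠ 0 := by exact_mod_cast hz.alpha_pos.ne'
  have h2 : (1 - α ^ 2 : ℂ) ≠ 0 := by exact_mod_cast hz.isUnivalentParam.one_sub_sq_pos.ne'
  have h : (1 / α : ℂ) - α ≠ 0 := by
    have : (1 / α : ℂ) - α = (1 - α ^ 2) / α := by field_simp
    rw [this]; exact div_ne_zero h2 h0
  rw [← sub_eq_zero, hz.ratMap_sub_a h]
  have : (α : ℂ) * (1 / α) - 1 = 0 := by field_simp; ring
  rw [this]; simp

theorem inv_alpha_mem : (1 / α : ℂ) ∈ exteriorDisk := by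
  rw [mem_exteriorDisk, norm_div, norm_one, Complex.norm_real, Real.norm_of_nonneg hz.alpha_pos.le]
  exact (one_lt_div hz.alpha_pos).2 hz.alpha_lt_one

theorem a_notMem : (a : ℂ) ∉ omittedSet ρ κ α := fun h =>
  h ⟨_, hz.inv_alpha_mem, hz.ratMap_inv_alpha⟩

end IsSecondZero

/-! ### The gradient of the potential -/

/-- The function `f(1/v) - c / (f(v) - a)`, in which the pole at `1/α` cancels. -/
noncomputable def outerField (ρ α β : ℝ) (v : ℂ) : ℂ :=
  ρ / v - ((ρ * (α - β) ^ 2 / α ^ 2 : ℝ) : ℂ) / (v - β)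

/-- A primitive of `outerField * f'` in the sense of `2 Re`. -/
noncomputable def outerPotential (a c t ρ κ α β : ℝ) (v : ℂ) : ℝ :=
  2 * (c + t) * Real.log ‖v‖ - 2 * c * Real.log ‖v - β‖ - 2 * κ * a * (1 / (v - α)).re
    - 2 * c * Real.log ρ

/-- The constant value of `|f|² - 2 c log |f - a| - outerPotential` on the unit circle. -/
noncomputable def boundaryConst (a c t κ α : ℝ) : ℝ := c + t - κ * a / α + 2 * c * Real.log α

open Classical in
/-- The gradient field: `conj z - c / (z - a)` on the region, and `S(z) - c / (z - a)` outside. -/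
noncomputable def gradField (a c ρ κ α β : ℝ) (z : ℂ) : ℂ :=
  if z ∈ omittedSet ρ κ α then starRingEnd ℂ z - c / (z - a)
  else outerField ρ α β (closedInv ρ κ α z)

open Classical in
/-- The potential whose `z`-derivative is `gradField`. -/
noncomputable def potential (a c t ρ κ α β : ℝ) (z : ℂ) : ℝ :=
  if z ∈ omittedSet ρ κ α then
    ‖z‖ ^ 2 - 2 * c * Real.log ‖z - a‖ - boundaryConst a c t κ α
  else outerPotential a c t ρ κ α β (closedInv ρ κ α z)

theorem conj_ratMap (ρ κ α : ℝ) (v : ℂ) :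
    starRingEnd ℂ (ratMap ρ κ α v) = ratMap ρ κ α (starRingEnd ℂ v) := by
  unfold ratMap
  simp only [map_sub, map_mul, map_div₀, Complex.conj_ofReal]

theorem conj_eq_one_div {v : ℂ} (hv : ‖v‖ = 1) : starRingEnd ℂ v = 1 / v := by
  have h0 : v ≠ 0 := by rintro rfl; rw [norm_zero] at hv; linarith
  rw [eq_div_iff h0, mul_comm, Complex.mul_conj', hv]; norm_num

namespace IsSecondZero

variable {a c t ρ κ α β : ℝ} (hz : IsSecondZero a c t ρ κ α β)
include hz

theorem mul_sub_one_ne_zero {v : ℂ} (h : ratMap ρ κ α v ≠ a) (hv : v - α ≠ 0) :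
    (α : ℂ) * v - 1 ≠ 0 := by
  intro h'
  apply h
  rw [← sub_eq_zero, hz.ratMap_sub_a hv, h']; simp

/-- In the coordinate `v`, the function `S(z) - c / (z - a)` is `outerField`. -/
theorem outerField_eq {v : ℂ} (hv : v ∈ closedExterior) (hva : ratMap ρ κ α v ≠ a) :
    ratMap ρ κ α (1 / v) - c / (ratMap ρ κ α v - a) = outerField ρ α β v := by
  have h0 : (α : ℂ) ≠ 0 := by exact_mod_cast hz.alpha_pos.ne'
  have hρ : (ρ : ℂ) ≠ 0 := by exact_mod_cast hz.rho_pos.ne'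
  have hvα := hz.sub_alpha_ne_zero hv
  have hvβ := hz.sub_beta_ne_zero hv
  have hv0 := ne_zero_of_closedExterior hv
  have h1 := hz.mul_sub_one_ne_zero hva hvα
  rw [hz.ratMap_sub_a hvα, hz.kappa_eq, hz.c_eq]
  have e : 1 / v - (α : ℂ) = -((α * v - 1) / v) := by field_simp; ring
  unfold ratMap outerField
  rw [e]
  obtain ⟨d, hd⟩ : ∃ d, (α : ℂ) * v - 1 = d := ⟨_, rfl⟩
  rw [hd] at h1 ⊢
  push_cast
  field_simp
  rw [← hd]
  ring

/-- The pullback of `2 Re (S(z) - c / (z - a)) dz` under `f` has the primitive `outerPotential`. -/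
theorem hasFDerivAt_outerPotential {v : ℂ} (hv : v ∈ closedExterior) :
    HasFDerivAt (outerPotential a c t ρ κ α β)
      (reForm (outerField ρ α β v * (ρ + κ / (v - α) ^ 2))) v := by
  have h0 : (α : ℂ) ≠ 0 := by exact_mod_cast hz.alpha_pos.ne'
  have hρ : (ρ : ℂ) ≠ 0 := by exact_mod_cast hz.rho_pos.ne'
  have hvα := hz.sub_alpha_ne_zero hv
  have hvβ := hz.sub_beta_ne_zero hv
  have hv0 := ne_zero_of_closedExterior hv
  have d1 : HasFDerivAt (fun v : ℂ => Real.log ‖v‖) (reForm (1 / (2 * v))) v := by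
    have := hasFDerivAt_log_norm 0 (w := v) (by simpa using hv0)
    simpa using this
  have d2 := hasFDerivAt_log_norm (β : ℂ) hvβ
  have d3 : HasFDerivAt (fun v : ℂ => (1 / (v - α)).re)
      (Complex.reCLM ∘L ((ContinuousLinearMap.mul ℝ ℂ) (-1 / (v - α) ^ 2))) v := by
    have h1 : HasDerivAt (fun v : ℂ => 1 / (v - α)) (-1 / (v - α) ^ 2) v := by
      have := (hasDerivAt_const v (1 : ℂ)).div ((hasDerivAt_id v).sub_const (α : ℂ)) hvα
      refine this.congr_deriv ?_
      simp
    have h2 := Complex.reCLM.hasFDerivAt.comp v (h1.hasFDerivAt.restrictScalars ℝ)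
    refine h2.congr_fderiv ?_
    ext h
    simp [mul_comm]
  have d := (((d1.const_mul (2 * (c + t))).sub (d2.const_mul (2 * c))).sub
    (d3.const_mul (2 * κ * a))).sub_const (2 * c * Real.log ρ)
  refine d.congr_fderiv ?_
  ext h
  have e : outerField ρ α β v * (ρ + κ / (v - α) ^ 2) =
      ((c + t : ℝ) : ℂ) / v - (c : ℂ) / (v - β) + ((κ * a : ℝ) : ℂ) / (v - α) ^ 2 := by
    rw [hz.kappa_eq, hz.c_eq, hz.a_eq, hz.t_eq]
    unfold outerField
    push_cast
    field_simp
    ring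
  rw [reForm_apply, e]
  have e1 : 1 / (2 * v) * h = ((1 / 2 : ℝ) : ℂ) * (h / v) := by push_cast; field_simp
  have e2 : 1 / (2 * (v - β)) * h = ((1 / 2 : ℝ) : ℂ) * (h / (v - β)) := by push_cast; field_simp
  have e3 : -1 / (v - α) ^ 2 * h = ((-1 : ℝ) : ℂ) * (h / (v - α) ^ 2) := by push_cast; field_simp
  have e4 : (((c + t : ℝ) : ℂ) / v - (c : ℂ) / (v - β) + ((κ * a : ℝ) : ℂ) / (v - α) ^ 2) * h =
      ((c + t : ℝ) : ℂ) * (h / v) - (c : ℂ) * (h / (v - β)) +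
        ((κ * a : ℝ) : ℂ) * (h / (v - α) ^ 2) := by ring
  have e5 : ((2 * (c + t)) • reForm (1 / (2 * v)) - (2 * c) • reForm (1 / (2 * (v - β))) -
      (2 * κ * a) • Complex.reCLM ∘L (ContinuousLinearMap.mul ℝ ℂ) (-1 / (v - α) ^ 2)) h =
      2 * (c + t) * (2 * (1 / (2 * v) * h).re) - 2 * c * (2 * (1 / (2 * (v - β)) * h).re) -
        2 * κ * a * (-1 / (v - α) ^ 2 * h).re := rfl
  rw [e5, e1, e2, e3, e4, Complex.add_re, Complex.sub_re]
  simp only [Complex.re_ofReal_mul]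
  ring

/-- The two formulas that define `potential` agree on the boundary curve. -/
theorem boundary_eq {v : ℂ} (hv : ‖v‖ = 1) :
    ‖ratMap ρ κ α v‖ ^ 2 - 2 * c * Real.log ‖ratMap ρ κ α v - a‖ - boundaryConst a c t κ α =
      outerPotential a c t ρ κ α β v := by
  have h0 : (α : ℂ) ≠ 0 := by exact_mod_cast hz.alpha_pos.ne'
  have hρ : (ρ : ℂ) ≠ 0 := by exact_mod_cast hz.rho_pos.ne'
  have hve : v ∈ closedExterior := hv.ge
  have hvα := hz.sub_alpha_ne_zero hve
  have hvβ := hz.sub_beta_ne_zero hve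
  have hv0 := ne_zero_of_closedExterior hve
  -- on the circle `|α v - 1| = |v - α|`
  have hn : ‖(α : ℂ) * v - 1‖ = ‖v - α‖ := by
    rw [← norm_mobius_eq_of_norm_one (x := α) hv, norm_sub_rev]
  have hlog : Real.log ‖ratMap ρ κ α v - a‖ = Real.log ρ + Real.log ‖v - β‖ - Real.log α := by
    rw [hz.ratMap_sub_a hvα, norm_div, norm_mul, norm_mul, norm_mul, hn, Complex.norm_real,
      Complex.norm_real, Real.norm_of_nonneg hz.rho_pos.le, Real.norm_of_nonneg hz.alpha_pos.le]
    have e : ρ * ‖v - α‖ * ‖v - β‖ / (α * ‖v - α‖) = ρ * ‖v - β‖ / α := by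
      have := norm_ne_zero_iff.2 hvα
      have := hz.alpha_pos
      field_simp
    rw [e, Real.log_div (mul_ne_zero hz.rho_pos.ne' (norm_ne_zero_iff.2 hvβ)) hz.alpha_pos.ne',
      Real.log_mul hz.rho_pos.ne' (norm_ne_zero_iff.2 hvβ)]
  have hsq : ‖ratMap ρ κ α v‖ ^ 2 = c + t - κ * a / α - 2 * κ * a * (1 / (v - α)).re := by
    have hcv : starRingEnd ℂ (1 / (v - α)) = 1 / (1 / v - α) := by
      rw [map_div₀, map_one, map_sub, Complex.conj_ofReal, conj_eq_one_div hv]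
    have hve' : (1 : ℂ) / v - α ≠ 0 := by
      rw [← conj_eq_one_div hv, ← Complex.conj_ofReal, ← map_sub]
      exact (map_ne_zero _).2 hvα
    have h1 : (1 : ℂ) - α * v ≠ 0 := by
      have : (1 : ℂ) / v - α = (1 - α * v) / v := by field_simp
      rw [this] at hve'
      exact (div_ne_zero_iff.1 hve').1
    have e : ratMap ρ κ α v * ratMap ρ κ α (1 / v) =
        ((c + t - κ * a / α : ℝ) : ℂ) - ((κ * a : ℝ) : ℂ) * (1 / (v - α) + 1 / (1 / v - α)) := by
      have e0 : (1 : ℂ) / v - α = (1 - α * v) / v := by field_simp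
      rw [hz.kappa_eq, hz.c_eq, hz.a_eq, hz.t_eq]
      unfold ratMap
      rw [e0]
      obtain ⟨d, hd⟩ : ∃ d, 1 - (α : ℂ) * v = d := ⟨_, rfl⟩
      rw [hd] at h1 ⊢
      push_cast
      field_simp
      rw [← hd]
      ring
    have e2 := Complex.mul_conj' (ratMap ρ κ α v)
    rw [conj_ratMap, conj_eq_one_div hv, e, ← hcv, Complex.add_conj] at e2
    have e3 : ((c + t - κ * a / α - κ * a * (2 * (1 / (v - α)).re) : ℝ) : ℂ) =
        ((‖ratMap ρ κ α v‖ ^ 2 : ℝ) : ℂ) := by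
      rw [Complex.ofReal_pow, ← e2]; push_cast; ring
    have e4 := Complex.ofReal_injective e3
    rw [← e4]; ring
  unfold outerPotential boundaryConst
  rw [hlog, hsq, hv, Real.log_one]
  ring

end IsSecondZero

/-! ### Regularity of the gradient field -/

/-- Lipschitz functions on two closed sets that cover a real normed space glue: a segment from one
set to the other meets their intersection. -/
theorem lipschitzWith_glue {E F : Type*} [NormedAddCommGroup E] [NormedSpace ℝ E]
    [PseudoMetricSpace F] {f : E → F} {s t : Set E} {C D : NNReal} (hs : IsClosed s)
    (ht : IsClosed t) (hst : s ∪ t = univ) (hfs : LipschitzOnWith C f s)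
    (hft : LipschitzOnWith D f t) : LipschitzWith (max C D) f := by
  have key : ∀ x ∈ s, ∀ y ∈ t, dist (f x) (f y) ≤ (max C D : NNReal) * dist x y := by
    intro x hx y hy
    obtain ⟨p, hp, hps, hpt⟩ : (segment ℝ x y ∩ (s ∩ t)).Nonempty :=
      isPreconnected_closed_iff.1 (convex_segment x y).isPreconnected s t hs ht
        (by rw [hst]; exact subset_univ _) ⟨x, left_mem_segment ℝ x y, hx⟩
        ⟨y, right_mem_segment ℝ x y, hy⟩
    rw [mem_segment_iff_wbtw] at hp
    have hd := hp.dist_add_dist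
    have h1 := hfs.dist_le_mul x hx p hps
    have h2 := hft.dist_le_mul p hpt y hy
    have m1 : (C : ℝ) ≤ (max C D : NNReal) := by exact_mod_cast le_max_left C D
    have m2 : (D : ℝ) ≤ (max C D : NNReal) := by exact_mod_cast le_max_right C D
    refine (dist_triangle _ (f p) _).trans ?_
    rw [← hd, mul_add]
    exact add_le_add (h1.trans (mul_le_mul_of_nonneg_right m1 dist_nonneg))
      (h2.trans (mul_le_mul_of_nonneg_right m2 dist_nonneg))
  refine LipschitzWith.of_dist_le_mul fun x y => ?_
  have m1 : (C : ℝ) ≤ (max C D : NNReal) := by exact_mod_cast le_max_left C D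
  have m2 : (D : ℝ) ≤ (max C D : NNReal) := by exact_mod_cast le_max_right C D
  have hx : x ∈ s ∪ t := hst ▸ mem_univ x
  have hy : y ∈ s ∪ t := hst ▸ mem_univ y
  rcases hx with hx | hx <;> rcases hy with hy | hy
  · exact (hfs.dist_le_mul x hx y hy).trans (mul_le_mul_of_nonneg_right m1 dist_nonneg)
  · exact key x hx y hy
  · rw [dist_comm, dist_comm x]; exact key y hy x hx
  · exact (hft.dist_le_mul x hx y hy).trans (mul_le_mul_of_nonneg_right m2 dist_nonneg)

theorem exists_lipschitzOnWith_div_sub {s : Set ℂ} {b : ℂ} {d : ℝ} (hd : 0 < d)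
    (hs : ∀ z ∈ s, d ≤ ‖z - b‖) (k : ℂ) :
    ∃ C, LipschitzOnWith C (fun z => k / (z - b)) s := by
  refine ⟨Real.toNNReal (‖k‖ / d ^ 2), LipschitzOnWith.of_dist_le_mul fun x hx y hy => ?_⟩
  have hx1 := hs x hx
  have hy1 := hs y hy
  have hx0 : x - b ≠ 0 := norm_pos_iff.1 (hd.trans_le hx1)
  have hy0 : y - b ≠ 0 := norm_pos_iff.1 (hd.trans_le hy1)
  have e : k / (x - b) - k / (y - b) = k * (y - x) / ((x - b) * (y - b)) := by field_simp; ring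
  rw [Real.coe_toNNReal _ (by positivity), dist_eq_norm, e, norm_div, norm_mul, norm_mul,
    dist_comm, dist_eq_norm, div_mul_eq_mul_div]
  refine div_le_div_of_nonneg_left (by positivity) (by positivity) ?_
  nlinarith

namespace IsSecondZero

variable {a c t ρ κ α β : ℝ} (hz : IsSecondZero a c t ρ κ α β)
include hz

theorem gradField_ratMap {v : ℂ} (hv : v ∈ closedExterior) :
    gradField a c ρ κ α β (ratMap ρ κ α v) = outerField ρ α β v := by
  have hp := hz.isUnivalentParam
  unfold gradField
  split_ifs with h
  · -- a point of the curve
    have hva : ratMap ρ κ α v ≠ a := fun e => hz.a_notMem (e ▸ h)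
    have hv1 : ‖v‖ = 1 := by
      have hv' : 1 ≤ ‖v‖ := hv
      refine le_antisymm (not_lt.1 fun h1 => h ⟨v, h1, rfl⟩) hv'
    rw [conj_ratMap, conj_eq_one_div hv1, hz.outerField_eq hv hva]
  · rw [hp.closedInv_ratMap hv]

theorem potential_ratMap {v : ℂ} (hv : v ∈ closedExterior) :
    potential a c t ρ κ α β (ratMap ρ κ α v) = outerPotential a c t ρ κ α β v := by
  have hp := hz.isUnivalentParam
  unfold potential
  split_ifs with h
  · have hv1 : ‖v‖ = 1 := by
      have hv' : 1 ≤ ‖v‖ := hv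
      refine le_antisymm (not_lt.1 fun h1 => h ⟨v, h1, rfl⟩) hv'
    rw [hz.boundary_eq hv1]
  · rw [hp.closedInv_ratMap hv]

theorem exists_lipschitzOnWith_outerField :
    ∃ C, LipschitzOnWith C (outerField ρ α β) closedExterior := by
  have h1 : ∃ C, LipschitzOnWith C (fun v : ℂ => (ρ : ℂ) / (v - 0)) closedExterior :=
    exists_lipschitzOnWith_div_sub one_pos (fun v hv => by rw [sub_zero]; exact hv) _
  have h2 : ∃ C, LipschitzOnWith C
      (fun v : ℂ => ((ρ * (α - β) ^ 2 / α ^ 2 : ℝ) : ℂ) / (v - β)) closedExterior := by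
    have hb : β < 1 := hz.beta_lt.trans hz.alpha_lt_one
    refine exists_lipschitzOnWith_div_sub (sub_pos.2 hb) (fun v hv => ?_) _
    have hv : 1 ≤ ‖v‖ := hv
    have := norm_sub_norm_le v (β : ℂ)
    rw [Complex.norm_real, Real.norm_of_nonneg hz.beta_pos.le] at this
    linarith
  obtain ⟨C, hC⟩ := h1
  obtain ⟨D, hD⟩ := h2
  simp only [sub_zero] at hC
  exact ⟨C + D, hC.sub hD⟩

theorem exists_dist_a : ∃ d : ℝ, 0 < d ∧ ∀ z ∈ omittedSet ρ κ α, d ≤ ‖z - a‖ := by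
  have hK := hz.isUnivalentParam.isCompact_omittedSet.isClosed
  obtain ⟨d, hd, h⟩ := Metric.isOpen_iff.1 hK.isOpen_compl _ hz.a_notMem
  refine ⟨d, hd, fun z hzK => ?_⟩
  by_contra hlt
  push Not at hlt
  exact h (by rwa [Metric.mem_ball, dist_eq_norm]) hzK

/-- Both formulas for the gradient field are Lipschitz on closed sets, and they agree on the
boundary curve because `S(z) = conj z` there. -/
theorem exists_lipschitzWith_gradField : ∃ C, LipschitzWith C (gradField a c ρ κ α β) := by
  have hp := hz.isUnivalentParam
  obtain ⟨d, hd, hda⟩ := hz.exists_dist_a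
  obtain ⟨C₁, h1⟩ := exists_lipschitzOnWith_div_sub hd hda (c : ℂ)
  obtain ⟨C₂, h2⟩ := hz.exists_lipschitzOnWith_outerField
  obtain ⟨C₃, h3⟩ := hp.exists_lipschitzOnWith_closedInv
  have hconj : LipschitzOnWith 1 (starRingEnd ℂ) (omittedSet ρ κ α) :=
    LipschitzOnWith.of_dist_le_mul fun x _ y _ => by
      rw [dist_eq_norm, ← map_sub, Complex.norm_conj, dist_eq_norm, NNReal.coe_one, one_mul]
  have hK : LipschitzOnWith (1 + C₁) (gradField a c ρ κ α β) (omittedSet ρ κ α) := by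
    intro x hx y hy
    have := (hconj.sub h1) hx hy
    unfold gradField
    rwa [if_pos hx, if_pos hy]
  have hL : LipschitzOnWith (C₂ * C₃) (gradField a c ρ κ α β) (ratMap ρ κ α '' closedExterior) := by
    have hmaps : MapsTo (closedInv ρ κ α) (ratMap ρ κ α '' closedExterior) closedExterior := by
      rintro _ ⟨v, hv, rfl⟩
      rw [hp.closedInv_ratMap hv]; exact hv
    have := h2.comp h3 hmaps
    rintro _ ⟨v, hv, rfl⟩ _ ⟨w, hw, rfl⟩
    have h := this (mem_image_of_mem _ hv) (mem_image_of_mem _ hw)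
    simp only [Function.comp, hp.closedInv_ratMap hv, hp.closedInv_ratMap hw] at h
    rwa [hz.gradField_ratMap hv, hz.gradField_ratMap hw]
  exact ⟨_, lipschitzWith_glue hp.isCompact_omittedSet.isClosed hp.isClosed_image_closedExterior
    hp.omittedSet_union_image hK hL⟩

/-- On the boundary curve the two one-sided derivatives agree, so that `potential` is differentiable
everywhere. -/
theorem hasFDerivAt_potential (z : ℂ) :
    HasFDerivAt (potential a c t ρ κ α β) (reForm (gradField a c ρ κ α β z)) z := by
  have hp := hz.isUnivalentParam
  rw [← hasFDerivWithinAt_univ, ← hp.omittedSet_union_image]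
  refine HasFDerivWithinAt.union ?_ ?_
  · by_cases h : z ∈ omittedSet ρ κ α
    · have hza : z - a ≠ 0 := fun e => hz.a_notMem (sub_eq_zero.1 e ▸ h)
      have d1 : HasFDerivAt (fun z : ℂ => ‖z‖ ^ 2) (2 • (innerSL ℝ) z) z :=
        (hasStrictFDerivAt_norm_sq z).hasFDerivAt
      have d2 := (hasFDerivAt_log_norm (a : ℂ) hza).const_mul (2 * c)
      have d := ((d1.sub d2).sub_const (boundaryConst a c t κ α)).hasFDerivWithinAt
        (s := omittedSet ρ κ α)
      refine (d.congr_fderiv ?_).congr (fun w hw => ?_) ?_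
      · ext h'
        have e0 : ((2 • (innerSL ℝ) z : ℂ →L[ℝ] ℝ) - (2 * c) • reForm (1 / (2 * (z - a)))) h' =
            2 * (starRingEnd ℂ z * h').re - 2 * c * (2 * (1 / (2 * (z - a)) * h').re) := by
          simp [Complex.inner]
          ring
        have e1 : 1 / (2 * (z - a)) * h' = ((1 / 2 : ℝ) : ℂ) * (h' / (z - a)) := by
          push_cast; field_simp
        have e2 : (starRingEnd ℂ z - c / (z - a)) * h' =
            starRingEnd ℂ z * h' - (c : ℂ) * (h' / (z - a)) := by ring
        rw [e0, reForm_apply]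
        unfold gradField
        rw [if_pos h, e1, e2, Complex.sub_re, Complex.re_ofReal_mul, Complex.re_ofReal_mul]
        ring
      · unfold potential; rw [if_pos hw]; rfl
      · unfold potential; rw [if_pos h]; rfl
    · refine HasFDerivWithinAt.of_notMem_closure ?_
      rwa [hp.isCompact_omittedSet.isClosed.closure_eq]
  · by_cases h : z ∈ ratMap ρ κ α '' closedExterior
    · obtain ⟨v, hv, rfl⟩ := h
      have d1 := hp.hasDerivWithinAt_closedInv hv
      have d2 := hz.hasFDerivAt_outerPotential hv
      have d2' : HasFDerivAt (outerPotential a c t ρ κ α β)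
          (reForm (outerField ρ α β v * (ρ + κ / (v - α) ^ 2)))
          (closedInv ρ κ α (ratMap ρ κ α v)) := by
        rwa [hp.closedInv_ratMap hv]
      have d := d2'.comp_hasFDerivWithinAt _ (d1.hasFDerivWithinAt.restrictScalars ℝ)
      refine (d.congr_fderiv ?_).congr ?_ ?_
      · ext h'
        have hne := hp.deriv_ne_zero hv
        have e : ((reForm (outerField ρ α β v * (ρ + κ / (v - α) ^ 2))).comp
            (ContinuousLinearMap.restrictScalars ℝ
              (ContinuousLinearMap.toSpanSingleton ℂ ((ρ : ℂ) + κ / (v - α) ^ 2)⁻¹))) h' =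
            reForm (outerField ρ α β v * (ρ + κ / (v - α) ^ 2))
              (h' * ((ρ : ℂ) + κ / (v - α) ^ 2)⁻¹) := rfl
        rw [hz.gradField_ratMap hv]
        refine Eq.trans e ?_
        rw [reForm_apply, reForm_apply]
        congr 2
        rw [mul_comm h', ← mul_assoc, mul_inv_cancel_right₀ hne]
      · rintro _ ⟨w, hw, rfl⟩
        rw [hz.potential_ratMap hw, Function.comp, hp.closedInv_ratMap hw]
      · rw [hz.potential_ratMap hv, Function.comp, hp.closedInv_ratMap hv]
    · refine HasFDerivWithinAt.of_notMem_closure ?_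
      rwa [hp.isClosed_image_closedExterior.closure_eq]

theorem hasDerivAt_closedInv {v : ℂ} (hv : v ∈ exteriorDisk) :
    HasDerivAt (closedInv ρ κ α) ((ρ : ℂ) + κ / (v - α) ^ 2)⁻¹ (ratMap ρ κ α v) :=
  (hz.isUnivalentParam.hasDerivWithinAt_closedInv
    (exteriorDisk_subset_closedExterior hv)).hasDerivAt
    (mem_of_superset (hz.isUnivalentParam.isOpen_image_exteriorDisk.mem_nhds
      (mem_image_of_mem _ hv)) (image_mono exteriorDisk_subset_closedExterior))

theorem differentiableAt_gradField {z : ℂ} (h : z ∉ omittedSet ρ κ α) :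
    DifferentiableAt ℂ (gradField a c ρ κ α β) z := by
  have hp := hz.isUnivalentParam
  have hz' := not_not.1 h
  obtain ⟨v, hv, rfl⟩ := hz'
  have hve := exteriorDisk_subset_closedExterior hv
  have d1 : DifferentiableAt ℂ (outerField ρ α β) (closedInv ρ κ α (ratMap ρ κ α v)) := by
    rw [hp.closedInv_ratMap hve]
    unfold outerField
    exact ((differentiableAt_const _).div differentiableAt_id (ne_zero_of_closedExterior hve)).sub
      ((differentiableAt_const _).div (by fun_prop) (hz.sub_beta_ne_zero hve))
  refine (d1.comp _ (hz.hasDerivAt_closedInv hv).differentiableAt).congr_of_eventuallyEq ?_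
  filter_upwards [hp.isOpen_image_exteriorDisk.mem_nhds (mem_image_of_mem _ hv)] with w hw
  obtain ⟨u, hu, rfl⟩ := hw
  rw [hz.gradField_ratMap (exteriorDisk_subset_closedExterior hu), Function.comp,
    hp.closedInv_ratMap (exteriorDisk_subset_closedExterior hu)]

end IsSecondZero

theorem divergence_of_hasFDerivAt {G : ℂ → ℂ} {D : ℂ →L[ℝ] ℂ} {z : ℂ} (h : HasFDerivAt G D z) :
    lineDeriv ℝ (fun z => (G z).re) z 1 - lineDeriv ℝ (fun z => (G z).im) z Complex.I
      = (D 1).re - (D Complex.I).im := by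
  have h1 := (Complex.reCLM.hasFDerivAt.comp z h).hasLineDerivAt 1
  have h2 := (Complex.imCLM.hasFDerivAt.comp z h).hasLineDerivAt Complex.I
  rw [show (fun z => (G z).re) = Complex.reCLM ∘ G from rfl,
    show (fun z => (G z).im) = Complex.imCLM ∘ G from rfl, h1.lineDeriv, h2.lineDeriv]
  rfl

namespace IsSecondZero

variable {a c t ρ κ α β : ℝ} (hz : IsSecondZero a c t ρ κ α β)
include hz

/-- The boundary curve is a null set. -/
theorem volume_frontier : volume (ratMap ρ κ α '' unitCircle) = 0 := by
  refine addHaar_image_eq_zero_of_differentiableOn_of_addHaar_eq_zero volume ?_ ?_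
  · intro v hv
    exact ((hasDerivAt_ratMap ρ κ α (hz.sub_alpha_ne_zero
      (unitCircle_subset_closedExterior hv))).differentiableAt.restrictScalars
      ℝ).differentiableWithinAt
  · have : unitCircle = Metric.sphere (0 : ℂ) 1 := by ext v; simp
    rw [this]; exact Measure.addHaar_sphere _ _ _

/-- The gradient field is holomorphic outside the region, and `conj z` plus a holomorphic function
in its interior. -/
theorem ae_divergence_gradField : ∀ᵐ w, lineDeriv ℝ (fun z => (gradField a c ρ κ α β z).re) w 1 -
    lineDeriv ℝ (fun z => (gradField a c ρ κ α β z).im) w Complex.I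
      = (omittedSet ρ κ α).indicator (fun _ => 2) w := by
  have hp := hz.isUnivalentParam
  filter_upwards [measure_eq_zero_iff_ae_notMem.1 hz.volume_frontier] with w hw
  by_cases h : w ∈ omittedSet ρ κ α
  · have hwi : w ∈ interior (omittedSet ρ κ α) := by
      rw [hp.interior_omittedSet_eq_diff]; exact ⟨h, hw⟩
    have hwa : w - a ≠ 0 := fun e => hz.a_notMem (sub_eq_zero.1 e ▸ h)
    obtain ⟨g, hg⟩ : DifferentiableAt ℂ (fun z : ℂ => (c : ℂ) / (z - a)) w :=
      (differentiableAt_const _).div (by fun_prop) hwa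
    have d := (Complex.conjCLE.toContinuousLinearMap.hasFDerivAt (x := w)).sub
      (hg.restrictScalars ℝ)
    have d' : HasFDerivAt (gradField a c ρ κ α β) _ w := d.congr_of_eventuallyEq <| by
      filter_upwards [mem_interior_iff_mem_nhds.1 hwi] with z hz'
      unfold gradField
      rw [if_pos hz']
      simp
    rw [divergence_of_hasFDerivAt d', indicator_of_mem h]
    have e : g Complex.I = Complex.I * g 1 := by
      rw [← smul_eq_mul, ← g.map_smul, smul_eq_mul, mul_one]
    simp [e]
    norm_num
  · obtain ⟨g, hg⟩ := hz.differentiableAt_gradField h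
    rw [divergence_of_hasFDerivAt (hg.restrictScalars ℝ), indicator_of_notMem h]
    have e : g Complex.I = Complex.I * g 1 := by
      rw [← smul_eq_mul, ← g.map_smul, smul_eq_mul, mul_one]
    simp [e]

/-! ### Behaviour of the potential at infinity -/

theorem tendsto_closedInv_cocompact : Tendsto (closedInv ρ κ α) (cocompact ℂ) (cocompact ℂ) := by
  have hp := hz.isUnivalentParam
  intro s hs
  obtain ⟨T, hT, hTs⟩ := mem_cocompact.1 hs
  have hcl : IsClosed closedExterior := by
    rw [← closure_exteriorDisk]; exact isClosed_closure
  have hc : IsCompact (ratMap ρ κ α '' (T ∩ closedExterior)) :=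
    (hT.inter_right hcl).image_of_continuousOn (hp.continuousOn_ratMap.mono inter_subset_right)
  rw [mem_map]
  filter_upwards [hc.compl_mem_cocompact, hp.isCompact_omittedSet.compl_mem_cocompact] with z h1 h2
  obtain ⟨v, hv, rfl⟩ := not_not.1 h2
  have hve := exteriorDisk_subset_closedExterior hv
  rw [mem_preimage, hp.closedInv_ratMap hve]
  exact hTs fun hvT => h1 ⟨v, ⟨hvT, hve⟩, rfl⟩

theorem eventually_eq_ratMap_closedInv : ∀ᶠ z in cocompact ℂ,
    closedInv ρ κ α z ∈ exteriorDisk ∧ ratMap ρ κ α (closedInv ρ κ α z) = z := by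
  have hp := hz.isUnivalentParam
  filter_upwards [hp.isCompact_omittedSet.compl_mem_cocompact] with z h2
  obtain ⟨v, hv, rfl⟩ := not_not.1 h2
  rw [hp.closedInv_ratMap (exteriorDisk_subset_closedExterior hv)]
  exact ⟨hv, rfl⟩

theorem tendsto_potential : Tendsto (fun z => potential a c t ρ κ α β z - 2 * t * Real.log ‖z‖)
    (cocompact ℂ) (𝓝 (-(2 * (t + c) * Real.log ρ))) := by
  have hp := hz.isUnivalentParam
  have hi : Tendsto (fun v : ℂ => v⁻¹) (cocompact ℂ) (𝓝 0) := by
    rw [← Metric.cobounded_eq_cocompact]; exact tendsto_inv₀_cobounded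
  -- in the coordinate `v`
  have lim : Tendsto (fun v : ℂ => -2 * c * Real.log ‖1 - β * v⁻¹‖
      - 2 * κ * a * (v⁻¹ * (1 - α * v⁻¹)⁻¹).re - 2 * c * Real.log ρ
      - 2 * t * Real.log ‖mulAtInfinity ρ κ α v⁻¹‖) (cocompact ℂ)
      (𝓝 (-2 * c * Real.log 1 - 2 * κ * a *
          (0 : ℂ).re - 2 * c * Real.log ρ - 2 * t * Real.log ρ)) := by
    have l1 : Tendsto (fun v : ℂ => ‖1 - β * v⁻¹‖) (cocompact ℂ) (𝓝 1) := by
      have := ((hi.const_mul (β : ℂ)).const_sub 1).norm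
      simpa using this
    have l2 : Tendsto (fun v : ℂ => v⁻¹ * (1 - α * v⁻¹)⁻¹) (cocompact ℂ) (𝓝 0) := by
      have h1 := ((hi.const_mul (α : ℂ)).const_sub 1)
      rw [mul_zero, sub_zero] at h1
      have := hi.mul (h1.inv₀ one_ne_zero)
      simpa using this
    have l3 : Tendsto (fun v : ℂ => ‖mulAtInfinity ρ κ α v⁻¹‖) (cocompact ℂ) (𝓝 ρ) := by
      have := ((differentiableAt_mulAtInfinity ρ κ α).continuousAt.tendsto.comp hi).norm
      rwa [mulAtInfinity_zero, Complex.norm_real, Real.norm_of_nonneg hz.rho_pos.le] at this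
    have k1 := (Real.continuousAt_log one_ne_zero).tendsto.comp l1
    have k2 := (Complex.continuous_re.tendsto 0).comp l2
    have k3 := (Real.continuousAt_log hz.rho_pos.ne').tendsto.comp l3
    exact (((k1.const_mul _).sub (k2.const_mul _)).sub_const _).sub (k3.const_mul _)
  have e : (-2 * c * Real.log 1 - 2 * κ * a * (0 : ℂ).re - 2 * c * Real.log ρ
      - 2 * t * Real.log ρ) = -(2 * (t + c) * Real.log ρ) := by
    rw [Real.log_one, Complex.zero_re]; ring
  rw [e] at lim
  have hne0 : ∀ᶠ v in cocompact ℂ, mulAtInfinity ρ κ α v⁻¹ ≠ 0 :=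
    hi.eventually ((differentiableAt_mulAtInfinity ρ κ α).continuousAt.eventually_ne
      (by rw [mulAtInfinity_zero]; exact_mod_cast hz.rho_pos.ne'))
  refine (lim.comp hz.tendsto_closedInv_cocompact).congr' ?_
  filter_upwards [hz.eventually_eq_ratMap_closedInv,
    hz.tendsto_closedInv_cocompact.eventually hne0] with z hzv hne
  obtain ⟨hv, hzv⟩ := hzv
  simp only [Function.comp]
  generalize closedInv ρ κ α z = v at *
  subst hzv
  have hve := exteriorDisk_subset_closedExterior hv
  have hv0 := ne_zero_of_closedExterior hve
  have hvβ := hz.sub_beta_ne_zero hve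
  rw [hz.potential_ratMap hve]
  have e1 : ratMap ρ κ α v = v * mulAtInfinity ρ κ α v⁻¹ := by
    have := ratMap_inv_eq (ρ := ρ) (κ := κ) (α := α) (inv_ne_zero hv0)
    rwa [inv_inv] at this
  have e2 : v - β = v * (1 - β * v⁻¹) := by field_simp
  have hne2 : 1 - β * v⁻¹ ≠ 0 := right_ne_zero_of_mul (e2 ▸ hvβ)
  have e3 : 1 / (v - α) = v⁻¹ * (1 - α * v⁻¹)⁻¹ := by
    have : v - α = v * (1 - α * v⁻¹) := by field_simp
    rw [this, one_div, mul_inv]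
  unfold outerPotential
  rw [e1, e2, e3, norm_mul, norm_mul,
      Real.log_mul (norm_ne_zero_iff.2 hv0) (norm_ne_zero_iff.2 hne),
    Real.log_mul (norm_ne_zero_iff.2 hv0) (norm_ne_zero_iff.2 hne2)]
  ring

end IsSecondZero

/-! ### Area and logarithmic potential of the region -/

namespace IsSecondZero

variable {a c t ρ κ α β : ℝ} (hz : IsSecondZero a c t ρ κ α β)
include hz

theorem volume_omittedSet : volume (omittedSet ρ κ α) = ENNReal.ofReal (Real.pi * t) := by
  obtain ⟨C, hC⟩ := hz.exists_lipschitzWith_gradField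
  have h := (area_and_integral_log hz.isUnivalentParam.isCompact_omittedSet hC
    hz.hasFDerivAt_potential hz.ae_divergence_gradField hz.tendsto_potential 0).1
  rw [← ofReal_measureReal hz.isUnivalentParam.isCompact_omittedSet.measure_ne_top, h]
  congr 1; ring

theorem integral_log (z : ℂ) : ∫ w in omittedSet ρ κ α, Real.log ‖z - w‖ =
    Real.pi / 2 * (potential a c t ρ κ α β z + 2 * (t + c) * Real.log ρ) := by
  obtain ⟨C, hC⟩ := hz.exists_lipschitzWith_gradField
  have h := (area_and_integral_log hz.isUnivalentParam.isCompact_omittedSet hC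
    hz.hasFDerivAt_potential hz.ae_divergence_gradField hz.tendsto_potential z).2
  simp only [norm_sub_rev z]
  rw [h]; ring

/-! ### The Schwarz function -/

theorem schwarz_ratMap {v : ℂ} (hv : v ∈ exteriorDisk) :
    ratMap ρ κ α (1 / ratMapInv ρ κ α (ratMap ρ κ α v)) = ratMap ρ κ α (1 / v) := by
  rw [hz.isUnivalentParam.ratMapInv_ratMap hv]

theorem schwarz_sub_eq {z : ℂ} (h : z ∈ (omittedSet ρ κ α)ᶜ) (hza : z ≠ a) :
    ratMap ρ κ α (1 / ratMapInv ρ κ α z) - c / (z - a) = gradField a c ρ κ α β z := by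
  obtain ⟨v, hv, rfl⟩ := not_not.1 h
  have hve := exteriorDisk_subset_closedExterior hv
  rw [hz.schwarz_ratMap hv, hz.outerField_eq hve hza, hz.gradField_ratMap hve]

theorem isSchwarzFunction : IsSchwarzFunction a c t (omittedSet ρ κ α)
    (fun z => ratMap ρ κ α (1 / ratMapInv ρ κ α z)) := by
  have hp := hz.isUnivalentParam
  have h0 := hz.alpha_pos.ne'
  refine ⟨hp.isCompact_omittedSet, hz.volume_omittedSet, fun z hzf => ?_,
    ⟨gradField a c ρ κ α β, ?_, fun z hz1 hz2 => hz.schwarz_sub_eq hz1 hz2⟩, ?_⟩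
  · have hzK : z ∈ omittedSet ρ κ α := hp.isCompact_omittedSet.isClosed.frontier_subset hzf
    have hza : z ≠ a := fun e => hz.a_notMem (e ▸ hzK)
    obtain ⟨C, hC⟩ := hz.exists_lipschitzWith_gradField
    have h1 : Tendsto (fun w => gradField a c ρ κ α β w + c / (w - a)) (𝓝 z)
        (𝓝 (gradField a c ρ κ α β z + c / (z - a))) :=
      (hC.continuous.tendsto z).add (tendsto_const_nhds.div
        (tendsto_id.sub_const (a : ℂ)) (sub_ne_zero.2 hza))
    have e : gradField a c ρ κ α β z + c / (z - a) = starRingEnd ℂ z := by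
      unfold gradField; rw [if_pos hzK, sub_add_cancel]
    rw [e] at h1
    refine (h1.mono_left nhdsWithin_le_nhds).congr' ?_
    filter_upwards [self_mem_nhdsWithin, nhdsWithin_le_nhds (isOpen_ne.mem_nhds hza)] with w h2 h3
    rw [← hz.schwarz_sub_eq h2 h3, sub_add_cancel]
  · exact DifferentiableOn.analyticOnNhd
      (fun z h => (hz.differentiableAt_gradField h).differentiableWithinAt)
      hp.isCompact_omittedSet.isClosed.isOpen_compl
  · have hw : Tendsto (fun z => (closedInv ρ κ α z)⁻¹) (cocompact ℂ) (𝓝 0) := by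
      have hi : Tendsto (fun v : ℂ => v⁻¹) (cocompact ℂ) (𝓝 0) := by
        rw [← Metric.cobounded_eq_cocompact]; exact tendsto_inv₀_cobounded
      exact hi.comp hz.tendsto_closedInv_cocompact
    set E : ℂ → ℂ := fun w => mulAtInfinity ρ κ α w * quotAtZero ρ κ α w with hE
    have hE0 : E 0 = c + t := by
      have : ρ * (ρ + κ / α ^ 2) = c + t := by
        rw [hz.kappa_eq, hz.c_eq, hz.t_eq]; field_simp; ring
      simp only [hE]
      rw [mulAtInfinity_zero, quotAtZero_zero]
      exact_mod_cast this
    have o1 : (fun w => E w - (c + t)) =O[𝓝 0] fun w => w := by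
      have hd : DifferentiableAt ℂ E 0 :=
        (differentiableAt_mulAtInfinity ρ κ α).mul (differentiableAt_quotAtZero ρ κ α h0)
      have := hd.isBigO_sub
      simpa only [hE0, sub_zero] using this
    have o2 : mulAtInfinity ρ κ α =O[𝓝 0] fun _ => (1 : ℂ) :=
      (differentiableAt_mulAtInfinity ρ κ α).continuousAt.isBigO_one ℂ
    have o1' := o1.comp_tendsto hw
    have o2' := o2.comp_tendsto hw
    have hne : ∀ᶠ z : ℂ in cocompact ℂ, z ≠ 0 := by
      rw [← Metric.cobounded_eq_cocompact]
      exact Bornology.eventually_ne_cobounded 0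
    have hev := hz.eventually_eq_ratMap_closedInv
    -- `1 / F(z) = O(1 / z)`
    have o3 : (fun z => (closedInv ρ κ α z)⁻¹) =O[cocompact ℂ] fun z => z⁻¹ := by
      have := o2'.mul (isBigO_refl (fun z : ℂ => z⁻¹) (cocompact ℂ))
      refine IsBigO.congr' this ?_ (by simp)
      filter_upwards [hne, hev] with z h1 h2
      have hv0 := ne_zero_of_closedExterior (exteriorDisk_subset_closedExterior h2.1)
      have e1 := ratMap_inv_eq (ρ := ρ) (κ := κ) (α := α) (inv_ne_zero hv0)
      rw [inv_inv, h2.2] at e1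
      simp only [Function.comp]
      rw [mul_inv_eq_iff_eq_mul₀ h1]
      rw [eq_inv_mul_iff_mul_eq₀ hv0]
      exact e1.symm
    have o4 := (o1'.trans o3).mul (isBigO_refl (fun z : ℂ => z⁻¹) (cocompact ℂ))
    refine IsBigO.congr' o4 ?_ (Eventually.of_forall fun z => by simp only; rw [pow_two, mul_inv])
    filter_upwards [hne, hev, hw.eventually (eventually_sub_ne_zero h0)] with z h1 h2 h4
    have hv0 := ne_zero_of_closedExterior (exteriorDisk_subset_closedExterior h2.1)
    have e1 := ratMap_inv_eq (ρ := ρ) (κ := κ) (α := α) (inv_ne_zero hv0)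
    have e2 := ratMap_eq_mul_quotAtZero (ρ := ρ) (κ := κ) h0 h4
    have e3 := hz.schwarz_ratMap h2.1
    rw [inv_inv, h2.2] at e1
    rw [h2.2] at e3
    rw [e3, one_div, e2]
    simp only [Function.comp, hE]
    have e4 : mulAtInfinity ρ κ α (closedInv ρ κ α z)⁻¹ = (closedInv ρ κ α z)⁻¹ * z := by
      rw [eq_inv_mul_iff_mul_eq₀ hv0]; exact e1.symm
    rw [e4]
    field_simp

theorem isConformalRegion : IsConformalRegion a c t (omittedSet ρ κ α) ρ κ α := by
  have hp := hz.isUnivalentParam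
  refine ⟨hp.rho_pos, hp.kappa_pos, hp.alpha_pos, hp.alpha_lt_one, hp.isCompact_omittedSet,
    hp.isSimplyConnected_omittedSet, analyticOnNhd_ratMap hp.alpha_pos hp.alpha_lt_one, ?_,
    hz.isSchwarzFunction⟩
  have := (hp.injOn_closedExterior.mono exteriorDisk_subset_closedExterior).bijOn_image
  rwa [omittedSet, compl_compl]

end IsSecondZero

/-! ### Positivity outside the region -/

/-- The effective potential up to an additive constant, away from the singularity `a`. -/
noncomputable def reducedPotential (a c t ρ κ α β : ℝ) (z : ℂ) : ℝ :=
  ‖z‖ ^ 2 - 2 * c * Real.log ‖z - a‖ - potential a c t ρ κ α β z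

/-- The function `exp (-reducedPotential)`, extended continuously by `0` to `a`, where the potential
is `+∞`. Its maximum points are the minimum points of the effective potential. -/
noncomputable def boltzmann (a c t ρ κ α β : ℝ) (z : ℂ) : ℝ :=
  Real.exp (potential a c t ρ κ α β z - ‖z‖ ^ 2) * ‖z - a‖ ^ (2 * c)

theorem boltzmann_eq_exp {a c t ρ κ α β : ℝ} {z : ℂ} (hz : z ≠ a) :
    boltzmann a c t ρ κ α β z = Real.exp (-reducedPotential a c t ρ κ α β z) := by
  unfold boltzmann reducedPotential
  rw [Real.rpow_def_of_pos (norm_pos_iff.2 (sub_ne_zero.2 hz)), ← Real.exp_add]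
  congr 1; ring

theorem reducedPotential_of_mem {a c t ρ κ α β : ℝ} {z : ℂ} (h : z ∈ omittedSet ρ κ α) :
    reducedPotential a c t ρ κ α β z = boundaryConst a c t κ α := by
  unfold reducedPotential potential
  rw [if_pos h]; ring

/-- At the real point `x` with `f(x) = f(1/x)`, the relation `S(f(v)) = f(1/v)` gives
`S'(f(x)) = -f'(1/x) / (x² f'(x))`; the inequality says that this is less than `-1`. -/
theorem sq_mul_deriv_lt {ρ κ α x : ℝ} (hp : IsUnivalentParam ρ κ α) (hx : 1 < x)
    (hxe : ρ * (x - α) * (1 - α * x) + κ * x = 0) :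
    x ^ 2 * (ρ + κ / (x - α) ^ 2) < ρ + κ / (1 / x - α) ^ 2 := by
  have hρ := hp.rho_pos
  have h1 := hp.alpha_lt_one
  have hxα : 0 < x - α := by linarith
  have hx0 : 0 < x := by linarith
  have hκ : κ = ρ * (x - α) * (α * x - 1) / x := by
    rw [eq_div_iff hx0.ne']; linarith
  have hax : 0 < α * x - 1 := by
    have h := hp.kappa_pos
    rw [hκ, div_pos_iff_of_pos_right hx0] at h
    exact pos_of_mul_pos_right h (mul_pos hρ hxα).le
  have hlt : x * (α * x - 1) < x - α := by
    have h := hp.kappa_lt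
    rw [hκ, div_lt_iff₀ hx0] at h
    have : ρ * ((x - α) * (α * x - 1)) < ρ * ((1 - α ^ 2) * x) := by linarith
    have := lt_of_mul_lt_mul_left this hρ.le
    nlinarith
  have e0 : 1 / x - α = -((α * x - 1) / x) := by field_simp; ring
  have e1 : x ^ 2 * (ρ + κ / (x - α) ^ 2) =
      ρ * x * (x * (x - α) + (α * x - 1)) / (x - α) := by
    rw [hκ]; field_simp
  have e2 : ρ + κ / (1 / x - α) ^ 2 = ρ * (x * (x - α) + (α * x - 1)) / (α * x - 1) := by
    obtain ⟨d, hd⟩ : ∃ d, α * x - 1 = d := ⟨_, rfl⟩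
    have hd0 : d ≠ 0 := hd ▸ hax.ne'
    rw [e0, hκ, hd]; field_simp; ring
  rw [e1, e2, div_lt_div_iff₀ hxα hax]
  have hpos : 0 < ρ * (x * (x - α) + (α * x - 1)) := by positivity
  nlinarith [mul_lt_mul_of_pos_left hlt hpos]

/-- The only points `|v| > 1` with `f(conj v) = f(1/v)` are real. These are the critical points of
the effective potential, where `S(z) = conj z`. -/
theorem critical_point_real {ρ κ α : ℝ} (hp : IsUnivalentParam ρ κ α) {v : ℂ}
    (hv : v ∈ exteriorDisk) (hαv : (α : ℂ) * v - 1 ≠ 0)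
    (h : ratMap ρ κ α (starRingEnd ℂ v) = ratMap ρ κ α (1 / v)) :
    ∃ x : ℝ, v = x ∧ 1 < x ∧ ρ * (x - α) * (1 - α * x) + κ * x = 0 := by
  have hve := exteriorDisk_subset_closedExterior hv
  have hv1 : 1 < ‖v‖ := hv
  have hv0 := ne_zero_of_closedExterior hve
  have hcv : starRingEnd ℂ v - α ≠ 0 :=
    sub_ne_zero_of_closedExterior hp.alpha_pos hp.alpha_lt_one
      (by rw [mem_closedExterior, Complex.norm_conj]; exact hve)
  have hne : starRingEnd ℂ v - 1 / v ≠ 0 := by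
    intro h'
    have e : v * starRingEnd ℂ v = 1 := by rw [sub_eq_zero.1 h']; field_simp
    rw [Complex.mul_conj'] at e
    have : ‖v‖ ^ 2 = 1 := by exact_mod_cast e
    nlinarith
  have hden : 1 / v - (α : ℂ) ≠ 0 := by
    have : 1 / v - (α : ℂ) = -((α * v - 1) / v) := by field_simp; ring
    rw [this]; exact neg_ne_zero.2 (div_ne_zero hαv hv0)
  have h1 : (ρ : ℂ) * (starRingEnd ℂ v - α) * (1 - α * v) + κ * v = 0 := by
    have e := hp.ratMap_sub_ratMap hcv hden
    have e' := hp.sub_conjugateRoot hden (starRingEnd ℂ v) hcv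
    rw [sub_eq_zero.2 h] at e
    have e2 : (starRingEnd ℂ v - 1 / v) * (ρ + κ / ((starRingEnd ℂ v - α) * (1 / v - α))) = 0 := by
      rw [← e', e]; ring
    have e3 := (mul_eq_zero.1 e2).resolve_left hne
    have e4 : 1 / v - (α : ℂ) = (1 - α * v) / v := by field_simp
    have hd : (1 : ℂ) - α * v ≠ 0 := by rw [← neg_sub]; exact neg_ne_zero.2 hαv
    rw [e4] at e3
    generalize (1 : ℂ) - α * v = d at *
    field_simp at e3
    linear_combination e3
  have him := congrArg Complex.im h1
  have hre := congrArg Complex.re h1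
  simp at him hre
  have hy : v.im = 0 := by
    have : v.im * (κ - ρ * (1 - α ^ 2)) = 0 := by linear_combination him
    rcases mul_eq_zero.1 this with h | h
    · exact h
    · have := hp.kappa_lt; linarith
  have hvx : v = (v.re : ℂ) := Complex.ext (by simp) (by simp [hy])
  rw [hy] at hre
  have hxe : ρ * (v.re - α) * (1 - α * v.re) + κ * v.re = 0 := by linear_combination hre
  refine ⟨v.re, hvx, ?_, hxe⟩
  rw [hvx, Complex.norm_real, Real.norm_eq_abs, lt_abs] at hv1
  rcases hv1 with h | h
  · exact h
  · exfalso
    have h0 := hp.alpha_pos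
    have a1 : 0 < α - v.re := by linarith
    have a2 : 0 < 1 - α * v.re := by nlinarith
    have a3 := mul_pos (mul_pos hp.rho_pos a1) a2
    have a4 : 0 < κ * (-v.re) := mul_pos hp.kappa_pos (by linarith)
    nlinarith

namespace IsSecondZero

variable {a c t ρ κ α β : ℝ} (hz : IsSecondZero a c t ρ κ α β)
include hz

theorem continuous_potential : Continuous (potential a c t ρ κ α β) :=
  continuous_iff_continuousAt.2 fun z => (hz.hasFDerivAt_potential z).continuousAt

theorem hasFDerivAt_reducedPotential {z : ℂ} (hza : z ≠ a) :
    HasFDerivAt (reducedPotential a c t ρ κ α β)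
      (reForm (starRingEnd ℂ z - (gradField a c ρ κ α β z + c / (z - a)))) z := by
  have d1 : HasFDerivAt (fun z : ℂ => ‖z‖ ^ 2) (2 • (innerSL ℝ) z) z :=
    (hasStrictFDerivAt_norm_sq z).hasFDerivAt
  have d2 := (hasFDerivAt_log_norm (a : ℂ) (sub_ne_zero.2 hza)).const_mul (2 * c)
  refine ((d1.sub d2).sub (hz.hasFDerivAt_potential z)).congr_fderiv ?_
  have hza' := sub_ne_zero.2 hza
  ext h'
  have e0 : ((2 • (innerSL ℝ) z : ℂ →L[ℝ] ℝ) - (2 * c) • reForm (1 / (2 * (z - a))) -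
      reForm (gradField a c ρ κ α β z)) h' =
      2 * (starRingEnd ℂ z * h').re - 2 * c * (2 * (1 / (2 * (z - a)) * h').re) -
        2 * (gradField a c ρ κ α β z * h').re := by
    simp [Complex.inner]
    ring
  have e1 : 1 / (2 * (z - a)) * h' = ((1 / 2 : ℝ) : ℂ) * (h' / (z - a)) := by
    push_cast; field_simp
  have e2 : (starRingEnd ℂ z - (gradField a c ρ κ α β z + c / (z - a))) * h' =
      starRingEnd ℂ z * h' - gradField a c ρ κ α β z * h' - (c : ℂ) * (h' / (z - a)) := by ring
  rw [e0, reForm_apply, e1, e2, Complex.sub_re, Complex.sub_re, Complex.re_ofReal_mul,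
    Complex.re_ofReal_mul]
  ring

theorem gradField_add_ratMap {v : ℂ} (hv : v ∈ closedExterior) (hva : ratMap ρ κ α v ≠ a) :
    gradField a c ρ κ α β (ratMap ρ κ α v) + c / (ratMap ρ κ α v - a) = ratMap ρ κ α (1 / v) := by
  rw [hz.gradField_ratMap hv, ← hz.outerField_eq hv hva, sub_add_cancel]

/-- Outside the region the reduced potential has no local minimum: its critical points are real, and
there the second derivative in the vertical direction, `2 + 2 S'`, is negative. -/
theorem not_isLocalMin_reducedPotential {z : ℂ} (hzK : z ∉ omittedSet ρ κ α) (hza : z ≠ a) :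
    ¬ IsLocalMin (reducedPotential a c t ρ κ α β) z := by
  intro hmin
  have hp := hz.isUnivalentParam
  set S : ℂ → ℂ := fun z => gradField a c ρ κ α β z + c / (z - a) with hS
  have hcrit : starRingEnd ℂ z = S z := by
    have h0 := hmin.hasFDerivAt_eq_zero (hz.hasFDerivAt_reducedPotential hza)
    have h1 := congrArg (fun L : ℂ →L[ℝ] ℝ => L (starRingEnd ℂ (starRingEnd ℂ z - S z))) h0
    simp only [reForm_apply, zero_apply] at h1
    rw [Complex.mul_conj', ← Complex.ofReal_pow, Complex.ofReal_re] at h1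
    have h2 : ‖starRingEnd ℂ z - S z‖ ^ 2 = 0 := by linarith
    exact sub_eq_zero.1 (norm_eq_zero.1 (pow_eq_zero_iff two_ne_zero |>.1 h2))
  obtain ⟨v, hv, rfl⟩ := not_not.1 hzK
  have hve := exteriorDisk_subset_closedExterior hv
  have hvα := hz.sub_alpha_ne_zero hve
  have hαv := hz.mul_sub_one_ne_zero hza hvα
  have hSv : S (ratMap ρ κ α v) = ratMap ρ κ α (1 / v) := hz.gradField_add_ratMap hve hza
  rw [conj_ratMap, hSv] at hcrit
  obtain ⟨x, rfl, hx, hxe⟩ := critical_point_real hp hv hαv hcrit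
  have hx0 : (x : ℂ) ≠ 0 := ne_zero_of_closedExterior hve
  -- the derivative of the Schwarz function at the critical point
  obtain ⟨s, hs⟩ : DifferentiableAt ℂ S (ratMap ρ κ α x) :=
    (hz.differentiableAt_gradField hzK).add
      ((differentiableAt_const _).div (by fun_prop) (sub_ne_zero.2 hza))
  have hsd : HasDerivAt S (s 1) (ratMap ρ κ α x) := hs.hasDerivAt
  have hfd := hasDerivAt_ratMap ρ κ α hvα
  have hxα' : (x : ℂ)⁻¹ - α ≠ 0 := by
    have : (x : ℂ)⁻¹ - (α : ℂ) = -((α * x - 1) / x) := by field_simp; ring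
    rw [this]; exact neg_ne_zero.2 (div_ne_zero hαv hx0)
  have hd1 : HasDerivAt (fun v : ℂ => S (ratMap ρ κ α v)) (s 1 * (ρ + κ / (x - α) ^ 2)) x :=
    hsd.comp (x : ℂ) hfd
  have hd2 : HasDerivAt (fun v : ℂ => ratMap ρ κ α (v⁻¹))
      ((ρ + κ / ((x : ℂ)⁻¹ - α) ^ 2) * (-((x : ℂ) ^ 2)⁻¹)) x :=
    (hasDerivAt_ratMap ρ κ α hxα').comp (x : ℂ) (hasDerivAt_inv hx0)
  have hopen : IsOpen exteriorDisk := by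
    rw [exteriorDisk_eq_compl]; exact Metric.isClosed_closedBall.isOpen_compl
  have hev : (fun v : ℂ => S (ratMap ρ κ α v)) =ᶠ[𝓝 (x : ℂ)] fun v => ratMap ρ κ α v⁻¹ := by
    filter_upwards [hopen.mem_nhds hv, hfd.continuousAt.eventually_ne hza] with w h1 h2
    rw [hS]
    simp only
    rw [hz.gradField_add_ratMap (exteriorDisk_subset_closedExterior h1) h2, one_div]
  have hsv : s 1 * (ρ + κ / (x - α) ^ 2) = (ρ + κ / ((x : ℂ)⁻¹ - α) ^ 2) * (-((x : ℂ) ^ 2)⁻¹) :=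
    hd1.unique (hd2.congr_of_eventuallyEq hev)
  have hlt := sq_mul_deriv_lt hp hx hxe
  have hfpos : 0 < ρ + κ / (x - α) ^ 2 := by
    have := hp.kappa_pos; have := hp.rho_pos; positivity
  have hsre : (s 1).re < -1 := by
    set A := ρ + κ / (x - α) ^ 2
    set B := ρ + κ / (1 / x - α) ^ 2 with hB
    have hxx : 0 < x ^ 2 := by positivity
    have e : s 1 = ((-B / (x ^ 2 * A) : ℝ) : ℂ) := by
      have hA' : ((A : ℝ) : ℂ) ≠ 0 := by exact_mod_cast hfpos.ne'
      have hsv' : s 1 * ((A : ℝ) : ℂ) = ((B : ℝ) : ℂ) * (-((x : ℂ) ^ 2)⁻¹) := by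
        rw [hB, one_div]; push_cast; exact_mod_cast hsv
      rw [eq_div_of_mul_eq hA' hsv']
      push_cast
      field_simp
    rw [e, Complex.ofReal_re, neg_div, neg_lt_neg_iff, one_lt_div (by positivity)]
    exact hlt
  -- the restriction to the vertical line through the critical point
  set b := ratMap ρ κ α x with hb
  have hbre : (starRingEnd ℂ b) = b := by rw [hb, conj_ratMap, Complex.conj_ofReal]
  set g : ℝ → ℝ := fun y => reducedPotential a c t ρ κ α β (b + y * Complex.I) with hg
  have hline : ∀ y : ℝ, HasDerivAt (fun y : ℝ => b + y * Complex.I) Complex.I y := by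
    intro y
    have := ((Complex.ofRealCLM.hasDerivAt (x := y)).mul_const Complex.I).const_add b
    simpa using this
  have hline0 : b + ((0 : ℝ) : ℂ) * Complex.I = b := by simp
  have hlc : Tendsto (fun y : ℝ => b + y * Complex.I) (𝓝 0) (𝓝 b) := by
    have := (hline 0).continuousAt.tendsto
    rwa [hline0] at this
  have hg1 : ∀ᶠ y : ℝ in 𝓝 0, HasDerivAt g
      (2 * y + 2 * (S (b + y * Complex.I)).im) y := by
    filter_upwards [hlc.eventually (isOpen_ne.mem_nhds hza)] with y hy
    refine ((hz.hasFDerivAt_reducedPotential hy).comp_hasDerivAt y (hline y)).congr_deriv ?_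
    rw [reForm_apply, map_add, hbre, map_mul, Complex.conj_ofReal, Complex.conj_I]
    have hbim : b.im = 0 := Complex.conj_eq_iff_im.1 hbre
    simp [hS, hbim]
    ring
  have hderiv : deriv g =ᶠ[𝓝 0] fun y : ℝ => 2 * y + 2 * (S (b + y * Complex.I)).im :=
    hg1.mono fun y hy => hy.deriv
  have hg2 : HasDerivAt (fun y : ℝ => 2 * y + 2 * (S (b + y * Complex.I)).im)
      (2 + 2 * (s 1).re) 0 := by
    have k1 : HasDerivAt (fun y : ℝ => S (b + y * Complex.I)) (s 1 * Complex.I) 0 := by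
      have h' : HasDerivAt S (s 1) (b + ((0 : ℝ) : ℂ) * Complex.I) := by rw [hline0]; exact hsd
      exact h'.comp (0 : ℝ) (hline 0)
    have k2 := Complex.imCLM.hasFDerivAt.comp_hasDerivAt (0 : ℝ) k1
    have k3 := ((hasDerivAt_id (0 : ℝ)).const_mul 2).add (k2.const_mul 2)
    refine k3.congr_deriv ?_
    simp
  have hdd : deriv (deriv g) 0 < 0 := by
    rw [hderiv.deriv_eq, hg2.deriv]; linarith
  have hd0 : deriv g 0 = 0 := by
    have hgmin : IsLocalMin g 0 := by
      have := hlc.eventually hmin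
      filter_upwards [this] with y hy
      simp only [hg]; rw [hline0]; exact hy
    exact hgmin.deriv_eq_zero
  have hmax := isLocalMax_of_deriv_deriv_neg hdd hd0 hg1.self_of_nhds.continuousAt
  have hconst : g =ᶠ[𝓝 0] fun _ => g 0 := by
    filter_upwards [hmax, hlc.eventually hmin] with y h1 h2
    refine le_antisymm h1 ?_
    simp only [hg]; rw [hline0]; exact h2
  have : deriv (deriv g) 0 = 0 := by
    rw [hconst.deriv.deriv_eq]; simp
  linarith

theorem c_pos : 0 < c := by
  have h0 := hz.alpha_pos
  have h1 := hz.alpha_lt_one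
  have h2 := sub_pos.2 hz.beta_lt
  have h3 : 0 < 1 - α * β := by
    have := hz.beta_pos; have := hz.beta_lt; nlinarith
  have := hz.rho_pos
  rw [hz.c_eq]; positivity

theorem continuous_boltzmann : Continuous (boltzmann a c t ρ κ α β) := by
  have := hz.continuous_potential
  have hc := hz.c_pos
  unfold boltzmann
  refine Continuous.mul (by fun_prop) (Continuous.rpow_const (by fun_prop) fun _ => Or.inr ?_)
  positivity

theorem tendsto_reducedPotential :
    Tendsto (reducedPotential a c t ρ κ α β) (cocompact ℂ) atTop := by
  have hn : Tendsto (fun z : ℂ => ‖z‖) (cocompact ℂ) atTop := tendsto_norm_cocompact_atTop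
  have hna : Tendsto (fun z : ℂ => ‖z - a‖) (cocompact ℂ) atTop :=
    tendsto_atTop_mono (fun z => norm_sub_norm_le z (a : ℂ)) (tendsto_atTop_add_const_right _ _ hn)
  -- `x² - (2t + 2c) log x → ∞`, compared with `log x ≤ x`
  have hev : ∀ᶠ z in cocompact ℂ, ‖z‖ * (‖z‖ - (2 * |t| + 2 * c)) - (2 * c * ‖(a : ℂ)‖ +
      (-(2 * (t + c) * Real.log ρ) + 1)) ≤ reducedPotential a c t ρ κ α β z := by
    filter_upwards [hz.tendsto_potential.eventually_lt_const (lt_add_one _),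
      hn.eventually_ge_atTop 1, hna.eventually_gt_atTop 0] with z h1 h2 h3
    have hl0 : 0 ≤ Real.log ‖z‖ := Real.log_nonneg h2
    have hl : Real.log ‖z‖ ≤ ‖z‖ := (Real.log_le_sub_one_of_pos (by linarith)).trans (by linarith)
    have hla : Real.log ‖z - a‖ ≤ ‖z‖ + ‖(a : ℂ)‖ :=
      ((Real.log_le_sub_one_of_pos h3).trans (by linarith)).trans (norm_sub_le _ _)
    have hc := hz.c_pos
    have m1 : t * Real.log ‖z‖ ≤ |t| * ‖z‖ :=
      (mul_le_mul_of_nonneg_right (le_abs_self t) hl0).trans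
        (mul_le_mul_of_nonneg_left hl (abs_nonneg t))
    have m2 := mul_le_mul_of_nonneg_left hla hc.le
    unfold reducedPotential
    nlinarith
  refine tendsto_atTop_mono' _ hev ?_
  exact tendsto_atTop_add_const_right _ _
    (hn.atTop_mul_atTop₀ (tendsto_atTop_add_const_right _ _ hn))

/-- Outside the region the reduced potential exceeds its constant value on the region: otherwise
`boltzmann`, which vanishes at `a` and is small at infinity, would have a global maximum point
outside the region. -/
theorem lt_reducedPotential {z : ℂ} (hzK : z ∉ omittedSet ρ κ α) (hza : z ≠ a) :
    boundaryConst a c t κ α < reducedPotential a c t ρ κ α β z := by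
  by_contra hle
  push Not at hle
  have hc := hz.c_pos
  obtain ⟨k, hk⟩ := hz.isUnivalentParam.isSimplyConnected_omittedSet.nonempty
  have hka : k ≠ a := fun e => hz.a_notMem (e ▸ hk)
  have hNk : boltzmann a c t ρ κ α β k = Real.exp (-boundaryConst a c t κ α) := by
    rw [boltzmann_eq_exp hka, reducedPotential_of_mem hk]
  have hpos : 0 < boltzmann a c t ρ κ α β k := by rw [hNk]; exact Real.exp_pos _
  have hzk : boltzmann a c t ρ κ α β k ≤ boltzmann a c t ρ κ α β z := by
    rw [hNk, boltzmann_eq_exp hza, Real.exp_le_exp]; linarith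
  obtain ⟨m, hm⟩ := hz.continuous_boltzmann.exists_forall_ge' k (by
    have hne : ∀ᶠ w in cocompact ℂ, w ≠ (a : ℂ) := by
      rw [← Metric.cobounded_eq_cocompact]; exact Bornology.eventually_ne_cobounded _
    filter_upwards [hne, hz.tendsto_reducedPotential.eventually_ge_atTop (boundaryConst a c t κ α)]
      with w h1 h2
    rw [hNk, boltzmann_eq_exp h1, Real.exp_le_exp]; linarith)
  -- a global maximum point of `boltzmann` outside the region
  obtain ⟨m, hmK, hm⟩ : ∃ m, m ∉ omittedSet ρ κ α ∧
      ∀ w, boltzmann a c t ρ κ α β w ≤ boltzmann a c t ρ κ α β m := by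
    by_cases h : m ∈ omittedSet ρ κ α
    · refine ⟨z, hzK, fun w => (hm w).trans ?_⟩
      have hma : m ≠ a := fun e => hz.a_notMem (e ▸ h)
      rw [boltzmann_eq_exp hma, reducedPotential_of_mem h, ← hNk]
      exact hzk
    · exact ⟨m, h, hm⟩
  have hma : m ≠ a := by
    rintro rfl
    have h1 := hm k
    have h2 : boltzmann a c t ρ κ α β a = 0 := by
      unfold boltzmann
      rw [sub_self, norm_zero, Real.zero_rpow (by positivity), mul_zero]
    linarith
  refine hz.not_isLocalMin_reducedPotential hmK hma ?_
  filter_upwards [isOpen_ne.mem_nhds hma] with w hw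
  have := hm w
  rw [boltzmann_eq_exp hw, boltzmann_eq_exp hma, Real.exp_le_exp] at this
  linarith

end IsSecondZero

/-! ### The equilibrium conditions -/

theorem effectivePotential_singularity (a c l : ℝ) (K : Set ℂ) :
    effectivePotential a c K l a = ⊤ := by
  unfold effectivePotential externalPotential
  rw [if_pos rfl, EReal.top_sub_coe, EReal.top_add_coe]

namespace IsSecondZero

variable {a c t ρ κ α β : ℝ} (hz : IsSecondZero a c t ρ κ α β)
include hz

theorem effectivePotential_eq {z : ℂ} (hza : z ≠ a) (l : ℝ) :
    effectivePotential a c (omittedSet ρ κ α) l z =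
      ((reducedPotential a c t ρ κ α β z - 2 * (t + c) * Real.log ρ + l : ℝ) : EReal) := by
  unfold effectivePotential externalPotential
  rw [if_neg hza, ← EReal.coe_sub, ← EReal.coe_add, hz.integral_log z]
  congr 1
  unfold reducedPotential
  rw [one_div, Real.log_inv]
  have := Real.pi_pos
  field_simp
  ring

theorem conditionA : ConditionA a c (omittedSet ρ κ α)
    (2 * (t + c) * Real.log ρ - boundaryConst a c t κ α) := by
  intro z h
  rw [hz.effectivePotential_eq (fun e => hz.a_notMem (e ▸ h)), reducedPotential_of_mem h,
    ← EReal.coe_zero]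
  congr 1; ring

theorem conditionB : ConditionB a c (omittedSet ρ κ α)
    (2 * (t + c) * Real.log ρ - boundaryConst a c t κ α) := by
  intro z h
  by_cases hza : z = a
  · rw [hza, effectivePotential_singularity]; exact EReal.zero_lt_top
  · rw [hz.effectivePotential_eq hza, ← EReal.coe_zero, EReal.coe_lt_coe_iff]
    have := hz.lt_reducedPotential h hza
    linarith

end IsSecondZero

theorem setOf_minimum_eq {a c l : ℝ} {K : Set ℂ} (hK : K.Nonempty) (hA : ConditionA a c K l)
    (hB : ConditionB a c K l) :
    {z : ℂ | ∀ w : ℂ, effectivePotential a c K l z ≤ effectivePotential a c K l w} = K := by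
  ext z
  constructor
  · intro h
    by_contra hzK
    obtain ⟨k, hk⟩ := hK
    have h1 := h k
    rw [hA k hk] at h1
    exact absurd (hB z hzK) (not_lt.2 h1)
  · intro hzK w
    rw [hA z hzK]
    by_cases hw : w ∈ K
    · exact (hA w hw).ge
    · exact (hB w hw).le

end NormalMatrixModel

theorem mainTheorem7 (a c t : ℝ) (ha : 0 < a) (hc : 0 < c) (ht : 0 < t)
    (htc : t < a * (a + 2 * Real.sqrt c)) :
    (∃! α : ℝ, IsAdmissibleAlpha a c t α) ∧
    ∀ (α ρ κ : ℝ) (K : Set ℂ), IsAdmissibleAlpha a c t α →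
      ρ = rhoParam a t α → κ = kappaParam a t α → K = enclosedRegion ρ κ α →
      -- the curve `f(|v| = 1)` is a regular Jordan curve, and it bounds the region `K`
      InjOn (ratMap ρ κ α) unitCircle ∧
      (∀ v ∈ unitCircle, deriv (ratMap ρ κ α) v ≠ 0) ∧
      frontier K = ratMap ρ κ α '' unitCircle ∧
      IsConnected (interior K) ∧ closure (interior K) = K ∧
      -- `K` is the unique simply connected compact region given by a conformal map `f`
      IsConformalRegion a c t K ρ κ α ∧
      κ / ρ ≤ 1 - α ^ 2 ∧
      (∀ (K' : Set ℂ) (ρ' κ' α' : ℝ), IsConformalRegion a c t K' ρ' κ' α' →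
        K' = K ∧ ρ' = ρ ∧ κ' = κ ∧ α' = α) ∧
      -- the equilibrium conditions, with a convergent logarithmic potential
      (∀ z : ℂ, IntegrableOn (fun w : ℂ => Real.log ‖z - w‖) K) ∧
      ∃ l : ℝ, ConditionA a c K l ∧ ConditionB a c K l ∧
        {z : ℂ | ∀ w : ℂ, effectivePotential a c K l z ≤ effectivePotential a c K l w} = K := by
  have huniq := existsUnique_isAdmissibleAlpha ha hc ht htc
  refine ⟨huniq, ?_⟩
  rintro α ρ κ K hα hρ hκ rfl
  have hp : IsUnivalentParam ρ κ α := by rw [hρ, hκ]; exact hα.isUnivalentParam ha ht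
  have hm : IsMatched a c t ρ κ α := by rw [hρ, hκ]; exact hα.isMatched ha
  obtain ⟨β, hz⟩ := hm.exists_isSecondZero hp
  rw [hp.enclosedRegion_eq_omittedSet]
  have hne := hp.isSimplyConnected_omittedSet.nonempty
  refine ⟨hp.injOn_closedExterior.mono unitCircle_subset_closedExterior, fun v hv => ?_,
    hp.frontier_omittedSet, hp.isConnected_interior_omittedSet, hp.closure_interior_omittedSet,
    hz.isConformalRegion, ?_, fun K' ρ' κ' α' h' => ?_, fun z => ?_,
    _, hz.conditionA, hz.conditionB, setOf_minimum_eq hne hz.conditionA hz.conditionB⟩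
  · have hve := unitCircle_subset_closedExterior hv
    rw [(hasDerivAt_ratMap ρ κ α (hz.sub_alpha_ne_zero hve)).deriv]
    exact hp.deriv_ne_zero hve
  · rw [div_le_iff₀ hp.rho_pos, mul_comm]
    exact hp.kappa_lt.le
  · obtain ⟨h1, h2, h3⟩ := h'.isMatched.eq_params ha h'.alpha_pos h'.alpha_lt_one h'.kappa_pos
    obtain rfl : α' = α := huniq.unique h1 hα
    obtain rfl : ρ' = ρ := h2.trans hρ.symm
    obtain rfl : κ' = κ := h3.trans hκ.symm
    refine ⟨?_, rfl, rfl, rfl⟩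
    rw [omittedSet, h'.bijective.image_eq, compl_compl]
  · have := integrableOn_log_norm_sub hp.isCompact_omittedSet z
    simp only [norm_sub_rev z]
    exact this
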